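/- Let $q$ be a prime power, $n\ge 1$, $k>3$, and let $0=i_0<i_1<\dots<i_{k-1}$ be integers. For $z=(z_1,\dots,z_{k-3})\in\mathbb F_{q^n}^{k-3}$, and for elements $x_1,\dots,x_r$ of a commutative ring and integers $e_1,\dots,e_r\ge 0$, write $\Delta(x_1,\dots,x_r;e_1,\dots,e_r)=\det\bigl(x_a^{q^{e_b}}\bigr)_{1\le a,b\le r}$, and put $$L(U,z)=\Delta(U,z_1,\dots,z_{k-3},1;\;0,i_2,\dots,i_{k-1}),$$ $$M(U,z)=\Delta(U,z_1,\dots,z_{k-3},1;\;0,i_2-i_1,\dots,i_{k-1}-i_1),$$ $$N(z)=\Delta(z_1,\dots,z_{k-3},1;\;i_2-i_1,\dots,i_{k-1}-i_1),$$ $$F(X,Y)=\Delta(X,Y,z_1,\dots,z_{k-3},1;\;0,i_1,i_2,\dots,i_{k-1}),$$ $$G(X,Y)=\Delta(X,Y,z_1,\dots,z_{k-3},1;\;0,1,2,\dots,k-1).$$ Suppose that $z\in\mathbb F_{q^n}^{k-3}$ satisfies $N(z)\ne 0$ and that $M(U,z)$ does not divide $L(U,z)$ in $\mathbb F_{q^n}[U]$.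 Suppose moreover that $q\ge 7$, or $q\in\{3,4,5\}$ and $i_1>1$, or $q=2$ and $i_1>2$. Then $G\neq 0$, $G$ divides $F$ in $\mathbb F_{q^n}[X,Y]$, and the affine plane curve $F(X,Y)/G(X,Y)=0$ has a non-repeated $\mathbb F_{q^n}$-rational absolutely irreducible component; that is, there is a polynomial $P\in\mathbb F_{q^n}[X,Y]$, irreducible over every algebraic extension of $\mathbb F_{q^n}$, such that $P$ divides $F/G$ and $P^2$ does not divide $F/G$. -/

import Mathlib

/-- The generalized Moore determinant `det (x_a ^ (q ^ e_b))`: row `a` is given by the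
element `x a`, column `b` by the exponent `e b`. -/
def mooreDet {R : Type*} [CommRing R] (q : ℕ) {r : ℕ} (x : Fin r → R) (e : Fin r → ℕ) : R :=
  (Matrix.of fun a b : Fin r => x a ^ q ^ e b).det

/-- `N(z₁, …, z_m)`: rows `z₁, …, z_m, 1`, columns `i_2 - i_1, …, i_{m+2} - i_1`. -/
def polyN {K : Type*} [Field K] (q : ℕ) (i : ℕ → ℕ) {m : ℕ} (z : Fin m → K) : K :=
  mooreDet q (Fin.snoc z 1 : Fin (m + 1) → K) (fun b => i (b + 2) - i 1)

/-- `L(U, z₁, …, z_m)` as a polynomial in `U`: rows `U, z₁, …, z_m, 1`,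
columns `0, i_2, …, i_{m+2}`. -/
noncomputable def polyL {K : Type*} [Field K] (q : ℕ) (i : ℕ → ℕ) {m : ℕ} (z : Fin m → K) :
    Polynomial K :=
  mooreDet q
    (Fin.cons Polynomial.X (Fin.snoc (fun a => Polynomial.C (z a)) 1 : Fin (m + 1) → Polynomial K))
    (Fin.cons 0 fun b : Fin (m + 1) => i (b + 2))

/-- `M(U, z₁, …, z_m)` as a polynomial in `U`: rows `U, z₁, …, z_m, 1`,
columns `0, i_2 - i_1, …, i_{m+2} - i_1`. -/
noncomputable def polyM {K : Type*} [Field K] (q : ℕ) (i : ℕ → ℕ) {m : ℕ} (z : Fin m → K) :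
    Polynomial K :=
  mooreDet q
    (Fin.cons Polynomial.X (Fin.snoc (fun a => Polynomial.C (z a)) 1 : Fin (m + 1) → Polynomial K))
    (Fin.cons 0 fun b : Fin (m + 1) => i (b + 2) - i 1)

/-- The rows `X, Y, z₁, …, z_m, 1` over `K[X, Y]`. -/
noncomputable def curveRows {K : Type*} [Field K] {m : ℕ} (z : Fin m → K) :
    Fin (m + 3) → MvPolynomial (Fin 2) K :=
  Fin.cons (MvPolynomial.X 0) (Fin.cons (MvPolynomial.X 1)
    (Fin.snoc (fun a => MvPolynomial.C (z a)) 1 : Fin (m + 1) → MvPolynomial (Fin 2) K))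

/-- `F(X, Y)`: rows `X, Y, z₁, …, z_m, 1`, columns `i_0, i_1, …, i_{m+2}`. -/
noncomputable def polyF {K : Type*} [Field K] (q : ℕ) (i : ℕ → ℕ) {m : ℕ} (z : Fin m → K) :
    MvPolynomial (Fin 2) K :=
  mooreDet q (curveRows z) (fun b => i b)

/-- `G(X, Y)`: rows `X, Y, z₁, …, z_m, 1`, columns `0, 1, …, m + 2`. -/
noncomputable def polyG {K : Type*} [Field K] (q : ℕ) {m : ℕ} (z : Fin m → K) :
    MvPolynomial (Fin 2) K :=
  mooreDet q (curveRows z) (fun b => (b : ℕ))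

/-- A polynomial over `K` is absolutely irreducible if it is irreducible over every algebraic
extension of `K`. (Every algebraic extension of `K` is isomorphic to one in the universe of `K`.) -/
def IsAbsolutelyIrreducible.{u, v} {K : Type u} [Field K] {σ : Type v}
    (P : MvPolynomial σ K) : Prop :=
  ∀ (E : Type u) [Field E] [Algebra K E] [Algebra.IsAlgebraic K E],
    Irreducible (MvPolynomial.map (algebraMap K E) P)

/-- The curve `P = 0` is a non-repeated `K`-rational absolutely irreducible component of the
affine plane curve `H = 0`. -/
def IsNonrepeatedAbsIrredComponent {K : Type*} [Field K] (P H : MvPolynomial (Fin 2) K) : Prop :=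
  IsAbsolutelyIrreducible P ∧ P ∣ H ∧ ¬ P ^ 2 ∣ H

/-! Put `Q = q ^ i 1`, a power of the characteristic p. Sylvester's identity gives N^Q F = L(X)
M(Y)^Q - M(X)^Q L(Y) (`polyN_pow_mul_mooreDet`), so F = 0 is the fibre product with itself of the
map v ↦ u = M(v)^Q / L(v). Since L and M are additive polynomials, the roots v of u L(v) = M(v)^Q
form a finite elementary abelian p-group V. Let C be the algebraic closure of K, Ω the splitting
field over C(u), G the Galois group of Ω over C(u), and Γ the group of automorphisms of Ω over K
fixing u.

A pair (x, y) of roots with y not constant is a generic point of a component of F. That component is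
defined over K as soon as the orbit of x under the stabilizer G_y is stable under Γ_y. The
polynomial G is a nonzero constant times a product of linear forms, so it does not vanish at (x, y)
when G_y moves x. Multiplicity is no obstacle: ∂F/∂X is a constant times M(Y)^Q, nonzero at (x, y).
It remains to find an orbit of G_y, with more than one point, that is stable under Γ_y
(`InertialSystem.hasCanonicalOrbit`).

The orbit comes from the places above u = 0. Each place j yields the group U j of roots in its
maximal ideal inside the group A j of roots in its valuation ring. Comparing places of C(x), C(y)
and Ω shows that the decomposition group at j is transitive on nonconstant roots in a coset of U j
within A j, and on the roots outside A j. Comparing leading terms shows that its elements of p-power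
order fix U j pointwise. `inertialSystem` collects these facts, and the rest is group theory.

If A j = V, the groups fixing y at the places with y ∉ U j + W (W the constant roots) act like
transvection groups, and a counting argument needing |U j| ≥ Q ≥ 7 makes the generic elements of the
sum of these U j one orbit. If A j ≠ V, either two distinct groups A j belong to places with y ∈ U j
and their sum minus their intersection is an orbit, or y ↦ A j is a symmetric polarity, whose
perpendicular group P y or its complement supplies the orbit. -/

set_option linter.unusedSectionVars false

/-! ### Orbits of Sylow subgroups, and connectivity along cosets of a family of subgroups. -/

section

open MulAction

/-- The stabilizer of `x` in `S` is a p-subgroup of its stabilizer in `H`, so its order is at most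
the p-part there. Comparing p-parts, the orbit of `S` already has `p ^ n` points. -/
theorem Sylow.orbit_eq_of_card_orbit_eq_pow {p : ℕ} [Fact p.Prime] {H α : Type*} [Group H]
    [Finite H] [MulAction H α] (S : Sylow p H) {x : α} {n : ℕ}
    (hn : Nat.card (orbit H x) = p ^ n) : orbit S x = orbit H x := by
  have hp : p.Prime := Fact.out
  have hfin : (orbit H x).Finite := Set.finite_range _
  have hsub : orbit S x ⊆ orbit H x := by
    rintro _ ⟨g, rfl⟩
    exact ⟨(g : H), rfl⟩
  have h1 : Nat.card (orbit H x) * Nat.card (stabilizer H x) = Nat.card H := by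
    rw [Nat.card_coe_set_eq, ← index_stabilizer]
    exact (stabilizer H x).index_mul_card
  have h2 : Nat.card (orbit S x) * Nat.card (stabilizer S x) = Nat.card S := by
    rw [Nat.card_coe_set_eq, ← index_stabilizer]
    exact (stabilizer S x).index_mul_card
  have h3 : Nat.card (stabilizer S x) ∣ Nat.card (stabilizer H x) := by
    let f : stabilizer S x →* stabilizer H x :=
      { toFun := fun g => ⟨(g : S), g.2⟩
        map_one' := rfl
        map_mul' := fun _ _ => rfl }
    apply Subgroup.card_dvd_of_injective f
    intro a b hab
    have : ((a : S) : H) = ((b : S) : H) :=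
      congrArg (fun z : stabilizer H x => (z : H)) hab
    exact Subtype.ext (Subtype.ext this)
  obtain ⟨s, hs⟩ := (IsPGroup.iff_card.mp (S.isPGroup'.to_subgroup (stabilizer S x)))
  have h4 := S.card_eq_multiplicity
  rw [hs] at h3 h2
  have hne : Nat.card (stabilizer H x) ≠ 0 := Nat.card_pos.ne'
  have h5 : s ≤ (Nat.card (stabilizer H x)).factorization p :=
    (hp.pow_dvd_iff_le_factorization hne).mp h3
  have h6 : (Nat.card H).factorization p = n + (Nat.card (stabilizer H x)).factorization p := by
    rw [← h1, hn, Nat.factorization_mul (pow_ne_zero _ hp.ne_zero) hne, hp.factorization_pow]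
    simp
  have h7 : p ^ n ≤ Nat.card (orbit S x) := by
    rw [h4, h6] at h2
    have : p ^ n * p ^ s ≤ Nat.card (orbit S x) * p ^ s := by
      rw [h2, ← pow_add]
      exact Nat.pow_le_pow_right hp.pos (by omega)
    exact Nat.le_of_mul_le_mul_right this (pow_pos hp.pos _)
  apply Set.eq_of_subset_of_ncard_le hsub _ hfin
  rw [← Nat.card_coe_set_eq, ← Nat.card_coe_set_eq, hn]
  exact h7

/-- A family of subgroups of the same order, and an equivalence relation identifying `x` with
`x + b` for `b` in a member of the family not containing `x`: then the elements of the join not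
lying in the meet are all equivalent. -/
theorem rel_of_mem_iSup_of_notMem_iInf {V ι : Type*} [AddCommGroup V] [Finite V]
    (B : ι → AddSubgroup V) (hcard : ∀ i j, Nat.card (B i) = Nat.card (B j))
    (r : V → V → Prop) (hr : Equivalence r)
    (hB : ∀ i x b, b ∈ B i → x ∉ B i → r x (x + b))
    {x y : V} (hx : x ∈ ⨆ i, B i) (hy : y ∈ ⨆ i, B i) (hx' : ∃ i, x ∉ B i) (hy' : ∃ i, y ∉ B i) :
    r x y := by
  have hnle : ∀ i j, ¬ B i ≤ B j → ¬ B j ≤ B i := fun i j h h' => h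
    (AddSubgroup.eq_of_le_of_card_ge h' (hcard i j).le).ge
  -- Both `b` and `c` are equivalent to `b + c`.
  have key : ∀ i j b c, b ∈ B i → b ∉ B j → c ∈ B j → c ∉ B i → r b c := by
    intro i j b c hb hb' hc hc'
    have h1 := hB j b c hc hb'
    have h2 := hB i c b hb hc'
    rw [add_comm c b] at h2
    exact hr.trans h1 (hr.symm h2)
  have keydiff : ∀ i j b c, b ∈ B i → b ∉ B j → c ∈ B i → c ∉ B j → r b c := by
    intro i j b c hb hb' hc hc'
    obtain ⟨d, hd, hd'⟩ := SetLike.not_le_iff_exists.mp (hnle i j fun h => hb' (h hb))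
    exact hr.trans (key i j b d hb hb' hd hd') (hr.symm (key i j c d hc hc' hd hd'))
  -- If neither excluding subgroup serves both elements, `b + c` lies in neither of them and links
  -- the two.
  have key2 : ∀ i j k b c, b ∈ B i → b ∉ B j → c ∈ B i → c ∉ B k → r b c := by
    intro i j k b c hb hb' hc hc'
    by_cases h1 : b ∈ B k
    · by_cases h2 : c ∈ B j
      · have h3 : b + c ∈ B i := add_mem hb hc
        have h4 : b + c ∉ B j := fun h => hb' (by simpa using sub_mem h h2)
        have h5 : b + c ∉ B k := fun h => hc' (by simpa using sub_mem h h1)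
        exact hr.trans (keydiff i j _ _ hb hb' h3 h4) (keydiff i k _ _ h3 h5 hc hc')
      · exact keydiff i j b c hb hb' hc h2
    · exact keydiff i k b c hb h1 hc hc'
  have key3 : ∀ i j b k l c, b ∈ B i → b ∉ B j → c ∈ B k → c ∉ B l → r b c := by
    intro i j b k l c hb hb' hc hc'
    by_cases hik : B i ≤ B k
    · have : B i = B k := AddSubgroup.eq_of_le_of_card_ge hik (hcard k i).le
      rw [← this] at hc
      exact key2 i j l b c hb hb' hc hc'
    · obtain ⟨d, hd, hd'⟩ := SetLike.not_le_iff_exists.mp hik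
      obtain ⟨e, he, he'⟩ := SetLike.not_le_iff_exists.mp (hnle i k hik)
      exact hr.trans (key2 i j k b d hb hb' hd hd')
        (hr.trans (key i k d e hd hd' he he') (key2 k i l e c he he' hc hc'))
  obtain ⟨i0, hi0⟩ := hx'
  obtain ⟨i1, b0, hb0, hb0'⟩ : ∃ i1 b0, b0 ∈ B i1 ∧ b0 ∉ B i0 := by
    by_contra! h
    exact hi0 ((iSup_le fun i => h i : (⨆ i, B i) ≤ B i0) hx)
  -- Adding `b ∈ B i` to `z` either is a permitted move, or keeps the sum inside `B i`, where `key3`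
  -- applies.
  have main : ∀ z ∈ ⨆ i, B i, (∃ i, z ∉ B i) → r b0 z := by
    intro z hz
    rw [AddSubgroup.iSup_eq_closure] at hz
    induction hz using AddSubgroup.closure_induction_left with
    | zero => rintro ⟨i, hi⟩; exact absurd (zero_mem _) hi
    | add_left b hb z hz ih =>
      rintro ⟨k, hk⟩
      obtain ⟨i, hi⟩ := Set.mem_iUnion.mp hb
      by_cases hzi : z ∈ B i
      · exact key3 i1 i0 b0 i k _ hb0 hb0' (add_mem hi hzi) hk
      · rw [add_comm]
        exact hr.trans (ih ⟨i, hzi⟩) (hB i z b hi hzi)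
    | neg_add_cancel b hb z hz ih =>
      rintro ⟨k, hk⟩
      obtain ⟨i, hi⟩ := Set.mem_iUnion.mp hb
      by_cases hzi : z ∈ B i
      · exact key3 i1 i0 b0 i k _ hb0 hb0' (add_mem (neg_mem hi) hzi) hk
      · rw [add_comm]
        exact hr.trans (ih ⟨i, hzi⟩) (hB i z (-b) (neg_mem hi) hzi)
  exact hr.trans (hr.symm (main x hx ⟨i0, hi0⟩)) (main y hy hy')

end

/-! ### Transvection-like families: generic elements of a coset of the sum form one orbit. -/

section

open MulAction

/-- Groups `H j` acting on a finite abelian group so that `H j` moves each element within its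
coset of `U j`, and is transitive on the elements of a coset that it moves. -/
structure TransvectionFamily {Γ V ι : Type*} [Group Γ] [AddCommGroup V] [DistribMulAction Γ V]
    (U : ι → AddSubgroup V) (H : ι → Subgroup Γ) : Prop where
  smul_sub_mem : ∀ j, ∀ g ∈ H j, ∀ x, g • x - x ∈ U j
  fixed_or_exists : ∀ j x x', (∃ g ∈ H j, g • x ≠ x) → x' - x ∈ U j →
    (∀ g ∈ H j, g • x' = x') ∨ ∃ g ∈ H j, g • x = x'
  eq_zero : ∀ j x, x ∈ U j → (∀ g ∈ H j, g • x = x) → x = 0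
  card_le : ∀ j, 7 ≤ Nat.card (U j)

namespace TransvectionFamily

variable {Γ V ι : Type*} [Group Γ] [AddCommGroup V] [DistribMulAction Γ V]
  {U : ι → AddSubgroup V} {H : ι → Subgroup Γ}

/-- The orbit of `a` under the group generated by all the `H j` is not fixed by any `H j`. -/
def Full (H : ι → Subgroup Γ) (a : V) : Prop :=
  ∀ j, ∃ h ∈ ⨆ j, H j, ∃ g ∈ H j, g • h • a ≠ h • a

theorem Full.smul {a : V} (ha : Full H a) {g : Γ} (hg : g ∈ ⨆ j, H j) : Full H (g • a) := by
  intro j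
  obtain ⟨h, hh, k, hk, hne⟩ := ha j
  refine ⟨h * g⁻¹, mul_mem hh (inv_mem hg), k, hk, ?_⟩
  simpa [mul_smul] using hne

theorem exists_mem_ne [Finite V] {D : AddSubgroup V} (hD : 7 ≤ Nat.card D) (a b c : V) :
    ∃ u ∈ D, u ≠ a ∧ u ≠ b ∧ u ≠ c := by
  by_contra! h
  have hsub : (D : Set V) ⊆ {a, b, c} := by
    intro u hu
    by_cases h1 : u = a
    · simp [h1]
    by_cases h2 : u = b
    · simp [h2]
    simp [h u hu h1 h2]
  have h1 := Set.ncard_le_ncard hsub (Set.toFinite _)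
  have h2 : ({a, b, c} : Set V).ncard ≤ 3 := (Set.ncard_insert_le _ _).trans
    (Nat.succ_le_succ ((Set.ncard_insert_le _ _).trans (by simp)))
  have h3 : (D : Set V).ncard = Nat.card D := rfl
  omega

/-- Apart from `e`, all of `a + U j` lies in the orbit of `a`. -/
theorem exists_forall_mem_orbit (T : TransvectionFamily U H) {N : Subgroup Γ} (hN : ∀ j, H j ≤ N)
    {a : V} {j : ι} (h : ∃ u ∈ U j, u ≠ 0 ∧ a + u ∈ orbit N a) :
    ∃ e, ∀ u ∈ U j, u ≠ e → a + u ∈ orbit N a := by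
  obtain ⟨u, hu, hu0, huo⟩ := h
  have step : ∀ x x', x ∈ orbit N a → (∃ g ∈ H j, g • x = x') → x' ∈ orbit N a := by
    rintro x x' ⟨n, rfl⟩ ⟨g, hg, rfl⟩
    exact ⟨⟨g, hN j hg⟩ * n, mul_smul _ _ _⟩
  -- If `a` is fixed, then `a + w` is moved for each nonzero `w ∈ U j`, so these elements form a
  -- single orbit.
  by_cases hfix : ∀ g ∈ H j, g • a = a
  · refine ⟨0, fun v hv hv0 => ?_⟩
    have hmoved : ∀ w ∈ U j, w ≠ 0 → ∃ g ∈ H j, g • (a + w) ≠ a + w := by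
      intro w hw hw0
      by_contra! hc
      refine hw0 (T.eq_zero j w hw fun g hg => ?_)
      have := hc g hg
      rwa [smul_add, hfix g hg, add_right_inj] at this
    rcases T.fixed_or_exists j (a + u) (a + v) (hmoved u hu hu0) (by simpa using sub_mem hv hu)
      with h | h
    · obtain ⟨g, hg, hne⟩ := hmoved v hv hv0
      exact absurd (h g hg) hne
    · exact step _ _ huo h
  · push Not at hfix
    -- If `a` is moved, its coset has at most one fixed point, as the difference of two would be a
    -- fixed element of `U j`; that point is the exception `e`.
    by_cases hex : ∃ e ∈ U j, ∀ g ∈ H j, g • (a + e) = a + e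
    · obtain ⟨e, he, hfe⟩ := hex
      refine ⟨e, fun v hv hve => ?_⟩
      rcases T.fixed_or_exists j a (a + v) hfix (by simpa using hv) with h | h
      · refine absurd (sub_eq_zero.mp (T.eq_zero j (v - e) (sub_mem hv he) fun g hg => ?_)) hve
        have : v - e = (a + v) - (a + e) := by abel
        rw [this, smul_sub, h g hg, hfe g hg]
      · exact step _ _ (mem_orbit_self a) h
    · refine ⟨0, fun v hv _ => ?_⟩
      rcases T.fixed_or_exists j a (a + v) hfix (by simpa using hv) with h | h
      · exact absurd ⟨v, hv, h⟩ hex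
      · exact step _ _ (mem_orbit_self a) h

/-- The bound 7 is used here. Suppose the claim fails for `g • a`, and let `F` be the fixed points
of `H l`. For `w ∈ F ∩ U j` other than 0 and `e`, the point g • (a + w) = g • a + w is in the orbit,
a contradiction. So |F ∩ U j| ≤ 2, and every coset of `U j` meets `F` in at most two points. For any
other `w ≠ 0, e`, one of `a + w` and `g • a + w` lies in `F`, else `H l` carries the first to the
second. Hence |U j| ≤ 2 + 2 + 2. -/
theorem exists_add_mem_orbit_smul [Finite V] (T : TransvectionFamily U H) {N : Subgroup Γ}
    (hN : ∀ j, H j ≤ N) {a : V} {j l : ι} (h : ∃ u ∈ U j, u ≠ 0 ∧ a + u ∈ orbit N a)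
    {g : Γ} (hg : g ∈ H l) : ∃ u ∈ U j, u ≠ 0 ∧ g • a + u ∈ orbit N a := by
  obtain ⟨e, he⟩ := T.exists_forall_mem_orbit hN h
  have step : ∀ x, x ∈ orbit N a → ∀ k ∈ H l, k • x ∈ orbit N a := by
    rintro x ⟨n, rfl⟩ k hk
    exact ⟨⟨k, hN l hk⟩ * n, mul_smul _ _ _⟩
  by_contra! hcon
  let F : AddSubgroup V :=
    { carrier := {x | ∀ g ∈ H l, g • x = x}
      add_mem' := fun {x y} hx hy g hg => by rw [smul_add, hx g hg, hy g hg]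
      zero_mem' := fun g _ => smul_zero g
      neg_mem' := fun {x} hx g hg => by rw [smul_neg, hx g hg] }
  have hD : ∀ w ∈ U j, w ∈ F → w = 0 ∨ w = e := by
    intro w hw hwF
    by_contra! hne
    refine hcon w hw hne.1 ?_
    have := step _ (he w hw hne.2) g hg
    rwa [smul_add, hwF g hg] at this
  have hpair : ({0, e} : Set V).ncard ≤ 2 := (Set.ncard_insert_le _ _).trans (by simp)
  have hcount : ∀ b, {w | w ∈ U j ∧ b + w ∈ F}.ncard ≤ 2 := by
    intro b
    by_cases hne : ∃ w, w ∈ U j ∧ b + w ∈ F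
    · obtain ⟨w0, hw0, hw0'⟩ := hne
      have hsub : {w | w ∈ U j ∧ b + w ∈ F} ⊆ (fun d => d + w0) '' ({0, e} : Set V) := by
        rintro w ⟨hw, hw'⟩
        refine ⟨w - w0, hD _ (sub_mem hw hw0) ?_, by simp⟩
        have := sub_mem hw' hw0'
        simpa using this
      exact (Set.ncard_le_ncard hsub (Set.toFinite _)).trans
        ((Set.ncard_image_le (Set.toFinite _)).trans hpair)
    · have : {w | w ∈ U j ∧ b + w ∈ F} = ∅ := by
        ext w
        simpa using fun h1 h2 => hne ⟨w, h1, h2⟩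
      simp [this]
  have hcover : (U j : Set V) ⊆ {0, e} ∪ ({w | w ∈ U j ∧ a + w ∈ F} ∪
      {w | w ∈ U j ∧ g • a + w ∈ F}) := by
    intro w hw
    by_cases hw0 : w = 0
    · simp [hw0]
    by_cases hwe : w = e
    · simp [hwe]
    right
    by_cases hfix : a + w ∈ F
    · exact Or.inl ⟨hw, hfix⟩
    right
    refine ⟨hw, ?_⟩
    have hmv : ∃ k ∈ H l, k • (a + w) ≠ a + w := by
      by_contra! hc
      exact hfix hc
    rcases T.fixed_or_exists l (a + w) (g • a + w) hmv
      (by simpa using T.smul_sub_mem l g hg a) with h | ⟨k, hk, hk'⟩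
    · exact h
    · exact absurd (hk' ▸ step _ (he w hw hwe) k hk) (hcon w hw hw0)
  have h1 := Set.ncard_le_ncard hcover (Set.toFinite _)
  have h2 := Set.ncard_union_le ({0, e} : Set V)
    ({w | w ∈ U j ∧ a + w ∈ F} ∪ {w | w ∈ U j ∧ g • a + w ∈ F})
  have h3 := Set.ncard_union_le {w | w ∈ U j ∧ a + w ∈ F} {w | w ∈ U j ∧ g • a + w ∈ F}
  have h5 := T.card_le j
  have h6 := hcount a
  have h7 := hcount (g • a)
  have h8 : (U j : Set V).ncard = Nat.card (U j) := rfl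
  omega

/-- Fullness provides a second orbit point in the `U j`-coset of some `h • a`; the previous lemma
carries this back to `a` one generator at a time. -/
theorem Full.exists_forall_mem_orbit [Finite V] (T : TransvectionFamily U H) {a : V}
    (ha : Full H a) (j : ι) : ∃ e, ∀ u ∈ U j, u ≠ e → a + u ∈ orbit (⨆ j, H j : Subgroup Γ) a := by
  set N := ⨆ j, H j with hNdef
  have hN : ∀ j, H j ≤ N := fun j => le_iSup H j
  apply T.exists_forall_mem_orbit hN
  obtain ⟨h, hh, g, hg, hne⟩ := ha j
  have hstart : ∃ u ∈ U j, u ≠ 0 ∧ h • a + u ∈ orbit N a :=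
    ⟨g • h • a - h • a, T.smul_sub_mem j g hg _, sub_ne_zero.mpr hne, by
      rw [add_sub_cancel]
      exact ⟨⟨g, hN j hg⟩ * ⟨h, hh⟩, mul_smul _ _ _⟩⟩
  have hmove : ∀ k ∈ N, ∃ u ∈ U j, u ≠ 0 ∧ k • h • a + u ∈ orbit N a := by
    intro k hk
    rw [hNdef, Subgroup.iSup_eq_closure] at hk
    have hstep : ∀ l, ∀ k' ∈ H l, ∀ b, b ∈ orbit N a →
        (∃ u ∈ U j, u ≠ 0 ∧ b + u ∈ orbit N a) →
        ∃ u ∈ U j, u ≠ 0 ∧ k' • b + u ∈ orbit N a := by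
      intro l k' hk' b hb hu
      rw [← orbit_eq_iff.mpr hb] at hu ⊢
      exact T.exists_add_mem_orbit_smul hN hu hk'
    have horb : ∀ k ∈ Subgroup.closure (⋃ i, (H i : Set Γ)), k • h • a ∈ orbit N a := by
      intro k hk
      rw [← Subgroup.iSup_eq_closure] at hk
      exact ⟨⟨k, hk⟩ * ⟨h, hh⟩, mul_smul _ _ _⟩
    induction hk using Subgroup.closure_induction_left with
    | one => simpa using hstart
    | mul_left x hx y hy ih =>
      obtain ⟨l, hl⟩ := Set.mem_iUnion.mp hx
      rw [mul_smul]
      exact hstep l x hl _ (horb y hy) ih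
    | inv_mul_cancel x hx y hy ih =>
      obtain ⟨l, hl⟩ := Set.mem_iUnion.mp hx
      rw [mul_smul]
      exact hstep l x⁻¹ (inv_mem hl) _ (horb y hy) ih
  simpa using hmove h⁻¹ (inv_mem hh)

/-- Induction on the number of terms of `b - a`. To split off `u ∈ U j`, choose `t ∈ U j` so that `a
+ t` is in the orbit of `a` and `a + t + d` in that of `a + (u + d)`; only two values of `t` are
forbidden. Then the difference is `d`. -/
theorem Full.exists_smul_eq [Finite V] (T : TransvectionFamily U H) {a b : V}
    (ha : Full H a) (hb : Full H b) (hab : b - a ∈ ⨆ j, U j) : ∃ g ∈ ⨆ j, H j, g • a = b := by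
  suffices h : ∀ d ∈ AddSubgroup.closure (⋃ j, (U j : Set V)), ∀ a, Full H a → Full H (a + d) →
      a + d ∈ orbit (⨆ j, H j : Subgroup Γ) a by
    rw [AddSubgroup.iSup_eq_closure] at hab
    obtain ⟨g, hg⟩ := h _ hab a ha (by simpa using hb)
    exact ⟨g, g.2, hg.trans (add_sub_cancel a b)⟩
  have step : ∀ j, ∀ u ∈ U j, ∀ d, (∀ a, Full H a → Full H (a + d) →
      a + d ∈ orbit (⨆ j, H j : Subgroup Γ) a) → ∀ a, Full H a → Full H (a + (u + d)) →
      a + (u + d) ∈ orbit (⨆ j, H j : Subgroup Γ) a := by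
    intro j u hu d ih a ha hb
    obtain ⟨e, he⟩ := ha.exists_forall_mem_orbit T j
    obtain ⟨e', he'⟩ := hb.exists_forall_mem_orbit T j
    obtain ⟨t, ht, hte, hte', -⟩ := exists_mem_ne (T.card_le j) e (e' + u) 0
    have h1 := he t ht hte
    have h2 := he' (t - u) (sub_mem ht hu) (fun h => hte' (by rw [← h]; abel))
    have h3 : a + (u + d) + (t - u) = a + t + d := by abel
    rw [h3] at h2
    have h4 : Full H (a + t) := by
      obtain ⟨g, hg⟩ := h1
      rw [← hg]
      exact ha.smul g.2
    have h5 : Full H (a + t + d) := by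
      obtain ⟨g, hg⟩ := h2
      rw [← hg]
      exact hb.smul g.2
    have h6 := ih _ h4 h5
    rw [orbit_eq_iff.mpr h1] at h6
    rw [← orbit_eq_iff] at h6 h2 ⊢
    rw [← h2, h6]
  intro d hd
  induction hd using AddSubgroup.closure_induction_left with
  | zero => intro a _ _; simp
  | add_left u hu d hd ih =>
    obtain ⟨j, hj⟩ := Set.mem_iUnion.mp hu
    exact step j u hj d ih
  | neg_add_cancel u hu d hd ih =>
    obtain ⟨j, hj⟩ := Set.mem_iUnion.mp hu
    exact step j (-u) (neg_mem hj) d ih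

/-- Take `v` for which the set of indices acting nontrivially somewhere on its orbit is maximal. If
`l` is missing, `v + u` with `0 ≠ u ∈ U l` gains `l`. It loses no `l'`: otherwise every `v + w` with
`0 ≠ w ∈ U l`, being conjugate to `v + u`, lies in the subgroup `F l'`, and `v` is an alternating
sum of three of these. -/
theorem exists_full [Finite V] (T : TransvectionFamily U H) : ∃ a ∈ ⨆ j, U j, Full H a := by
  let F : ι → AddSubgroup V := fun l =>
    { carrier := {x | ∀ h ∈ ⨆ j, H j, ∀ g ∈ H l, g • h • x = h • x}
      add_mem' := fun {x y} hx hy h hh g hg => by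
        rw [smul_add, smul_add, hx h hh g hg, hy h hh g hg]
      zero_mem' := fun h _ g _ => by simp
      neg_mem' := fun {x} hx h hh g hg => by rw [smul_neg, smul_neg, hx h hh g hg] }
  have hFsmul : ∀ l x, x ∈ F l → ∀ k ∈ ⨆ j, H j, k • x ∈ F l := by
    intro l x hx k hk h hh g hg
    rw [← mul_smul h k]
    exact hx _ (mul_mem hh hk) g hg
  let S : V → Set ι := fun v => {l | v ∉ F l}
  have hfin : ((fun v => S v) '' ((⨆ j, U j : AddSubgroup V) : Set V)).Finite := Set.toFinite _
  obtain ⟨s, hs⟩ := hfin.exists_maximal ⟨S 0, 0, zero_mem _, rfl⟩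
  obtain ⟨⟨v, hv, rfl⟩, hmax⟩ := hs
  refine ⟨v, hv, fun l => ?_⟩
  by_contra! hcon
  have hvF : v ∈ F l := hcon
  have hvfix : ∀ g ∈ H l, g • v = v := fun g hg => by simpa using hvF 1 (one_mem _) g hg
  obtain ⟨u, hu, hu0, -⟩ := exists_mem_ne (T.card_le l) 0 0 0
  have hmoved : ∀ w ∈ U l, w ≠ 0 → ∃ g ∈ H l, g • (v + w) ≠ v + w := by
    intro w hw hw0
    by_contra! hc
    refine hw0 (T.eq_zero l w hw fun g hg => ?_)
    have := hc g hg
    rwa [smul_add, hvfix g hg, add_right_inj] at this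
  have hnot : v + u ∉ F l := by
    intro h
    obtain ⟨g, hg, hne⟩ := hmoved u hu hu0
    exact hne (by simpa using h 1 (one_mem _) g hg)
  have hle : S v ≤ S (v + u) := by
    intro l' hl' hmem
    have hall : ∀ w ∈ U l, w ≠ 0 → v + w ∈ F l' := by
      intro w hw hw0
      rcases T.fixed_or_exists l (v + u) (v + w) (hmoved u hu hu0)
        (by simpa using sub_mem hw hu) with h | ⟨g, hg, hgw⟩
      · obtain ⟨g, hg, hne⟩ := hmoved w hw hw0
        exact absurd (h g hg) hne
      · rw [← hgw]
        exact hFsmul l' _ hmem g (le_iSup H l hg)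
    obtain ⟨t, ht, ht0, htu, -⟩ := exists_mem_ne (T.card_le l) 0 (-u) 0
    have h1 := hall (u + t) (add_mem hu ht) (fun h => htu (by rw [eq_neg_iff_add_eq_zero, add_comm, h]))
    have h2 := hall t ht ht0
    have h3 : v = (v + u) - ((v + (u + t)) - (v + t)) := by abel
    exact hl' (h3 ▸ sub_mem hmem (sub_mem h1 h2))
  have := hmax ⟨v + u, add_mem hv (AddSubgroup.mem_iSup_of_mem l hu), rfl⟩ hle
  exact this hnot hvF

end TransvectionFamily

end

/-! ### Axioms for inertia acting on roots, and passage to elements of p-power order. -/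

section

open MulAction

/-- The action of a Galois group `G` (normal in `Γ`) on the root space `V` of an additive
polynomial together with the places `J` above infinity: `U j` are the roots in the maximal ideal
of `j`, `A j` those in the valuation ring of `j`, and `W` consists of the constant roots. -/
structure InertialSystem (p : ℕ) {Γ V J : Type*} [Group Γ] [AddCommGroup V] [DistribMulAction Γ V]
    [MulAction Γ J] (G : Subgroup Γ) (W : AddSubgroup V) (U A : J → AddSubgroup V) : Prop where
  char_smul : ∀ x : V, p • x = 0
  smul_W : ∀ σ : Γ, ∀ w ∈ W, σ • w ∈ W
  smul_U : ∀ (σ : Γ) j x, x ∈ U j → σ • x ∈ U (σ • j)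
  smul_A : ∀ (σ : Γ) j x, x ∈ A j → σ • x ∈ A (σ • j)
  fixed : ∀ g ∈ G, ∀ w ∈ W, g • w = w
  trans : ∀ x y, x ∉ W → y ∉ W → ∃ g ∈ G, g • x = y
  trans_index : ∀ i j : J, ∃ g ∈ G, g • i = j
  W_le : ∀ j, W ≤ A j
  U_le : ∀ j, U j ≤ A j
  eq_zero : ∀ j x, x ∈ U j → x ∈ W → x = 0
  exists_small : ∀ j x y, x ∉ W → y ∉ W → x ∈ A j → y - x ∈ U j → ∃ g ∈ G, g • j = j ∧ g • x = y
  exists_large : ∀ j x y, x ∉ A j → y ∉ A j → ∃ g ∈ G, g • j = j ∧ g • x = y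
  smul_sub_mem : ∀ j, ∀ g ∈ G, g • j = j → ∀ x ∈ A j, g • x - x ∈ U j
  unipotent_fixed : ∀ j, ∀ g ∈ G, g • j = j → ∀ m, g ^ p ^ m = 1 → ∀ x ∈ U j, g • x = x
  unipotent_sub_mem : ∀ j, ∀ g ∈ G, g • j = j → ∀ m, g ^ p ^ m = 1 → ∀ x, g • x - x ∈ A j
  cover : ∀ x, x ∉ W → ∃ j, x ∈ U j
  exists_mem_notMem : ∃ j, ∃ x ∈ A j, x ∉ U j ⊔ W
  card_le : ∀ j, A j = ⊤ → 7 ≤ Nat.card (U j)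

namespace InertialSystem

/-- A `Γ`-canonical orbit, with more than one point, of the stabilizer of `y` in `G`. -/
def HasCanonicalOrbit {Γ V : Type*} [Group Γ] [AddCommGroup V] [DistribMulAction Γ V]
    (G : Subgroup Γ) (y : V) : Prop :=
  ∃ X : Set V, (∃ a ∈ X, ∃ b ∈ X, a ≠ b) ∧
    (∀ a ∈ X, ∀ b ∈ X, ∃ g ∈ G, g • y = y ∧ g • a = b) ∧
    ∀ σ : Γ, σ • y = y → ∀ a ∈ X, σ • a ∈ X

theorem HasCanonicalOrbit.smul {Γ V : Type*} [Group Γ] [AddCommGroup V] [DistribMulAction Γ V]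
    {G : Subgroup Γ} {y : V} (h : HasCanonicalOrbit G y) {g : Γ} (hg : g ∈ G) :
    HasCanonicalOrbit G (g • y) := by
  obtain ⟨X, ⟨a, ha, b, hb, hab⟩, htr, hst⟩ := h
  refine ⟨{x | g⁻¹ • x ∈ X}, ⟨g • a, by simpa using ha, g • b, by simpa using hb,
    fun h => hab (smul_left_cancel g h)⟩, ?_, ?_⟩
  · intro a ha b hb
    obtain ⟨k, hk, hky, hkab⟩ := htr _ ha _ hb
    refine ⟨g * k * g⁻¹, mul_mem (mul_mem hg hk) (inv_mem hg), ?_, ?_⟩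
    · simp [mul_smul, hky]
    · simp [mul_smul, hkab]
  · intro σ hσ a ha
    have := hst (g⁻¹ * σ * g) (by simp [mul_smul, hσ]) _ ha
    simpa [mul_smul] using this

variable {p : ℕ} {Γ V J : Type*} [Group Γ] [AddCommGroup V] [DistribMulAction Γ V]
  [MulAction Γ J] {G : Subgroup Γ} {W : AddSubgroup V} {U A : J → AddSubgroup V}

theorem exists_card_eq_pow [Fact p.Prime] [Finite V] (hp : ∀ x : V, p • x = 0)
    (D : AddSubgroup V) : ∃ n, Nat.card D = p ^ n := by
  let _ : Module (ZMod p) D := AddCommGroup.zmodModule fun x => Subtype.ext (hp x)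
  have : Module.Finite (ZMod p) D := Module.Finite.of_finite
  exact ⟨Module.finrank (ZMod p) D, by
    rw [Module.natCard_eq_pow_finrank (K := ZMod p) (V := D), Nat.card_zmod]⟩

/-- The orbit of `x` is the coset `x + D`, of p-power size, so a Sylow p-subgroup is transitive on
it. -/
theorem exists_sylow_orbit [Fact p.Prime] [Finite V] (hp : ∀ x : V, p • x = 0) (H : Subgroup Γ)
    [Finite H] (S : Sylow p H) (D : AddSubgroup V) (x : V) (h1 : ∀ g ∈ H, g • x - x ∈ D)
    (h2 : ∀ d ∈ D, ∃ g ∈ H, g • x = x + d) : ∀ d ∈ D, ∃ g ∈ S, g • x = x + d := by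
  have horb : orbit H x = (fun d => x + d) '' (D : Set V) := by
    ext z
    constructor
    · rintro ⟨g, rfl⟩
      exact ⟨_, h1 g g.2, by simp [Subgroup.smul_def]⟩
    · rintro ⟨d, hd, rfl⟩
      obtain ⟨g, hg, hgx⟩ := h2 d hd
      exact ⟨⟨g, hg⟩, hgx⟩
  obtain ⟨n, hn⟩ := exists_card_eq_pow hp D
  have hcard : Nat.card (orbit H x) = p ^ n := by
    rw [horb, Nat.card_image_of_injective (add_right_injective x), ← hn]
    rfl
  intro d hd
  have hmem : x + d ∈ orbit H x := by
    rw [horb]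
    exact ⟨d, hd, rfl⟩
  rw [← S.orbit_eq_of_card_orbit_eq_pow hcard] at hmem
  obtain ⟨g, hg⟩ := hmem
  exact ⟨g, g.2, hg⟩

theorem exists_unipotent [Fact p.Prime] [Finite V] (hp : ∀ x : V, p • x = 0) (H : Subgroup Γ)
    [Finite H] (D : AddSubgroup V) (x : V) (h1 : ∀ g ∈ H, g • x - x ∈ D)
    (h2 : ∀ d ∈ D, ∃ g ∈ H, g • x = x + d) :
    ∀ d ∈ D, ∃ g ∈ H, (∃ m, g ^ p ^ m = 1) ∧ g • x = x + d := by
  intro d hd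
  obtain ⟨S⟩ : Nonempty (Sylow p H) := inferInstance
  obtain ⟨g, hgS, hg⟩ := exists_sylow_orbit hp H S D x h1 h2 d hd
  obtain ⟨m, hm⟩ := S.isPGroup' ⟨g, hgS⟩
  refine ⟨g, g.2, ⟨m, ?_⟩, hg⟩
  have := congrArg (fun z : S => ((z : H) : Γ)) hm
  simpa using this

theorem smul_A_iff (S : InertialSystem p G W U A) (σ : Γ) (j : J) (x : V) :
    σ • x ∈ A (σ • j) ↔ x ∈ A j :=
  ⟨fun h => by simpa using S.smul_A σ⁻¹ _ _ h, S.smul_A σ j x⟩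

theorem smul_W_iff (S : InertialSystem p G W U A) (σ : Γ) (x : V) : σ • x ∈ W ↔ x ∈ W :=
  ⟨fun h => by simpa using S.smul_W σ⁻¹ _ h, S.smul_W σ x⟩

theorem smul_sup (S : InertialSystem p G W U A) (σ : Γ) (j : J) (x : V) (hx : x ∈ U j ⊔ W) :
    σ • x ∈ U (σ • j) ⊔ W := by
  obtain ⟨u, hu, w, hw, rfl⟩ := AddSubgroup.mem_sup.mp hx
  rw [smul_add]
  exact AddSubgroup.add_mem_sup (S.smul_U σ j u hu) (S.smul_W σ w hw)

theorem smul_sup_iff (S : InertialSystem p G W U A) (σ : Γ) (j : J) (x : V) :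
    σ • x ∈ U (σ • j) ⊔ W ↔ x ∈ U j ⊔ W :=
  ⟨fun h => by simpa using S.smul_sup σ⁻¹ _ _ h, S.smul_sup σ j x⟩

theorem card_eq_of_smul_mem [Finite V] (B : J → AddSubgroup V)
    (hB : ∀ (σ : Γ) j x, x ∈ B j → σ • x ∈ B (σ • j)) (hJ : ∀ i j : J, ∃ g ∈ G, g • i = j)
    (i j : J) : Nat.card (B i) = Nat.card (B j) := by
  have key : ∀ i j, Nat.card (B i) ≤ Nat.card (B j) := by
    intro i j
    obtain ⟨g, -, rfl⟩ := hJ i j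
    refine Nat.card_le_card_of_injective (fun x : B i => (⟨g • x, hB g i x x.2⟩ : B (g • i))) ?_
    intro a b hab
    exact Subtype.ext (smul_left_cancel g (congrArg Subtype.val hab))
  exact (key i j).antisymm (key j i)

/-- Excluding `U j ⊔ W` keeps the whole coset `x + U j` free of constants, which makes it a full
orbit of the decomposition group. -/
theorem exists_unipotent_small [Fact p.Prime] [Finite V] [Finite G]
    (S : InertialSystem p G W U A) {j : J} {x u : V} (hx : x ∈ A j) (hx' : x ∉ U j ⊔ W)
    (hu : u ∈ U j) : ∃ g ∈ G, g • j = j ∧ (∃ m, g ^ p ^ m = 1) ∧ g • x = x + u := by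
  have hfin : Finite (G ⊓ stabilizer Γ j : Subgroup Γ) :=
    Finite.of_injective _ (Subgroup.inclusion_injective inf_le_left)
  have hW : ∀ d ∈ U j, x + d ∉ W := fun d hd hw => hx' (by
    have := AddSubgroup.add_mem_sup (neg_mem hd) hw
    simpa using this)
  obtain ⟨g, hg, hm, hgx⟩ := exists_unipotent S.char_smul (G ⊓ stabilizer Γ j) (U j) x
    (fun g hg => S.smul_sub_mem j g hg.1 hg.2 x hx) (fun d hd => by
      obtain ⟨g, hg, hgj, hgx⟩ := S.exists_small j x (x + d) (by simpa using hW 0 (zero_mem _))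
        (hW d hd) hx (by simpa using hd)
      exact ⟨g, ⟨hg, hgj⟩, hgx⟩) u hu
  exact ⟨g, hg.1, hg.2, hm, hgx⟩

theorem exists_unipotent_large [Fact p.Prime] [Finite V] [Finite G]
    (S : InertialSystem p G W U A) {j : J} {x a : V} (hx : x ∉ A j) (ha : a ∈ A j) :
    ∃ g ∈ G, g • j = j ∧ (∃ m, g ^ p ^ m = 1) ∧ g • x = x + a := by
  have hsm : ∀ g : Γ, g • j = j → ∀ z ∈ A j, g • z ∈ A j := fun g hg z hz => by
    have := S.smul_A g j z hz
    rwa [hg] at this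
  -- The decomposition group is transitive on all of V \ A j, which need not have p-power size; `H`
  -- is the part preserving the coset `x + A j`.
  let H : Subgroup Γ :=
    { carrier := {g | g ∈ G ∧ g • j = j ∧ g • x - x ∈ A j}
      mul_mem' := by
        rintro g h ⟨hg, hgj, hgx⟩ ⟨hh, hhj, hhx⟩
        refine ⟨mul_mem hg hh, by rw [mul_smul, hhj, hgj], ?_⟩
        have := add_mem (hsm g hgj _ hhx) hgx
        simpa [mul_smul, smul_sub] using this
      one_mem' := ⟨one_mem _, by simp, by simp⟩
      inv_mem' := by
        rintro g ⟨hg, hgj, hgx⟩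
        have hgj' : g⁻¹ • j = j := by rw [inv_smul_eq_iff, hgj]
        refine ⟨inv_mem hg, hgj', ?_⟩
        have := neg_mem (hsm g⁻¹ hgj' _ hgx)
        simpa [smul_sub] using this }
  have hfin : Finite H := Finite.of_injective
    (Subgroup.inclusion (fun g hg => hg.1 : H ≤ G)) (Subgroup.inclusion_injective _)
  obtain ⟨g, hg, hm, hgx⟩ := exists_unipotent S.char_smul H (A j) x
    (fun g hg => hg.2.2) (fun d hd => by
      obtain ⟨g, hg, hgj, hgx⟩ := S.exists_large j x (x + d) hx
        (fun h => hx (by simpa using sub_mem h hd))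
      exact ⟨g, ⟨hg, hgj, by rw [hgx]; simpa using hd⟩, hgx⟩) a ha
  exact ⟨g, hg.1, hg.2.1, hm, hgx⟩

end InertialSystem

end

/-! ### The case where every root is finite at every place. -/

section

open MulAction

namespace InertialSystem

variable {p : ℕ} {Γ V J : Type*} [Group Γ] [AddCommGroup V] [DistribMulAction Γ V]
  [MulAction Γ J] {G : Subgroup Γ} {W : AddSubgroup V} {U A : J → AddSubgroup V}

/-- Move `u` to `v` in the decomposition group, then bring `y` back by an element of p-power order,
which does not disturb `U j`. -/
theorem exists_inertia_smul_eq [Fact p.Prime] [Finite V] [Finite G]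
    (S : InertialSystem p G W U A) {y : V} {j : J} (hyA : y ∈ A j) (hy : y ∉ U j ⊔ W)
    {u v : V} (hu : u ∈ U j) (hv : v ∈ U j) (hu0 : u ≠ 0) (hv0 : v ≠ 0) :
    ∃ g ∈ G ⊓ stabilizer Γ j ⊓ stabilizer Γ y, g • u = v := by
  obtain ⟨g, hg, hgj, hgu⟩ := S.exists_small j u v (fun h => hu0 (S.eq_zero j u hu h))
    (fun h => hv0 (S.eq_zero j v hv h)) (S.U_le j hu) (sub_mem hv hu)
  have h1 : g • y - y ∈ U j := S.smul_sub_mem j g hg hgj y hyA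
  have h2 : g • y ∈ A j := by simpa using add_mem (S.U_le j h1) hyA
  have h3 : g • y ∉ U j ⊔ W := fun h => hy (by
    simpa using sub_mem h (AddSubgroup.mem_sup_left h1))
  obtain ⟨t, ht, htj, ⟨m, hm⟩, hty⟩ := S.exists_unipotent_small h2 h3 (neg_mem h1)
  refine ⟨t * g, ⟨⟨mul_mem ht hg, mem_stabilizer_iff.mpr (by rw [mul_smul, hgj, htj])⟩,
    mem_stabilizer_iff.mpr (by rw [mul_smul, hty]; abel)⟩, ?_⟩
  rw [mul_smul, hgu, S.unipotent_fixed j t ht htj m hm v hv]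

/-- A Sylow p-subgroup fixes `x`, so the orbit has size prime to p and its average is a fixed point
of the coset `x + D`. -/
theorem exists_fixed_of_unipotent_fixed [Fact p.Prime] [Finite V] (hp : ∀ x : V, p • x = 0)
    (H : Subgroup Γ) [Finite H] (D : AddSubgroup V) (x : V) (h1 : ∀ g ∈ H, g • x - x ∈ D)
    (h2 : ∀ g ∈ H, ∀ m, g ^ p ^ m = 1 → g • x = x) :
    ∃ z, z - x ∈ D ∧ ∀ g ∈ H, g • z = z := by
  classical
  obtain ⟨S⟩ : Nonempty (Sylow p H) := inferInstance
  have hfin : (orbit H x).Finite := Set.finite_range _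
  have hle : (S : Subgroup H) ≤ stabilizer H x := by
    intro g hg
    obtain ⟨m, hm⟩ := S.isPGroup' ⟨g, hg⟩
    exact h2 g g.2 m (by simpa using congrArg (fun z : S => ((z : H) : Γ)) hm)
  have hn : ¬ p ∣ hfin.toFinset.card := by
    rw [← Set.ncard_eq_toFinset_card _ hfin, ← index_stabilizer]
    exact fun h => S.not_dvd_index (h.trans (Subgroup.index_dvd_of_le hle))
  set s := ∑ o ∈ hfin.toFinset, o with hs
  have hinv : ∀ g ∈ H, g • s = s := by
    intro g hg
    rw [hs, Finset.smul_sum]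
    refine Finset.sum_bij (fun o _ => g • o) ?_ ?_ ?_ ?_
    · intro o ho
      rw [Set.Finite.mem_toFinset] at ho ⊢
      obtain ⟨k, rfl⟩ := ho
      exact ⟨⟨g, hg⟩ * k, mul_smul _ _ _⟩
    · intro a _ b _ hab
      exact smul_left_cancel g hab
    · intro o ho
      rw [Set.Finite.mem_toFinset] at ho
      obtain ⟨k, rfl⟩ := ho
      refine ⟨(⟨g, hg⟩⁻¹ * k : H) • x, ?_, ?_⟩
      · rw [Set.Finite.mem_toFinset]
        exact ⟨_, rfl⟩
      · rw [mul_smul]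
        exact smul_inv_smul g _
    · intros; rfl
  have hsx : s - hfin.toFinset.card • x ∈ D := by
    rw [hs, ← Finset.sum_const, ← Finset.sum_sub_distrib]
    refine sum_mem fun o ho => ?_
    rw [Set.Finite.mem_toFinset] at ho
    obtain ⟨k, rfl⟩ := ho
    exact h1 k k.2
  obtain ⟨n', hn'⟩ : ∃ n' : ℕ, n' * hfin.toFinset.card ≡ 1 [MOD p] := by
    have hco : (hfin.toFinset.card).Coprime p :=
      ((Nat.Prime.coprime_iff_not_dvd Fact.out).mpr hn).symm
    obtain ⟨n', -, h⟩ := Nat.exists_mul_mod_eq_one_of_coprime hco (Fact.out : p.Prime).one_lt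
    refine ⟨n', ?_⟩
    rw [Nat.ModEq, mul_comm, h, Nat.mod_eq_of_lt (Fact.out : p.Prime).one_lt]
  have hmod : (n' * hfin.toFinset.card) • x = x := by
    have key : ∀ a : ℕ, a • x = (a % p) • x := by
      intro a
      conv_lhs => rw [← Nat.mod_add_div a p, add_smul, mul_smul, hp, add_zero]
    rw [key, hn', ← key, one_smul]
  refine ⟨n' • s, ?_, fun g hg => ?_⟩
  · have : n' • s - x = n' • (s - hfin.toFinset.card • x) := by
      rw [smul_sub, ← mul_smul, hmod]
    rw [this]
    exact D.nsmul_mem hsx _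
  · rw [smul_comm, hinv g hg]

/-- Places with `y ∈ U j ⊔ W` are dropped: only for the others can an inertia element be corrected
to fix `y`. -/
theorem transvectionFamily [Fact p.Prime] [Finite V] [Finite G] (S : InertialSystem p G W U A)
    (htop : ∀ j, A j = ⊤) (y : V) :
    TransvectionFamily (fun j : {j // y ∉ U j ⊔ W} => U j)
      (fun j => G ⊓ stabilizer Γ j.1 ⊓ stabilizer Γ y) where
  smul_sub_mem := fun j g hg x => S.smul_sub_mem j g hg.1.1 hg.1.2 x (by simp [htop])
  card_le := fun j => S.card_le j (htop j)
  eq_zero := by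
    intro j x hx hfix
    by_contra hx0
    obtain ⟨u, hu, hu0, hux, -⟩ := TransvectionFamily.exists_mem_ne (S.card_le j (htop j)) 0 x 0
    obtain ⟨g, hg, hgx⟩ := S.exists_inertia_smul_eq (by simp [htop]) j.2 hx hu hx0 hu0
    exact hux (hgx ▸ hfix g hg)
  fixed_or_exists := by
    intro j x x' hmoved hx'
    have hsm : ∀ g ∈ G ⊓ stabilizer Γ j.1 ⊓ stabilizer Γ y, ∀ u ∈ U j.1, g • u ∈ U j.1 := by
      intro g hg u hu
      have := S.smul_U g j u hu
      rwa [show g • j.1 = j.1 from hg.1.2] at this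
    -- A `t` trivial on `U j` that moves `x` translates it by an element of `U j`; conjugating `t`
    -- gives translation by any nonzero element.
    by_cases hcase : ∃ t ∈ G ⊓ stabilizer Γ j.1 ⊓ stabilizer Γ y,
        (∀ u ∈ U j.1, t • u = u) ∧ t • x ≠ x
    · right
      obtain ⟨t, ht, htU, htx⟩ := hcase
      by_cases hxx : x' - x = 0
      · exact ⟨1, one_mem _, by rw [one_smul]; exact (sub_eq_zero.mp hxx).symm⟩
      have hd : t • x - x ∈ U j.1 := S.smul_sub_mem j t ht.1.1 ht.1.2 x (by simp [htop])
      obtain ⟨h, hh, hhd⟩ := S.exists_inertia_smul_eq (by simp [htop]) j.2 hd hx'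
        (sub_ne_zero.mpr htx) hxx
      refine ⟨h * t * h⁻¹, mul_mem (mul_mem hh ht) (inv_mem hh), ?_⟩
      have hu : h⁻¹ • x - x ∈ U j.1 :=
        S.smul_sub_mem j h⁻¹ (inv_mem hh.1.1) (inv_smul_eq_iff.mpr (hh.1.2 : h • j.1 = j.1).symm) x (by simp [htop])
      have e1 : t • h⁻¹ • x = h⁻¹ • x + (t • x - x) := by
        have := htU _ hu
        rw [smul_sub] at this
        rw [sub_eq_iff_eq_add] at this
        rw [this]; abel
      rw [mul_smul, mul_smul, e1, smul_add, hhd, smul_inv_smul]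
      abel
    -- Otherwise p-power elements fix `x`, so its coset has a fixed point `z`. With `z` as origin,
    -- the coset minus `z` is one orbit.
    · push Not at hcase
      have hfin : Finite (G ⊓ stabilizer Γ j.1 ⊓ stabilizer Γ y : Subgroup Γ) :=
        Finite.of_injective _ (Subgroup.inclusion_injective (inf_le_left.trans inf_le_left))
      obtain ⟨z, hz, hzfix⟩ := exists_fixed_of_unipotent_fixed S.char_smul
        (G ⊓ stabilizer Γ j.1 ⊓ stabilizer Γ y) (U j.1) x
        (fun g hg => S.smul_sub_mem j g hg.1.1 hg.1.2 x (by simp [htop]))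
        (fun g hg m hm => hcase g hg (S.unipotent_fixed j g hg.1.1 hg.1.2 m hm))
      by_cases hzx' : x' = z
      · left
        rw [hzx']
        exact hzfix
      right
      have hzx : x ≠ z := by
        rintro rfl
        obtain ⟨g, hg, hne⟩ := hmoved
        exact hne (hzfix g hg)
      have hx1 : x - z ∈ U j.1 := by simpa using neg_mem hz
      have hx2 : x' - z ∈ U j.1 := by simpa using sub_mem hx' hz
      obtain ⟨h, hh, hhd⟩ := S.exists_inertia_smul_eq (by simp [htop]) j.2 hx1 hx2
        (sub_ne_zero.mpr hzx) (sub_ne_zero.mpr hzx')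
      refine ⟨h, hh, ?_⟩
      rw [smul_sub, hzfix h hh] at hhd
      simpa using hhd

/-- The orbit consists of the full elements in the sum of the `U j` with `y ∉ U j ⊔ W`. This family
of places is permuted by the stabilizer of `y` in `Γ`, so the set is canonical. -/
theorem hasCanonicalOrbit_of_eq_top [Fact p.Prime] [Finite V] [Finite G] [G.Normal]
    (S : InertialSystem p G W U A) (htop : ∀ j, A j = ⊤) {y : V} (hy : y ∉ W) :
    HasCanonicalOrbit G y := by
  let U' : {j // y ∉ U j ⊔ W} → AddSubgroup V := fun j => U j
  let H' : {j // y ∉ U j ⊔ W} → Subgroup Γ := fun j => G ⊓ stabilizer Γ j.1 ⊓ stabilizer Γ y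
  have T : TransvectionFamily U' H' := S.transvectionFamily htop y
  have hH : ⨆ j, H' j ≤ G ⊓ stabilizer Γ y :=
    iSup_le fun j g hg => ⟨hg.1.1, hg.2⟩
  have hind : ∀ σ : Γ, σ • y = y → ∀ j : {j // y ∉ U j ⊔ W}, y ∉ U (σ • j.1) ⊔ W := by
    intro σ hσ j h
    exact j.2 ((S.smul_sup_iff σ j.1 y).mp (by rwa [hσ]))
  have hΛ : ∀ σ : Γ, σ • y = y → ∀ a ∈ ⨆ j, U' j, σ • a ∈ ⨆ j, U' j := by
    intro σ hσ a ha
    have : (⨆ j, U' j) ≤ (⨆ j, U' j).comap (DistribSMul.toAddMonoidHom V σ) := by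
      refine iSup_le fun j u hu => ?_
      exact AddSubgroup.mem_iSup_of_mem (⟨σ • j.1, hind σ hσ j⟩ : {j // y ∉ U j ⊔ W})
        (S.smul_U σ j u hu)
    exact this ha
  have hinv : ∀ σ : Γ, σ • y = y → σ⁻¹ • y = y := fun σ hσ => by rw [inv_smul_eq_iff, hσ]
  have hHj : ∀ (σ : Γ) (hσ : σ • y = y) j, ∀ g ∈ H' j, σ * g * σ⁻¹ ∈ H' ⟨σ • j.1, hind σ hσ j⟩ := by
    intro σ hσ j g hg
    refine ⟨⟨Subgroup.Normal.conj_mem inferInstance g hg.1.1 σ, ?_⟩, ?_⟩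
    · have h1 : g • j.1 = j.1 := hg.1.2
      simp [mem_stabilizer_iff, mul_smul, h1]
    · have h1 : g • y = y := hg.2
      change (σ * g * σ⁻¹) • y = y
      rw [mul_smul, mul_smul, hinv σ hσ, h1, hσ]
  have hconj : ∀ σ : Γ, σ • y = y → ∀ h ∈ ⨆ j, H' j, σ * h * σ⁻¹ ∈ ⨆ j, H' j := by
    intro σ hσ h hh
    have : (⨆ j, H' j) ≤ (⨆ j, H' j).comap (MulAut.conj σ).toMonoidHom := by
      refine iSup_le fun j g hg => ?_
      exact Subgroup.mem_iSup_of_mem (⟨σ • j.1, hind σ hσ j⟩ : {j // y ∉ U j ⊔ W})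
        (hHj σ hσ j g hg)
    exact this hh
  have hstable : ∀ σ : Γ, σ • y = y → ∀ a, a ∈ ⨆ j, U' j ∧ TransvectionFamily.Full H' a →
      σ • a ∈ ⨆ j, U' j ∧ TransvectionFamily.Full H' (σ • a) := by
    rintro σ hσ a ⟨ha, hfull⟩
    refine ⟨hΛ σ hσ a ha, fun j => ?_⟩
    obtain ⟨h, hh, g, hg, hne⟩ := hfull ⟨σ⁻¹ • j.1, hind _ (hinv σ hσ) j⟩
    refine ⟨σ * h * σ⁻¹, hconj σ hσ h hh, σ * g * σ⁻¹, ?_, ?_⟩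
    · have := hHj σ hσ _ g hg
      simpa using this
    · simpa [mul_smul] using hne
  obtain ⟨a, ha, hfull⟩ := T.exists_full
  refine ⟨{a | a ∈ ⨆ j, U' j ∧ TransvectionFamily.Full H' a}, ?_, ?_, fun σ hσ a => hstable σ hσ a⟩
  -- The family of places is nonempty by moving `x0` to `y`; fullness then yields a moved point.
  · obtain ⟨j0, x0, hx0, hx0'⟩ := S.exists_mem_notMem
    obtain ⟨g, -, hgx⟩ := S.trans x0 y (fun h => hx0' (AddSubgroup.mem_sup_right h)) hy
    obtain ⟨h, hh, k, hk, hne⟩ := hfull ⟨g • j0, by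
      rw [← hgx, S.smul_sup_iff]
      exact hx0'⟩
    have h1 := hstable h (hH hh).2 a ⟨ha, hfull⟩
    exact ⟨_, hstable k hk.2 _ h1, _, h1, hne⟩
  · rintro a ⟨ha, hfa⟩ b ⟨hb, hfb⟩
    obtain ⟨g, hg, hgab⟩ := hfa.exists_smul_eq T hfb (sub_mem hb ha)
    exact ⟨g, (hH hg).1, (hH hg).2, hgab⟩

end InertialSystem

end

/-! ### The case of infinite roots: several groups `A j` for one `y`, or a polarity. -/

section

open MulAction

namespace InertialSystem

variable {p : ℕ} {Γ V J : Type*} [Group Γ] [AddCommGroup V] [DistribMulAction Γ V]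
  [MulAction Γ J] {G : Subgroup Γ} {W : AddSubgroup V} {U A : J → AddSubgroup V}

theorem exists_smul_eq_add [Fact p.Prime] [Finite V] [Finite G]
    (S : InertialSystem p G W U A) {j : J} {y x a : V} (hy : y ∈ U j) (hx : x ∉ A j)
    (ha : a ∈ A j) : ∃ g ∈ G, g • y = y ∧ g • x = x + a := by
  obtain ⟨g, hg, hgj, ⟨m, hm⟩, hgx⟩ := S.exists_unipotent_large hx ha
  exact ⟨g, hg, S.unipotent_fixed j g hg hgj m hm y hy, hgx⟩

/-- For each place with `y ∈ U j`, elements fixing `y` translate any point outside `A j` by any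
element of `A j`. So the sum minus the intersection of these `A j` is one orbit. -/
theorem hasCanonicalOrbit_of_exists_ne [Fact p.Prime] [Finite V] [Finite G]
    (S : InertialSystem p G W U A) {y : V} {i j : J} (hi : y ∈ U i) (hj : y ∈ U j)
    (hij : A i ≠ A j) : HasCanonicalOrbit G y := by
  have hcard : ∀ i j, Nat.card (A i) = Nat.card (A j) :=
    card_eq_of_smul_mem A S.smul_A S.trans_index
  let B : {j // y ∈ U j} → AddSubgroup V := fun j => A j
  have hex : ∀ i j, A i ≠ A j → ∃ b ∈ A i, b ∉ A j := fun i j hne =>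
    SetLike.not_le_iff_exists.mp fun h => hne (AddSubgroup.eq_of_le_of_card_ge h (hcard j i).le)
  have hind : ∀ σ : Γ, σ • y = y → ∀ j : {j // y ∈ U j}, y ∈ U (σ • j.1) := by
    intro σ hσ j
    have := S.smul_U σ _ _ j.2
    rwa [hσ] at this
  refine ⟨{x | x ∈ ⨆ j, B j ∧ ∃ j, x ∉ B j}, ?_, ?_, ?_⟩
  · obtain ⟨b, hb, hb'⟩ := hex i j hij
    obtain ⟨c, hc, hc'⟩ := hex j i hij.symm
    exact ⟨b, ⟨AddSubgroup.mem_iSup_of_mem (⟨i, hi⟩ : {j // y ∈ U j}) hb, ⟨j, hj⟩, hb'⟩,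
      c, ⟨AddSubgroup.mem_iSup_of_mem (⟨j, hj⟩ : {j // y ∈ U j}) hc, ⟨i, hi⟩, hc'⟩,
      fun h => hb' (h ▸ hc)⟩
  · rintro a ⟨ha, ha'⟩ b ⟨hb, hb'⟩
    refine rel_of_mem_iSup_of_notMem_iInf B (fun i j => hcard _ _)
      (fun a b => ∃ g ∈ G, g • y = y ∧ g • a = b) ⟨fun a => ⟨1, one_mem _, by simp, by simp⟩,
        ?_, ?_⟩ ?_ ha hb ha' hb'
    · rintro a b ⟨g, hg, hgy, rfl⟩
      exact ⟨g⁻¹, inv_mem hg, by rw [inv_smul_eq_iff, hgy], by simp⟩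
    · rintro a b c ⟨g, hg, hgy, rfl⟩ ⟨h, hh, hhy, rfl⟩
      exact ⟨h * g, mul_mem hh hg, by rw [mul_smul, hgy, hhy], mul_smul _ _ _⟩
    · intro i x b hb hx
      exact S.exists_smul_eq_add i.2 hx hb
  · rintro σ hσ a ⟨ha, k, hk⟩
    refine ⟨?_, ⟨σ • k.1, hind σ hσ k⟩, fun h => hk ((S.smul_A_iff σ k.1 a).mp h)⟩
    have : (⨆ j, B j) ≤ (⨆ j, B j).comap (DistribSMul.toAddMonoidHom V σ) := by
      refine iSup_le fun j u hu => ?_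
      exact AddSubgroup.mem_iSup_of_mem (⟨σ • j.1, hind σ hσ j⟩ : {j // y ∈ U j})
        (S.smul_A σ j u hu)
    exact this ha

/-- If the valuation ring subgroup `A j` depends only on any `y ∈ U j`, it defines a polarity:
`P y` is the subgroup attached to `y`. -/
structure Polarity (U A : J → AddSubgroup V) (W : AddSubgroup V) (P : V → AddSubgroup V) :
    Prop where
  eq : ∀ y j, y ∉ W → y ∈ U j → A j = P y
  exists_eq : ∀ y, y ∉ W → ∃ j, y ∈ U j ∧ A j = P y

namespace Polarity

variable {P : V → AddSubgroup V}

theorem smul_mem_iff (S : InertialSystem p G W U A) (hP : Polarity U A W P) (σ : Γ) {x y : V}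
    (hy : y ∉ W) : σ • x ∈ P (σ • y) ↔ x ∈ P y := by
  obtain ⟨j, hj, hPj⟩ := hP.exists_eq y hy
  rw [← hP.eq (σ • y) (σ • j) (fun h => hy ((S.smul_W_iff σ y).mp h)) (S.smul_U σ j y hj),
    S.smul_A_iff, hPj]

theorem W_le (S : InertialSystem p G W U A) (hP : Polarity U A W P) {y : V} (hy : y ∉ W) :
    W ≤ P y := by
  obtain ⟨j, hj, hPj⟩ := hP.exists_eq y hy
  exact hPj ▸ S.W_le j

theorem self_mem (S : InertialSystem p G W U A) (hP : Polarity U A W P) {y : V} (hy : y ∉ W) :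
    y ∈ P y := by
  obtain ⟨j, hj, hPj⟩ := hP.exists_eq y hy
  exact hPj ▸ S.U_le j hj

theorem card_eq [Finite V] (S : InertialSystem p G W U A) (hP : Polarity U A W P) {x y : V}
    (hx : x ∉ W) (hy : y ∉ W) : Nat.card (P x) = Nat.card (P y) := by
  obtain ⟨i, hi, hPi⟩ := hP.exists_eq x hx
  obtain ⟨j, hj, hPj⟩ := hP.exists_eq y hy
  rw [← hPi, ← hPj]
  exact card_eq_of_smul_mem A S.smul_A S.trans_index i j

/-- Double counting of pairs with `a ∈ P b`. If `x ∈ P y` but `y ∉ P x`, translating `y` by `P x`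
with `x` fixed gives at least |P x| elements `v` with `x ∈ P v`, and by transitivity the same for
every `x' ∉ W`. But each `P y'` has fewer than |P x| elements outside `W`, since `0 ∈ W`. -/
theorem symm [Fact p.Prime] [Finite V] [Finite G] (S : InertialSystem p G W U A)
    (hP : Polarity U A W P) {x y : V} (hx : x ∉ W) (hy : y ∉ W) (hxy : x ∈ P y) : y ∈ P x := by
  classical
  by_contra hcon
  have := Fintype.ofFinite V
  let s : Finset V := Finset.univ.filter fun v => v ∉ W
  obtain ⟨j, hj, hPj⟩ := hP.exists_eq x hx
  have hbig : Nat.card (P x) ≤ (s.filter fun v => x ∈ P v).card := by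
    rw [← hPj] at hcon ⊢
    have hsub : (fun a => y + a) '' (A j : Set V) ⊆ (s.filter fun v => x ∈ P v : Finset V) := by
      rintro _ ⟨a, ha, rfl⟩
      obtain ⟨g, hg, hgx, hgy⟩ := S.exists_smul_eq_add hj hcon ha
      rw [Finset.coe_filter]
      refine ⟨?_, ?_⟩
      · simp only [s, Finset.mem_filter, Finset.mem_univ, true_and]
        rw [← hgy, S.smul_W_iff]
        exact hy
      · change x ∈ P (y + a)
        rw [← hgy]
        nth_rewrite 1 [← hgx]
        exact (hP.smul_mem_iff S g hy).mpr hxy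
    have h1 := Set.ncard_le_ncard hsub (Set.toFinite _)
    rw [Set.ncard_image_of_injective _ (add_right_injective y), Set.ncard_coe_finset] at h1
    exact h1
  have hall : ∀ x' ∈ s, Nat.card (P x) ≤ (s.filter fun v => x' ∈ P v).card := by
    intro x' hx'
    obtain ⟨g, hg, rfl⟩ := S.trans x x' hx (by simpa [s] using hx')
    refine hbig.trans (Finset.card_le_card_of_injOn (fun v => g • v) ?_ ?_)
    · intro v hv
      simp only [s, Finset.coe_filter, Finset.mem_filter, Finset.mem_univ, true_and,
        Set.mem_ofPred_eq] at hv ⊢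
      exact ⟨fun h => hv.1 ((S.smul_W_iff g v).mp h), (hP.smul_mem_iff S g hv.1).mpr hv.2⟩
    · intro a _ b _ hab
      exact smul_left_cancel g hab
  have hsmall : ∀ y' ∈ s, (s.filter fun v => v ∈ P y').card < Nat.card (P x) := by
    intro y' hy'
    have hy'W : y' ∉ W := by simpa [s] using hy'
    rw [hP.card_eq S hx hy'W, ← Set.ncard_coe_finset]
    refine Set.ncard_lt_ncard (t := (P y' : Set V)) ⟨?_, ?_⟩ (Set.toFinite _)
    · intro v hv
      simpa using (Finset.mem_filter.mp (Finset.mem_coe.mp hv)).2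
    · intro h
      have := h (zero_mem (P y'))
      simp only [s, Finset.coe_filter, Finset.mem_filter, Finset.mem_univ, true_and,
        Set.mem_ofPred_eq] at this
      exact this.1 (zero_mem W)
  have hdc := Finset.sum_card_bipartiteAbove_eq_sum_card_bipartiteBelow (s := s) (t := s)
    (fun a b => a ∈ P b)
  have h1 : s.card * Nat.card (P x) ≤ ∑ a ∈ s, (s.bipartiteAbove (fun a b => a ∈ P b) a).card := by
    rw [← smul_eq_mul]
    exact Finset.card_nsmul_le_sum _ _ _ hall
  have hs : s.Nonempty := ⟨x, by simpa [s] using hx⟩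
  have h2 : ∑ b ∈ s, (s.bipartiteBelow (fun a b => a ∈ P b) b).card < s.card * Nat.card (P x) := by
    rw [← smul_eq_mul, ← Finset.sum_const]
    exact Finset.sum_lt_sum_of_nonempty hs hsmall
  omega

theorem exists_notMem_of_ne [Finite V] {D E F : AddSubgroup V} (hE : ¬ D ≤ E) (hF : ¬ D ≤ F) :
    ∃ w ∈ D, w ∉ E ∧ w ∉ F := by
  obtain ⟨a, ha, haE⟩ := SetLike.not_le_iff_exists.mp hE
  obtain ⟨b, hb, hbF⟩ := SetLike.not_le_iff_exists.mp hF
  by_cases haF : a ∈ F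
  · by_cases hbE : b ∈ E
    · exact ⟨a + b, add_mem ha hb, fun h => haE (by simpa using sub_mem h hbE),
        fun h => hbF (by simpa using sub_mem h haF)⟩
    · exact ⟨b, hb, hbE, hbF⟩
  · exact ⟨a, ha, haE, haF⟩

/-- The orbit is the set of v ∈ P y \ W with `P v ≠ P y`. For `v' ∉ P v`, the translation by `v' -
v` at a place where this difference is small sends `v` to `v'`. It fixes `y`: a nonzero `g • y - y`
would be small there and perpendicular to `v'`, forcing `v' ∈ A j` and then `v ∈ A j`. -/
theorem hasCanonicalOrbit_of_exists_ne [Fact p.Prime] [Finite V] [Finite G]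
    (S : InertialSystem p G W U A) (hP : Polarity U A W P) {x y : V} (hx : x ∉ W) (hy : y ∉ W)
    (hxy : x ∈ P y) (hne : P x ≠ P y) : HasCanonicalOrbit G y := by
  have hnle : ∀ v, v ∉ W → P v ≠ P y → ¬ P y ≤ P v := fun v hv hne h =>
    hne (AddSubgroup.eq_of_le_of_card_ge h (hP.card_eq S hv hy).le).symm
  have step : ∀ v v', v ∉ W → v' ∉ W → v ∈ P y → v' ∈ P y → v' ∉ P v →
      ∃ g ∈ G, g • y = y ∧ g • v = v' := by
    intro v v' hv hv' hvy hvy' hvv'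
    have hd : v' - v ∉ P v := fun h => hvv' (by simpa using add_mem h (hP.self_mem S hv))
    have hdW : v' - v ∉ W := fun h => hd (hP.W_le S hv h)
    obtain ⟨j, hj, hPj⟩ := hP.exists_eq _ hdW
    have hvd : v ∉ A j := fun h => hd (hP.symm S hv hdW (hPj ▸ h))
    obtain ⟨g, hg, hgj, -, hgv⟩ := S.exists_unipotent_large hvd (S.U_le j hj)
    rw [add_sub_cancel] at hgv
    refine ⟨g, hg, ?_, hgv⟩
    have hyj : y ∈ A j := by
      rw [hPj]
      exact hP.symm S hdW hy (sub_mem hvy' hvy)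
    have hη : g • y - y ∈ U j := S.smul_sub_mem j g hg hgj y hyj
    by_contra hgy
    have hη0 : g • y - y ≠ 0 := sub_ne_zero.mpr hgy
    have hηW : g • y - y ∉ W := fun h => hη0 (S.eq_zero j _ hη h)
    have hgyW : g • y ∉ W := fun h => hy ((S.smul_W_iff g y).mp h)
    have h1 : g • y ∈ P v' := by
      refine hP.symm S hv' hgyW ?_
      rw [← hgv]
      exact (hP.smul_mem_iff S g hy).mpr hvy
    have h2 : y ∈ P v' := hP.symm S hv' hy hvy'
    have h3 : v' ∈ A j := by
      rw [hP.eq _ j hηW hη]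
      exact hP.symm S hηW hv' (sub_mem h1 h2)
    exact hvd (by simpa using sub_mem h3 (S.U_le j hj))
  -- Two arbitrary points are joined through a third, because `P y` is not the union of two proper
  -- subgroups.
  have hmid : ∀ v v', v ∉ W → v' ∉ W → v ∈ P y → P v ≠ P y → P v' ≠ P y →
      ∃ w ∈ P y, w ∉ W ∧ w ∉ P v ∧ w ∉ P v' ∧ P w ≠ P y := by
    intro v v' hv hv' hvy hne hne'
    obtain ⟨w, hw, hwv, hwv'⟩ := exists_notMem_of_ne (hnle v hv hne) (hnle v' hv' hne')
    have hwW : w ∉ W := fun h => hwv (hP.W_le S hv h)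
    exact ⟨w, hw, hwW, hwv, hwv', fun h => hwv (hP.symm S hv hwW (h ▸ hvy))⟩
  refine ⟨{v | v ∉ W ∧ v ∈ P y ∧ P v ≠ P y}, ?_, ?_, ?_⟩
  · obtain ⟨w, hw, hwW, hwx, -, hwne⟩ := hmid x x hx hx hxy hne hne
    exact ⟨x, ⟨hx, hxy, hne⟩, w, ⟨hwW, hw, hwne⟩, fun h => hwx (h ▸ hP.self_mem S hx)⟩
  · rintro v ⟨hv, hvy, hvne⟩ v' ⟨hv', hvy', hvne'⟩
    obtain ⟨w, hw, hwW, hwv, hwv', -⟩ := hmid v v' hv hv' hvy hvne hvne'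
    obtain ⟨g, hg, hgy, hgv⟩ := step v w hv hwW hvy hw hwv
    obtain ⟨h, hh, hhy, hhv⟩ := step v' w hv' hwW hvy' hw hwv'
    refine ⟨h⁻¹ * g, mul_mem (inv_mem hh) hg, ?_, ?_⟩
    · rw [mul_smul, hgy, inv_smul_eq_iff, hhy]
    · rw [mul_smul, hgv, inv_smul_eq_iff, hhv]
  · rintro σ hσ v ⟨hv, hvy, hvne⟩
    have h1 : ∀ x, σ • x ∈ P y ↔ x ∈ P y := by
      intro x
      have := hP.smul_mem_iff S σ (x := x) hy
      rwa [hσ] at this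
    refine ⟨fun h => hv ((S.smul_W_iff σ v).mp h), (h1 v).mpr hvy, fun h => hvne ?_⟩
    ext x
    rw [← hP.smul_mem_iff S σ hv, h, h1]

/-- A `p`-group of automorphisms preserving a proper subgroup of a finite elementary abelian
`p`-group fixes a non-trivial coset. -/
theorem exists_fixed_coset [Fact p.Prime] [Finite V] (hp : ∀ x : V, p • x = 0) {H : Type*}
    [Group H] [DistribMulAction H V] (hH : IsPGroup p H) (D : AddSubgroup V) (hD : D ≠ ⊤)
    (hHD : ∀ g : H, ∀ x ∈ D, g • x ∈ D) : ∃ v, v ∉ D ∧ ∀ g : H, g • v - v ∈ D := by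
  let _ : MulAction H (V ⧸ D) :=
    { smul := fun g => QuotientAddGroup.map D D (DistribSMul.toAddMonoidHom V g) (hHD g)
      one_smul := by
        intro x
        induction x using QuotientAddGroup.induction_on with
        | H x => exact congrArg _ (one_smul H x)
      mul_smul := by
        intro g h x
        induction x using QuotientAddGroup.induction_on with
        | H x => exact congrArg _ (mul_smul g h x) }
  have hsmul : ∀ (g : H) (x : V), g • (x : V ⧸ D) = ((g • x : V) : V ⧸ D) := fun _ _ => rfl
  have hdvd : p ∣ Nat.card (V ⧸ D) := by
    obtain ⟨n, hn⟩ := exists_card_eq_pow hp (⊤ : AddSubgroup V)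
    have h1 : Nat.card (V ⧸ D) ∣ p ^ n := by
      rw [← hn, AddSubgroup.card_top]
      exact AddSubgroup.card_quotient_dvd_card D
    obtain ⟨m, -, hm⟩ := (Nat.dvd_prime_pow Fact.out).mp h1
    rw [hm]
    refine dvd_pow_self p ?_
    rintro rfl
    rw [pow_zero] at hm
    exact hD (AddSubgroup.index_eq_one.mp hm)
  have h0 : (0 : V ⧸ D) ∈ fixedPoints H (V ⧸ D) := by
    intro g
    change g • ((0 : V) : V ⧸ D) = ((0 : V) : V ⧸ D)
    rw [hsmul, smul_zero]
  obtain ⟨b, hb, hb0⟩ := hH.exists_fixed_point_of_prime_dvd_card_of_fixed_point _ hdvd h0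
  induction b using QuotientAddGroup.induction_on with
  | H v =>
    refine ⟨v, fun h => hb0 ((QuotientAddGroup.eq_zero_iff v).mpr h).symm, fun g => ?_⟩
    have := hb g
    rw [hsmul, QuotientAddGroup.eq] at this
    have := neg_mem this
    simpa [sub_eq_add_neg, add_comm] using this

/-- Here the `P y` meet pairwise in `W`, and the complement of `A j = P y` is one orbit of the
stabilizer of `y`: bring a point into a chosen coset of `A j`, then translate by `A j` with `y`
fixed. -/
theorem hasCanonicalOrbit_of_forall_eq [Fact p.Prime] [Finite V] [Finite G]
    (S : InertialSystem p G W U A) (htop : ∀ j, A j ≠ ⊤) (hP : Polarity U A W P)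
    (heq : ∀ x y, x ∉ W → y ∉ W → x ∈ P y → P x = P y) : ∃ y, y ∉ W ∧ HasCanonicalOrbit G y := by
  obtain ⟨j, x, hx, hx'⟩ := S.exists_mem_notMem
  have hxW : x ∉ W := fun h => hx' (AddSubgroup.mem_sup_right h)
  obtain ⟨y, hy, hy0⟩ : ∃ y ∈ U j, y ≠ 0 := by
    obtain ⟨i, hi⟩ := S.cover x hxW
    obtain ⟨g, -, rfl⟩ := S.trans_index i j
    exact ⟨g • x, S.smul_U g i x hi, fun h => hxW (by
      rw [smul_eq_zero_iff_eq] at h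
      exact h ▸ zero_mem W)⟩
  have hyW : y ∉ W := fun h => hy0 (S.eq_zero j y hy h)
  have hAy : A j = P y := hP.eq y j hyW hy
  have hPA : ∀ z, z ∉ W → z ∈ A j → P z = A j := fun z hz hzA => by
    rw [hAy]
    exact heq z y hz hyW (hAy ▸ hzA)
  have hstab : ∀ g : Γ, ∀ z, z ∉ W → z ∈ A j → g • z ∈ A j → ∀ v, g • v ∈ A j ↔ v ∈ A j := by
    intro g z hz hzA hgz v
    have := hP.smul_mem_iff S g (x := v) hz
    rwa [hPA _ (fun h => hz ((S.smul_W_iff g z).mp h)) hgz, hPA z hz hzA] at this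
  -- Elements acting trivially on V / A j already connect A j \ W modulo `W`, by the connectivity
  -- lemma applied to the subgroups `U i ⊔ W` with `A i = A j`.
  have hmod : ∀ z z', z ∉ W → z' ∉ W → z ∈ A j → z' ∈ A j →
      ∃ g ∈ G, (∀ v, g • v - v ∈ A j) ∧ ∃ w ∈ W, g • z = z' + w := by
    intro z z' hz hz' hzA hzA'
    let B : {i // A i = A j} → AddSubgroup V := fun i => U i ⊔ W
    have hcover : ∀ v, v ∉ W → v ∈ A j → v ∈ ⨆ i, B i := by
      intro v hv hvA
      obtain ⟨i, hi⟩ := S.cover v hv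
      exact AddSubgroup.mem_iSup_of_mem
        (⟨i, (hP.eq v i hv hi).trans (hPA v hv hvA)⟩ : {i // A i = A j})
        (AddSubgroup.mem_sup_left hi)
    have hnot : ∀ v, v ∉ W → v ∈ A j → ∃ i, v ∉ B i := by
      intro v hv hvA
      obtain ⟨g, -, rfl⟩ := S.trans x v hxW hv
      refine ⟨⟨g • j, ?_⟩, fun h => hx' ((S.smul_sup_iff g j x).mp h)⟩
      ext u
      rw [← smul_inv_smul g u, S.smul_A_iff, ← hstab g x hxW hx hvA]
    refine rel_of_mem_iSup_of_notMem_iInf B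
      (fun i k => card_eq_of_smul_mem (fun i => U i ⊔ W) S.smul_sup S.trans_index _ _)
      (fun a b => ∃ g ∈ G, (∀ v, g • v - v ∈ A j) ∧ ∃ w ∈ W, g • a = b + w)
      ⟨fun a => ⟨1, one_mem _, by simp, 0, zero_mem _, by simp⟩, ?_, ?_⟩ ?_
      (hcover z hz hzA) (hcover z' hz' hzA') (hnot z hz hzA) (hnot z' hz' hzA')
    · rintro a b ⟨g, hg, hgA, w, hw, hgw⟩
      refine ⟨g⁻¹, inv_mem hg, fun v => ?_, -w, neg_mem hw, ?_⟩
      · simpa using neg_mem (hgA (g⁻¹ • v))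
      · rw [inv_smul_eq_iff, smul_add, hgw, S.fixed g hg _ (neg_mem hw)]
        abel
    · rintro a b c ⟨g, hg, hgA, w, hw, hgw⟩ ⟨h, hh, hhA, w', hw', hhw⟩
      refine ⟨h * g, mul_mem hh hg, fun v => ?_, w' + w, add_mem hw' hw, ?_⟩
      · simpa [mul_smul] using add_mem (hhA (g • v)) (hgA v)
      · rw [mul_smul, hgw, smul_add, hhw, S.fixed h hh w hw]
        abel
    · rintro ⟨i, hi⟩ a b hb ha
      by_cases haA : a ∈ A i
      · obtain ⟨u, hu, w, hw, rfl⟩ := AddSubgroup.mem_sup.mp hb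
        obtain ⟨g, hg, hgi, ⟨m, hm⟩, hga⟩ := S.exists_unipotent_small haA ha hu
        exact ⟨g, hg, fun v => hi ▸ S.unipotent_sub_mem i g hg hgi m hm v, -w, neg_mem hw, by
          rw [hga]; abel⟩
      · obtain ⟨g, hg, hgi, ⟨m, hm⟩, hga⟩ := S.exists_unipotent_large haA
          ((sup_le (S.U_le i) (S.W_le i) : U i ⊔ W ≤ A i) hb)
        exact ⟨g, hg, fun v => hi ▸ S.unipotent_sub_mem i g hg hgi m hm v, 0, zero_mem _, by
          rw [hga, add_zero]⟩
  let H : Subgroup Γ :=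
    { carrier := {g | g ∈ G ∧ g • y - y ∈ W}
      mul_mem' := by
        rintro g h ⟨hg, hgy⟩ ⟨hh, hhy⟩
        refine ⟨mul_mem hg hh, ?_⟩
        have := add_mem (S.smul_W g _ hhy) hgy
        simpa [mul_smul, smul_sub] using this
      one_mem' := ⟨one_mem _, by simp⟩
      inv_mem' := by
        rintro g ⟨hg, hgy⟩
        refine ⟨inv_mem hg, ?_⟩
        have := neg_mem (S.smul_W g⁻¹ _ hgy)
        simpa [smul_sub] using this }
  have hfin : Finite H := Finite.of_injective
    (Subgroup.inclusion (fun g hg => hg.1 : H ≤ G)) (Subgroup.inclusion_injective _)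
  obtain ⟨Sy⟩ : Nonempty (Sylow p H) := inferInstance
  have hHA : ∀ g ∈ H, ∀ v, g • v ∈ A j ↔ v ∈ A j := fun g hg =>
    hstab g y hyW (S.U_le j hy) (by
      have := add_mem (S.W_le j hg.2) (S.U_le j hy)
      simpa using this)
  obtain ⟨v0, hv0, hfix⟩ := exists_fixed_coset S.char_smul Sy.isPGroup' (A j) (htop j)
    (fun g v hv => (hHA g.1 g.1.2 v).mpr hv)
  have hSW : ∀ w ∈ W, ∃ g ∈ Sy, g • y = y + w := by
    refine exists_sylow_orbit S.char_smul H Sy W y (fun g hg => hg.2) fun w hw => ?_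
    obtain ⟨g, hg, hgy⟩ := S.trans y (y + w) hyW (fun h => hyW (by simpa using sub_mem h hw))
    exact ⟨g, ⟨hg, by rw [hgy]; simpa using hw⟩, hgy⟩
  -- `h` takes `v` to `v0`, `g` takes `h • z` to `y + w` without changing cosets of `A j`, and `k`
  -- in the Sylow subgroup removes `w`. The coset of `v0` was chosen fixed by that Sylow subgroup.
  have hred : ∀ z v, z ∉ W → z ∈ A j → v ∉ A j → ∃ g ∈ G, g • z = y ∧ g • v - v0 ∈ A j := by
    intro z v hz hzA hv
    obtain ⟨h, hh, hhj, hhv⟩ := S.exists_large j v v0 hv hv0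
    have hhz : h • z ∈ A j := by
      have := S.smul_A h j z hzA
      rwa [hhj] at this
    obtain ⟨g, hg, hgA, w, hw, hgz⟩ := hmod (h • z) y (fun H => hz ((S.smul_W_iff h z).mp H)) hyW
      hhz (S.U_le j hy)
    obtain ⟨k, hk, hky⟩ := hSW (-w) (neg_mem hw)
    refine ⟨k * (g * h), mul_mem k.2.1 (mul_mem hg hh), ?_, ?_⟩
    · rw [mul_smul, mul_smul, hgz, smul_add, S.fixed k k.2.1 w hw]
      have : (k : Γ) • y = y + -w := hky
      rw [this]
      abel
    · rw [mul_smul, mul_smul, hhv]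
      have h1 : (k : Γ) • (g • v0 - v0) ∈ A j := (hHA k k.2 _).mpr (hgA v0)
      have h2 : (k : Γ) • v0 - v0 ∈ A j := hfix ⟨k, hk⟩
      have := add_mem h1 h2
      simpa [smul_sub] using this
  refine ⟨y, hyW, {v | v ∉ A j}, ?_, ?_, ?_⟩
  · exact ⟨v0, hv0, v0 + y, fun h => hv0 (by simpa using sub_mem h (S.U_le j hy)), by simpa using hy0⟩
  · intro v hv v' hv'
    obtain ⟨g, hg, hgy, hgv⟩ := hred y v hyW (S.U_le j hy) hv
    obtain ⟨h, hh, hhy, hhv⟩ := hred y v' hyW (S.U_le j hy) hv'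
    have hgA : g • v ∉ A j := fun H => hv0 (by simpa using sub_mem H hgv)
    obtain ⟨k, hk, hky, hkv⟩ := S.exists_smul_eq_add hy hgA
      (a := h • v' - g • v) (by simpa using sub_mem hhv hgv)
    refine ⟨h⁻¹ * (k * g), mul_mem (inv_mem hh) (mul_mem hk hg), ?_, ?_⟩
    · rw [mul_smul, mul_smul, hgy, hky, inv_smul_eq_iff, hhy]
    · rw [mul_smul, mul_smul, hkv, inv_smul_eq_iff]
      abel
  · intro σ hσ v hv h
    refine hv ((hstab σ y hyW (S.U_le j hy) ?_ v).mp h)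
    rw [hσ]
    exact S.U_le j hy

end Polarity

/-- By transitivity of `G` on nonconstant roots, one suitable point suffices, so each case may pick
its own. -/
theorem hasCanonicalOrbit [Fact p.Prime] [Finite V] [Finite G] [G.Normal]
    (S : InertialSystem p G W U A) {y : V} (hy : y ∉ W) : HasCanonicalOrbit G y := by
  suffices h : ∃ z, z ∉ W ∧ HasCanonicalOrbit G z by
    obtain ⟨z, hz, hcan⟩ := h
    obtain ⟨g, hg, rfl⟩ := S.trans z y hz hy
    exact hcan.smul hg
  have hsmulA : ∀ (g : Γ) j, A (g • j) = ⊤ ↔ A j = ⊤ := by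
    intro g j
    constructor
    · intro h
      ext v
      rw [← S.smul_A_iff g, h]
      simp
    · intro h
      ext v
      rw [← smul_inv_smul g v, S.smul_A_iff g, h]
      simp
  by_cases htop : ∃ j, A j = ⊤
  · obtain ⟨j, hj⟩ := htop
    refine ⟨y, hy, S.hasCanonicalOrbit_of_eq_top (fun i => ?_) hy⟩
    obtain ⟨g, -, rfl⟩ := S.trans_index j i
    exact (hsmulA g j).mpr hj
  push Not at htop
  by_cases hne : ∃ z, z ∉ W ∧ ∃ i j, z ∈ U i ∧ z ∈ U j ∧ A i ≠ A j
  · obtain ⟨z, hz, i, j, hi, hj, hij⟩ := hne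
    exact ⟨z, hz, S.hasCanonicalOrbit_of_exists_ne hi hj hij⟩
  push Not at hne
  have : Nonempty J := let ⟨j, _⟩ := S.exists_mem_notMem; ⟨j⟩
  choose! f hf using S.cover
  have hP : Polarity U A W (fun v => A (f v)) :=
    ⟨fun v j hv hj => hne v hv j (f v) hj (hf v hv), fun v hv => ⟨f v, hf v hv, rfl⟩⟩
  by_cases hB : ∃ x y, x ∉ W ∧ y ∉ W ∧ x ∈ A (f y) ∧ A (f x) ≠ A (f y)
  · obtain ⟨x, z, hx, hz, hxz, hxz'⟩ := hB
    exact ⟨z, hz, hP.hasCanonicalOrbit_of_exists_ne S hx hz hxz hxz'⟩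
  push Not at hB
  exact hP.hasCanonicalOrbit_of_forall_eq S htop hB

end InertialSystem

end

/-! ### Conjugacy of valuation rings above a maximal ideal of a Dedekind domain. -/

section

open scoped Pointwise

theorem ValuationSubring.mem_of_isIntegral {A Ω : Type*} [CommRing A] [Field Ω] [Algebra A Ω]
    (O : ValuationSubring Ω) (hO : ∀ a : A, algebraMap A Ω a ∈ O) {x : Ω} (hx : IsIntegral A x) :
    x ∈ O := by
  let φ : A →+* O := (algebraMap A Ω).codRestrict O.toSubring hO
  have hint : IsIntegral O x := by
    obtain ⟨f, hf, hfx⟩ := hx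
    refine ⟨f.map φ, hf.map φ, ?_⟩
    rw [Polynomial.eval₂_map]
    exact hfx
  obtain ⟨y, rfl⟩ := IsIntegrallyClosed.isIntegral_iff.mp hint
  exact y.2

theorem ValuationSubring.mem_nonunits_iff_of_mem {Ω : Type*} [Field Ω] {O : ValuationSubring Ω}
    {x : Ω} (hx : x ∈ O) : x ∈ O.nonunits ↔ (⟨x, hx⟩ : O) ∈ IsLocalRing.maximalIdeal O := by
  rw [ValuationSubring.mem_nonunits_iff_exists_mem_maximalIdeal]
  exact ⟨fun ⟨_, h⟩ => h, fun h => ⟨hx, h⟩⟩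

/-- The localization at `P` is a field or a discrete valuation ring, so one of a/b, b/a has a
denominator outside `P`. -/
theorem IsDedekindDomain.exists_mul_eq_mul {B : Type*} [CommRing B] [IsDedekindDomain B]
    (P : Ideal B) [P.IsPrime] (a b : B) : ∃ s, s ∉ P ∧ ∃ c, s * a = c * b ∨ s * b = c * a := by
  by_cases hP : P = ⊥
  · by_cases hb : b = 0
    · exact ⟨1, Ideal.one_notMem P, 0, Or.inr (by simp [hb])⟩
    · exact ⟨b, by simpa [hP] using hb, a, Or.inl (mul_comm b a)⟩
  have := IsLocalization.AtPrime.isDiscreteValuationRing_of_dedekind_domain B hP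
    (Localization.AtPrime P)
  have key : ∀ a b : B, algebraMap B (Localization.AtPrime P) b ∣ algebraMap B _ a →
      ∃ s, s ∉ P ∧ ∃ c, s * a = c * b := by
    rintro a b ⟨z, hz⟩
    obtain ⟨c, s, rfl⟩ := IsLocalization.exists_mk'_eq P.primeCompl z
    refine ⟨s, s.2, c, ?_⟩
    apply IsLocalization.injective (Localization.AtPrime P) P.primeCompl_le_nonZeroDivisors
    rw [map_mul, map_mul, hz, mul_comm (algebraMap B _ b), ← mul_assoc, mul_comm,
      IsLocalization.mk'_spec' ]
    ring
  rcases ValuationRing.dvd_total (algebraMap B (Localization.AtPrime P) a)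
    (algebraMap B (Localization.AtPrime P) b) with h | h
  · obtain ⟨s, hs, c, hc⟩ := key _ _ h
    exact ⟨s, hs, c, Or.inr hc⟩
  · obtain ⟨s, hs, c, hc⟩ := key _ _ h
    exact ⟨s, hs, c, Or.inl hc⟩

/-- Valuation rings of a finite Galois extension dominating the localization of a Dedekind domain
at the same maximal ideal are conjugate. -/
theorem ValuationSubring.exists_galois_conj {A F Ω : Type*} [CommRing A] [IsDedekindDomain A]
    [Field F] [Algebra A F] [IsFractionRing A F] [Field Ω] [Algebra F Ω] [Algebra A Ω]
    [IsScalarTower A F Ω] [FiniteDimensional F Ω] [IsGalois F Ω] (m : Ideal A) [m.IsMaximal]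
    (O O' : ValuationSubring Ω) (hO : ∀ a : A, algebraMap A Ω a ∈ O)
    (hO' : ∀ a : A, algebraMap A Ω a ∈ O') (hm : ∀ a ∈ m, algebraMap A Ω a ∈ O.nonunits)
    (hm' : ∀ a ∈ m, algebraMap A Ω a ∈ O'.nonunits) : ∃ σ : Ω ≃ₐ[F] Ω, σ • O = O' := by
  let B := integralClosure A Ω
  have hB : IsDedekindDomain B := integralClosure.isDedekindDomain A F Ω
  have hFrac : IsFractionRing B Ω := integralClosure.isFractionRing_of_finite_extension F Ω
  let _ : MulSemiringAction (Ω ≃ₐ[F] Ω) B := IsIntegralClosure.MulSemiringAction A F Ω B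
  have hinv : Algebra.IsInvariant A B (Ω ≃ₐ[F] Ω) := Algebra.isInvariant_of_isGalois A F Ω B
  have hcoe : ∀ (σ : Ω ≃ₐ[F] Ω) (b : B), ((σ • b : B) : Ω) = σ b := fun σ b =>
    algebraMap_galRestrict_apply A σ b
  have hmem : ∀ O : ValuationSubring Ω, (∀ a : A, algebraMap A Ω a ∈ O) → ∀ b : B, (b : Ω) ∈ O :=
    fun O hO b => O.mem_of_isIntegral hO b.2
  let ψ : ∀ O : ValuationSubring Ω, (∀ a : A, algebraMap A Ω a ∈ O) → B →+* O := fun O hO =>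
    (algebraMap B Ω).codRestrict O.toSubring (hmem O hO)
  let P : ∀ O : ValuationSubring Ω, (∀ a : A, algebraMap A Ω a ∈ O) → Ideal B := fun O hO =>
    (IsLocalRing.maximalIdeal O).comap (ψ O hO)
  have hPmem : ∀ O hO b, b ∈ P O hO ↔ (b : Ω) ∈ O.nonunits := fun O hO b =>
    (ValuationSubring.mem_nonunits_iff_of_mem (hmem O hO b)).symm
  have hPprime : ∀ O hO, (P O hO).IsPrime := fun O hO => Ideal.IsPrime.comap _
  have hunder : ∀ O hO, (∀ a ∈ m, algebraMap A Ω a ∈ O.nonunits) → (P O hO).under A = m := by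
    intro O hO hm
    refine (Ideal.IsMaximal.eq_of_le inferInstance
      (Ideal.IsPrime.ne_top ((hPprime O hO).comap _)) fun a ha => ?_).symm
    exact (hPmem O hO _).mpr (hm a ha)
  have hcomm : SMulCommClass (Ω ≃ₐ[F] Ω) A B := ⟨fun σ a b => by
    apply Subtype.ext
    rw [hcoe]
    simp only [Algebra.smul_def, MulMemClass.coe_mul, hcoe, map_mul]
    congr 1
    change σ (algebraMap A Ω a) = algebraMap A Ω a
    rw [IsScalarTower.algebraMap_apply A F Ω, σ.commutes]⟩
  obtain ⟨σ, hσ⟩ := Algebra.IsInvariant.exists_smul_of_under_eq A B (Ω ≃ₐ[F] Ω) (P O hO) (P O' hO')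
    ((hunder O hO hm).trans (hunder O' hO' hm').symm)
  have key : ∀ (O O' : ValuationSubring Ω) hO hO' (σ : Ω ≃ₐ[F] Ω), P O' hO' = σ • P O hO →
      ∀ x ∈ O, σ x ∈ O' := by
    intro O O' hO hO' σ hσ x hx
    obtain ⟨a, b, hb, rfl⟩ := IsFractionRing.div_surjective (A := B) x
    have hb0 : (b : Ω) ≠ 0 := fun h => nonZeroDivisors.ne_zero hb (Subtype.ext h)
    change (a : Ω) / b ∈ O at hx
    change σ ((a : Ω) / b) ∈ O'
    have hP := hPprime O hO
    -- A fraction in `O` can be written with denominator outside `P O`. In the unwanted alternative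
    -- with `c ∈ P O`, the element s = c (a/b) would be a nonunit.
    obtain ⟨s, hs, c, hc⟩ : ∃ s, s ∉ P O hO ∧ ∃ c, s * a = c * b := by
      obtain ⟨s, hs, c, hc | hc⟩ := IsDedekindDomain.exists_mul_eq_mul (P O hO) a b
      · exact ⟨s, hs, c, hc⟩
      by_cases hcP : c ∈ P O hO
      · exfalso
        apply hs
        rw [hPmem O hO] at hcP ⊢
        have h1 : (s : Ω) * b = c * a := congrArg Subtype.val hc
        have h2 : (s : Ω) = c * (a / b) := by
          rw [mul_div_assoc', ← h1, mul_div_cancel_right₀ _ hb0]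
        rw [h2, ValuationSubring.mem_nonunits_iff, map_mul]
        exact mul_lt_one_of_lt_of_le hcP ((ValuationSubring.valuation_le_one_iff O _).mpr hx)
      · exact ⟨c, hcP, s, hc.symm⟩
    have hs' : σ • s ∉ P O' hO' := by
      rw [hσ]
      exact fun h => hs (Ideal.smul_mem_pointwise_smul_iff.mp h)
    rw [hPmem O' hO', hcoe] at hs'
    have h0 : (s : Ω) ≠ 0 := fun h => hs (by
      rw [hPmem O hO, h, ValuationSubring.mem_nonunits_iff, map_zero]
      exact zero_lt_one)
    have h1 : (s : Ω) * a = c * b := congrArg Subtype.val hc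
    have h2 : (a : Ω) / b = c / s := by
      rw [div_eq_div_iff hb0 h0, mul_comm, h1]
    rw [h2, map_div₀, div_eq_mul_inv]
    refine O'.mul_mem _ _ ?_ ?_
    · rw [← hcoe]
      exact hmem O' hO' _
    · by_contra hcon
      exact hs' (O'.mem_nonunits_iff_or.mpr (Or.inr hcon))
  refine ⟨σ, ?_⟩
  ext x
  rw [ValuationSubring.mem_pointwise_smul_iff_inv_smul_mem]
  constructor
  · intro h
    have := key O O' hO hO' σ hσ _ h
    simpa using this
  · intro h
    exact key O' O hO' hO σ⁻¹ (by rw [hσ, inv_smul_smul]) x h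

end

/-! ### Rational subfields of a Galois extension of C(u). -/

section

open scoped Pointwise
open Polynomial

section RationalFunctionField

variable {C Ω : Type*} [Field C] [Field Ω] [Algebra C Ω]

/-- The embedding of the rational function field sending the variable to `t`. -/
noncomputable def ratFuncLift (t : Ω) (ht : Transcendental C t) : RatFunc C →ₐ[C] Ω :=
  RatFunc.liftAlgHom (aeval t)
    (nonZeroDivisors_le_comap_nonZeroDivisors_of_injective _ (transcendental_iff_injective.mp ht))

@[simp]
theorem ratFuncLift_X (t : Ω) (ht : Transcendental C t) : ratFuncLift t ht RatFunc.X = t := by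
  have := RatFunc.liftAlgHom_apply_div (φ := aeval (R := C) t)
    (hφ := nonZeroDivisors_le_comap_nonZeroDivisors_of_injective _
      (transcendental_iff_injective.mp ht)) X 1
  simpa [ratFuncLift] using this

theorem RatFunc.algHom_ext_X {f g : RatFunc C →ₐ[C] Ω} (h : f RatFunc.X = g RatFunc.X) :
    f = g := by
  have hpoly : ∀ q : C[X], f (algebraMap C[X] (RatFunc C) q) = g (algebraMap C[X] (RatFunc C) q) := by
    have : f.comp (IsScalarTower.toAlgHom C C[X] (RatFunc C)) =
        g.comp (IsScalarTower.toAlgHom C C[X] (RatFunc C)) := by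
      apply Polynomial.algHom_ext
      simpa using h
    exact fun q => DFunLike.congr_fun this q
  ext x
  obtain ⟨a, b, -, rfl⟩ := IsFractionRing.div_surjective (A := C[X]) x
  rw [map_div₀, map_div₀, hpoly, hpoly]

theorem transcendental_of_ratFuncLift_eq {t u : Ω} (ht : Transcendental C t)
    (hu : Transcendental C u) {ψ : RatFunc C} (h : ratFuncLift t ht ψ = u) :
    Transcendental C ψ := by
  intro halg
  exact hu (h ▸ halg.algHom (ratFuncLift t ht))

variable [Algebra (RatFunc C) Ω] [IsScalarTower C (RatFunc C) Ω]

theorem transcendental_algebraMap_X : Transcendental C (algebraMap (RatFunc C) Ω RatFunc.X) := by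
  rw [transcendental_algebraMap_iff (algebraMap (RatFunc C) Ω).injective]
  exact RatFunc.transcendental_X

theorem algebraMap_eq_ratFuncLift {t : Ω} (ht : Transcendental C t) {ψ : RatFunc C}
    (hψ : Transcendental C ψ) (h : ratFuncLift t ht ψ = algebraMap (RatFunc C) Ω RatFunc.X)
    (x : RatFunc C) :
    algebraMap (RatFunc C) Ω x = ratFuncLift t ht (ratFuncLift ψ hψ x) := by
  have : IsScalarTower.toAlgHom C (RatFunc C) Ω = (ratFuncLift t ht).comp (ratFuncLift ψ hψ) := by
    apply RatFunc.algHom_ext_X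
    simp [h]
  exact DFunLike.congr_fun this x

/-- Since ψ(v) = ψ(v') = u, the map `v ↦ v'` identifies C(v) with C(v') over C(u), so `v` and `v'`
share their minimal polynomial. -/
theorem exists_galois_of_ratFuncLift_eq [Normal (RatFunc C) Ω] {v v' : Ω}
    (hv : Transcendental C v) (hv' : Transcendental C v') {ψ : RatFunc C}
    (h : ratFuncLift v hv ψ = algebraMap (RatFunc C) Ω RatFunc.X)
    (h' : ratFuncLift v' hv' ψ = algebraMap (RatFunc C) Ω RatFunc.X) :
    ∃ g : Ω ≃ₐ[RatFunc C] Ω, g v = v' := by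
  have hψ : Transcendental C ψ :=
    transcendental_of_ratFuncLift_eq hv (transcendental_algebraMap_X (Ω := Ω)) h
  have hint : IsIntegral (RatFunc C) v := Normal.isIntegral inferInstance v
  have hcomp : ∀ w (hw : Transcendental C w),
      ratFuncLift w hw ψ = algebraMap (RatFunc C) Ω RatFunc.X → ∀ q : (RatFunc C)[X],
      aeval w q = ratFuncLift w hw (q.eval₂ (ratFuncLift ψ hψ : RatFunc C →+* RatFunc C)
        RatFunc.X) := by
    intro w hw hwψ q
    have e1 : algebraMap (RatFunc C) Ω = ((ratFuncLift w hw : RatFunc C →ₐ[C] Ω) :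
        RatFunc C →+* Ω).comp (ratFuncLift ψ hψ : RatFunc C →+* RatFunc C) :=
      RingHom.ext fun x => algebraMap_eq_ratFuncLift hw hψ hwψ x
    have e2 := Polynomial.hom_eval₂ q (ratFuncLift ψ hψ : RatFunc C →+* RatFunc C)
      ((ratFuncLift w hw : RatFunc C →ₐ[C] Ω) : RatFunc C →+* Ω) RatFunc.X
    rw [aeval_def, e1]
    simpa using e2.symm
  have h0 : aeval v' (minpoly (RatFunc C) v) = 0 := by
    have h1 := hcomp v hv h (minpoly (RatFunc C) v)
    rw [minpoly.aeval] at h1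
    rw [hcomp v' hv' h', (map_eq_zero_iff _ (ratFuncLift v hv).injective).mp h1.symm, map_zero]
  have hconj : IsConjRoot (RatFunc C) v v' :=
    minpoly.eq_of_irreducible_of_monic (minpoly.irreducible hint) h0 (minpoly.monic hint)
  obtain ⟨σ, hσ⟩ := (isConjRoot_iff_exists_algEquiv).mp hconj
  exact ⟨σ.symm, by rw [← hσ]; simp⟩

/-- Two places of `Ω` above the zero of the parameter `t` of a rational subfield are conjugate by
an automorphism fixing `t`. -/
theorem exists_galois_conj_of_parameter [FiniteDimensional (RatFunc C) Ω] [IsGalois (RatFunc C) Ω]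
    {t : Ω} (ht : Transcendental C t) {ψ : RatFunc C}
    (h : ratFuncLift t ht ψ = algebraMap (RatFunc C) Ω RatFunc.X) (O O' : ValuationSubring Ω)
    (hO : ∀ c : C, algebraMap C Ω c ∈ O) (hO' : ∀ c : C, algebraMap C Ω c ∈ O')
    (htO : t ∈ O.nonunits) (htO' : t ∈ O'.nonunits) :
    ∃ g : Ω ≃ₐ[RatFunc C] Ω, g t = t ∧ ∀ x, g x ∈ O' ↔ x ∈ O := by
  have hψ : Transcendental C ψ :=
    transcendental_of_ratFuncLift_eq ht (transcendental_algebraMap_X (Ω := Ω)) h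
  -- `F` stands for the field C(t) between C(u) and Ω.
  have key : ∀ (F : Type _) [Field F] [Algebra (RatFunc C) F] [Algebra C[X] F] [Algebra F Ω]
      [Algebra C[X] Ω] [IsScalarTower C[X] F Ω] [IsScalarTower (RatFunc C) F Ω]
      [IsFractionRing C[X] F], (∀ q : C[X], algebraMap C[X] Ω q = aeval t q) →
      ∃ g : Ω ≃ₐ[RatFunc C] Ω, g t = t ∧ ∀ x, g x ∈ O' ↔ x ∈ O := by
    intro F _ _ _ _ _ _ _ _ hmap
    have : FiniteDimensional F Ω := Module.Finite.of_restrictScalars_finite (RatFunc C) F Ω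
    have : IsGalois F Ω := IsGalois.tower_top_of_isGalois (RatFunc C) F Ω
    have hmemO : ∀ O : ValuationSubring Ω, (∀ c : C, algebraMap C Ω c ∈ O) → t ∈ O →
        ∀ q : C[X], algebraMap C[X] Ω q ∈ O := by
      intro O hO htO q
      rw [hmap]
      induction q using Polynomial.induction_on' with
      | add a b ha hb => rw [map_add]; exact O.add_mem _ _ ha hb
      | monomial n a =>
        rw [aeval_monomial]
        exact O.mul_mem _ _ (hO a) (pow_mem htO n)
    have hle : ∀ O : ValuationSubring Ω, t ∈ O.nonunits → t ∈ O := fun O h =>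
      (ValuationSubring.valuation_le_one_iff O t).mp (le_of_lt h)
    have hm : (Ideal.span {(X : C[X])}).IsMaximal :=
      PrincipalIdealRing.isMaximal_of_irreducible Polynomial.irreducible_X
    have hideal : ∀ O : ValuationSubring Ω, (∀ c : C, algebraMap C Ω c ∈ O) → t ∈ O.nonunits →
        ∀ q ∈ Ideal.span {(X : C[X])}, algebraMap C[X] Ω q ∈ O.nonunits := by
      intro O hO htO q hq
      obtain ⟨r, rfl⟩ := Ideal.mem_span_singleton.mp hq
      rw [map_mul, hmap X, aeval_X, ValuationSubring.mem_nonunits_iff, map_mul]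
      exact mul_lt_one_of_lt_of_le htO
        ((ValuationSubring.valuation_le_one_iff O _).mpr (hmemO O hO (hle O htO) r))
    obtain ⟨σ, hσ⟩ := ValuationSubring.exists_galois_conj (A := C[X]) (F := F)
      (Ideal.span {(X : C[X])}) O O' (hmemO O hO (hle O htO)) (hmemO O' hO' (hle O' htO'))
      (hideal O hO htO) (hideal O' hO' htO')
    refine ⟨σ.restrictScalars (RatFunc C), ?_, fun x => ?_⟩
    · have h1 : t = algebraMap F Ω (algebraMap C[X] F X) := by
        rw [← IsScalarTower.algebraMap_apply, hmap, aeval_X]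
      rw [h1]
      exact σ.commutes _
    · rw [← hσ]
      exact ValuationSubring.smul_mem_pointwise_smul_iff (g := σ)
  let e : FractionRing C[X] ≃ₐ[C[X]] RatFunc C := (RatFunc.toFractionRingAlgEquiv C C[X]).symm
  -- C(u) enters C(t) by the twisted map `u ↦ ψ`. Using `FractionRing C[X]` for C(t) keeps this
  -- structure apart from that of `RatFunc C` over itself.
  let _ : Algebra (RatFunc C) (FractionRing C[X]) :=
    ((e.symm : RatFunc C →+* FractionRing C[X]).comp
      (ratFuncLift ψ hψ : RatFunc C →+* RatFunc C)).toAlgebra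
  let _ : Algebra (FractionRing C[X]) Ω :=
    ((ratFuncLift t ht : RatFunc C →+* Ω).comp (e : FractionRing C[X] →+* RatFunc C)).toAlgebra
  let _ : Algebra C[X] Ω := (aeval (R := C) t : C[X] →+* Ω).toAlgebra
  have hpoly : ∀ q : C[X], ratFuncLift t ht (algebraMap C[X] (RatFunc C) q) = aeval t q := by
    have : (ratFuncLift t ht).comp (IsScalarTower.toAlgHom C C[X] (RatFunc C)) = aeval t := by
      apply Polynomial.algHom_ext
      simp
    exact fun q => DFunLike.congr_fun this q
  have : IsScalarTower C[X] (FractionRing C[X]) Ω := by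
    refine IsScalarTower.of_algebraMap_eq fun q => ?_
    change aeval t q = ratFuncLift t ht (e (algebraMap C[X] (FractionRing C[X]) q))
    rw [e.commutes, hpoly]
  have : IsScalarTower (RatFunc C) (FractionRing C[X]) Ω := by
    refine IsScalarTower.of_algebraMap_eq fun x => ?_
    change _ = ratFuncLift t ht (e (e.symm (ratFuncLift ψ hψ x)))
    rw [e.apply_symm_apply]
    exact algebraMap_eq_ratFuncLift ht hψ h x
  exact key (FractionRing C[X]) fun q => rfl

end RationalFunctionField

end

/-! ### Additive polynomials, residues and leading terms. -/

section

open scoped Pointwise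
open Polynomial

section AdditivePolynomials

/-- The linear combinations of the monomials `X ^ p ^ j`. -/
noncomputable def additivePolynomials (K : Type*) [Field K] (p : ℕ) : Submodule K K[X] :=
  Submodule.span K (Set.range fun j : ℕ => (X : K[X]) ^ p ^ j)

theorem map_mem_additivePolynomials {K F : Type*} [Field K] [Field F] {p : ℕ} {L : K[X]} (φ : K →+* F)
    (hL : L ∈ additivePolynomials K p) : L.map φ ∈ additivePolynomials F p := by
  induction hL using Submodule.span_induction with
  | mem f hf =>
    obtain ⟨j, rfl⟩ := hf
    exact Submodule.subset_span ⟨j, by simp⟩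
  | zero => simp
  | add f g _ _ hf hg => rw [Polynomial.map_add]; exact add_mem hf hg
  | smul c f _ hf => rw [Polynomial.map_smul]; exact Submodule.smul_mem _ _ hf

variable {K : Type*} [Field K] {p : ℕ} [Fact p.Prime] {L : K[X]}

theorem aeval_add_of_mem_additivePolynomials {A : Type*} [CommRing A] [Algebra K A] [CharP A p]
    (hL : L ∈ additivePolynomials K p) (x y : A) :
    aeval (x + y) L = aeval x L + aeval y L := by
  induction hL using Submodule.span_induction with
  | mem f hf =>
    obtain ⟨j, rfl⟩ := hf
    simp [add_pow_char_pow]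
  | zero => simp
  | add f g _ _ hf hg => rw [map_add, map_add, map_add, hf, hg]; abel
  | smul c f _ hf => rw [map_smul, map_smul, map_smul, hf, smul_add]

theorem coeff_zero_of_mem_additivePolynomials (hL : L ∈ additivePolynomials K p) :
    L.coeff 0 = 0 := by
  have hp : p.Prime := Fact.out
  induction hL using Submodule.span_induction with
  | mem f hf =>
    obtain ⟨j, rfl⟩ := hf
    rw [coeff_X_pow, if_neg (pow_pos hp.pos j).ne]
  | zero => simp
  | add f g _ _ hf hg => rw [coeff_add, hf, hg, add_zero]
  | smul c f _ hf => rw [coeff_smul, hf, smul_zero]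

theorem aeval_zero_of_mem_additivePolynomials {A : Type*} [CommRing A] [Algebra K A]
    (hL : L ∈ additivePolynomials K p) : aeval (0 : A) L = 0 := by
  rw [← coeff_zero_eq_aeval_zero', coeff_zero_of_mem_additivePolynomials hL, map_zero]

theorem derivative_of_mem_additivePolynomials [CharP K p] (hL : L ∈ additivePolynomials K p) :
    derivative L = C (L.coeff 1) := by
  have hp : p.Prime := Fact.out
  induction hL using Submodule.span_induction with
  | mem f hf =>
    obtain ⟨j, rfl⟩ := hf
    rcases Nat.eq_zero_or_pos j with rfl | hj
    · simp
    · have h1 : 1 < p ^ j := Nat.one_lt_pow hj.ne' hp.one_lt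
      have h0 : ((p ^ j : ℕ) : K) = 0 := by
        rw [Nat.cast_pow, CharP.cast_eq_zero, zero_pow hj.ne']
      simp only [derivative_X_pow, h0, map_zero, zero_mul, coeff_X_pow, if_neg h1.ne]
  | zero => simp
  | add f g _ _ hf hg => rw [derivative_add, coeff_add, hf, hg, C_add]
  | smul c f _ hf => rw [derivative_smul, coeff_smul, hf, smul_C]

theorem eq_divX_mul_X_of_mem_additivePolynomials (hL : L ∈ additivePolynomials K p) :
    L = L.divX * X := by
  conv_lhs => rw [← divX_mul_X_add L, coeff_zero_of_mem_additivePolynomials hL]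
  simp

end AdditivePolynomials

namespace ValuationSubring

variable {C Ω : Type*} [Field C] [Field Ω] [Algebra C Ω] {O : ValuationSubring Ω}

theorem valuation_algebraMap_eq_one (hC : ∀ c : C, algebraMap C Ω c ∈ O) {c : C} (hc : c ≠ 0) :
    O.valuation (algebraMap C Ω c) = 1 := by
  apply le_antisymm ((O.valuation_le_one_iff _).mpr (hC c))
  have h := (O.valuation_le_one_iff _).mpr (hC c⁻¹)
  rw [map_inv₀, map_inv₀] at h
  have h0 : O.valuation (algebraMap C Ω c) ≠ 0 := by simpa using hc
  exact (inv_le_one₀ (zero_lt_iff.mpr h0)).mp h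

theorem aeval_mem (hC : ∀ c : C, algebraMap C Ω c ∈ O) {x : Ω} (hx : x ∈ O) (h : C[X]) :
    aeval x h ∈ O := by
  induction h using Polynomial.induction_on' with
  | add a b ha hb => rw [map_add]; exact O.add_mem _ _ ha hb
  | monomial n a =>
    rw [aeval_monomial]
    exact O.mul_mem _ _ (hC a) (pow_mem hx n)

theorem valuation_add_lt {x y : Ω} (hx : O.valuation x < 1) (hy : O.valuation y < 1) :
    O.valuation (x + y) < 1 :=
  Valuation.map_add_lt _ hx hy

theorem valuation_sub_lt {x y : Ω} (hx : O.valuation x < 1) (hy : O.valuation y < 1) :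
    O.valuation (x - y) < 1 :=
  Valuation.map_sub_lt _ hx hy

theorem valuation_mul_lt {x y : Ω} (hx : x ∈ O) (hy : O.valuation y < 1) :
    O.valuation (x * y) < 1 := by
  rw [map_mul]
  exact (mul_le_of_le_one_left' ((O.valuation_le_one_iff _).mpr hx)).trans_lt hy

theorem mem_of_sub_algebraMap (hC : ∀ c : C, algebraMap C Ω c ∈ O) {x : Ω} {c : C}
    (hx : O.valuation (x - algebraMap C Ω c) < 1) : x ∈ O := by
  have := O.add_mem _ _ ((O.valuation_le_one_iff _).mp hx.le) (hC c)
  simpa using this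

theorem eq_of_valuation_sub_lt (hC : ∀ c : C, algebraMap C Ω c ∈ O) {x : Ω} {c d : C}
    (hc : O.valuation (x - algebraMap C Ω c) < 1) (hd : O.valuation (x - algebraMap C Ω d) < 1) :
    c = d := by
  by_contra hne
  have h := valuation_sub_lt hc hd
  rw [sub_sub_sub_cancel_left, ← map_sub,
    valuation_algebraMap_eq_one hC (sub_ne_zero.mpr (Ne.symm hne))] at h
  exact lt_irrefl _ h

theorem valuation_eq_one_of_sub_algebraMap (hC : ∀ c : C, algebraMap C Ω c ∈ O) {x : Ω} {c : C}
    (hc : c ≠ 0) (hx : O.valuation (x - algebraMap C Ω c) < 1) : O.valuation x = 1 := by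
  have h := valuation_algebraMap_eq_one hC hc
  rw [← h] at hx ⊢
  exact Valuation.map_eq_of_sub_lt _ hx

theorem valuation_aeval_sub_lt (hC : ∀ c : C, algebraMap C Ω c ∈ O) {x : Ω} {c : C}
    (hx : O.valuation (x - algebraMap C Ω c) < 1) (h : C[X]) :
    O.valuation (aeval x h - algebraMap C Ω (h.eval c)) < 1 := by
  have e := congrArg (aeval x) (X_sub_C_mul_divByMonic_eq_sub_modByMonic h c)
  rw [modByMonic_X_sub_C_eq_C_eval] at e
  simp only [map_mul, map_sub, aeval_X, aeval_C] at e
  rw [← e, mul_comm]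
  exact valuation_mul_lt (aeval_mem hC (mem_of_sub_algebraMap hC hx) _) hx

/-- Factor `h` into linear factors: if none is small at `x`, neither is their product. -/
theorem exists_isRoot_of_valuation_aeval_lt [IsAlgClosed C] (hC : ∀ c : C, algebraMap C Ω c ∈ O)
    {x : Ω} {h : C[X]} (h0 : h ≠ 0) (hx : O.valuation (aeval x h) < 1) :
    ∃ c : C, h.IsRoot c ∧ O.valuation (x - algebraMap C Ω c) < 1 := by
  by_contra! hcon
  have hs := (IsAlgClosed.splits h).eq_prod_roots
  have e : aeval x h = algebraMap C Ω h.leadingCoeff *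
      (h.roots.map fun c => x - algebraMap C Ω c).prod := by
    conv_lhs => rw [hs]
    simp [map_multiset_prod, Multiset.map_map]
  rw [e, map_mul, valuation_algebraMap_eq_one hC (leadingCoeff_ne_zero.mpr h0), one_mul,
    map_multiset_prod, Multiset.map_map] at hx
  apply absurd hx
  rw [not_lt]
  apply Multiset.one_le_prod_of_one_le
  intro a ha
  obtain ⟨c, hc, rfl⟩ := Multiset.mem_map.mp ha
  exact hcon c ((mem_roots h0).mp hc)

/-- Elements congruent to nonzero constants `a, a` and `b, b`. -/
theorem valuation_sub_one_lt_of_mul_eq (hC : ∀ c : C, algebraMap C Ω c ∈ O) {r x x' y y' : Ω}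
    {a b : C} (ha : a ≠ 0) (hb : b ≠ 0) (hx : O.valuation (x - algebraMap C Ω a) < 1)
    (hx' : O.valuation (x' - algebraMap C Ω a) < 1) (hy : O.valuation (y - algebraMap C Ω b) < 1)
    (hy' : O.valuation (y' - algebraMap C Ω b) < 1) (h : r * (x * y) = x' * y') :
    O.valuation (r - 1) < 1 := by
  have hxy : O.valuation (x * y) = 1 := by
    rw [map_mul, valuation_eq_one_of_sub_algebraMap hC ha hx,
      valuation_eq_one_of_sub_algebraMap hC hb hy, one_mul]
  have e : (r - 1) * (x * y) = (x' - x) * y' + x * (y' - y) := by linear_combination h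
  have h1 : O.valuation (x' - x) < 1 := by
    simpa using valuation_sub_lt hx' hx
  have h2 : O.valuation (y' - y) < 1 := by
    simpa using valuation_sub_lt hy' hy
  have h3 : O.valuation ((r - 1) * (x * y)) < 1 := by
    rw [e]
    refine valuation_add_lt ?_ (valuation_mul_lt (mem_of_sub_algebraMap hC hx) h2)
    rw [mul_comm]
    exact valuation_mul_lt (mem_of_sub_algebraMap hC hy') h1
  rwa [map_mul, hxy, mul_one] at h3

/-- An automorphism of `p`-power order acts trivially on leading terms when these are determined
up to roots of unity. -/
theorem not_of_pow_prime_pow_eq_one [IsAlgClosed C] {p : ℕ} [Fact p.Prime] [CharP C p]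
    (hC : ∀ c : C, algebraMap C Ω c ∈ O) {S : Ω → Prop} {e : ℕ} (he : 0 < e)
    (h0 : ∀ v, S v → v ≠ 0)
    (hS : ∀ v w, S v → S w → O.valuation ((v / w) ^ e - 1) < 1) (g : Ω ≃ₐ[C] Ω)
    (hg : ∀ x, O.valuation x < 1 → O.valuation (g x) < 1) {m : ℕ} (hm : g ^ p ^ m = 1) {v : Ω}
    (hv : S v) (hgv : S (g v)) : ¬ S (g v - v) := by
  -- The ratio of two elements of `S` is congruent to an `e`-th root of unity in `C`.
  have hroot : ∀ v w, S v → S w → ∃ c : C, c ≠ 0 ∧ O.valuation (v / w - algebraMap C Ω c) < 1 := by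
    intro v w hv hw
    obtain ⟨c, hc, hcv⟩ := exists_isRoot_of_valuation_aeval_lt (h := X ^ e - 1) hC
      (X_pow_sub_C_ne_zero he 1) (x := v / w) (by simpa using hS v w hv hw)
    refine ⟨c, ?_, hcv⟩
    rintro rfl
    simp [he.ne'] at hc
  obtain ⟨c, hc0, hc⟩ := hroot _ _ hgv hv
  have hv0 := h0 v hv
  -- `g` multiplies the leading term by the constant `c`, which it fixes, so `g ^ n` multiplies it
  -- by `c ^ n`. Hence `c ^ p ^ m = 1`, so `c = 1`, and `g v - v` has a smaller leading term than
  -- elements of `S`.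
  have hpow : ∀ n : ℕ, O.valuation ((g ^ n) v / v - algebraMap C Ω (c ^ n)) < 1 := by
    intro n
    induction n with
    | zero => simp [hv0]
    | succ n ih =>
      have e : (g ^ (n + 1)) v / v - algebraMap C Ω (c ^ (n + 1)) =
          (g v / v) * (g ((g ^ n) v / v - algebraMap C Ω (c ^ n))) +
          algebraMap C Ω (c ^ n) * (g v / v - algebraMap C Ω c) := by
        have hgv0 : g v ≠ 0 := by simpa using hv0
        rw [pow_succ', AlgEquiv.mul_apply, map_sub, map_div₀, g.commutes]
        simp only [map_pow]
        field_simp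
        ring
      rw [e]
      exact valuation_add_lt (valuation_mul_lt (mem_of_sub_algebraMap hC hc) (hg _ ih))
        (valuation_mul_lt (hC _) hc)
  have h1 := hpow (p ^ m)
  rw [hm, AlgEquiv.one_apply, div_self hv0] at h1
  have hc1 : c ^ p ^ m = 1 := by
    refine eq_of_valuation_sub_lt hC h1 ?_
    simp
  have hc1' : c = 1 := by
    have h2 : (c - 1) ^ p ^ m = 0 := by rw [sub_pow_char_pow, hc1, one_pow, sub_self]
    exact sub_eq_zero.mp (pow_eq_zero_iff (pow_pos (Fact.out : p.Prime).pos m).ne' |>.mp h2)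
  intro hd
  obtain ⟨d, hd0, hd⟩ := hroot _ _ hd hv
  apply hd0
  refine eq_of_valuation_sub_lt hC hd ?_
  rw [hc1'] at hc
  rw [sub_div, div_self hv0]
  simpa using hc

end ValuationSubring

end

/-! ### The roots of u L(v) = M(v)^Q and their behaviour where u vanishes. -/

section

open scoped Pointwise
open Polynomial

theorem IsAlgClosed.transcendental_of_notMem_range {C Ω : Type*} [Field C] [IsAlgClosed C] [Field Ω]
    [Algebra C Ω] {v : Ω} (hv : v ∉ Set.range (algebraMap C Ω)) : Transcendental C v := by
  intro halg
  apply hv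
  obtain ⟨h, h0, hh⟩ := halg
  have hs := (IsAlgClosed.splits h).eq_prod_roots
  have e : aeval v h = algebraMap C Ω h.leadingCoeff *
      (h.roots.map fun c => v - algebraMap C Ω c).prod := by
    conv_lhs => rw [hs]
    simp [map_multiset_prod, Multiset.map_map]
  rw [hh, eq_comm, mul_eq_zero, or_iff_right (by simpa using h0), Multiset.prod_eq_zero_iff,
    Multiset.mem_map] at e
  obtain ⟨c, -, hc⟩ := e
  exact ⟨c, (sub_eq_zero.mp hc).symm⟩

/-- Two additive polynomials with nonzero derivative in characteristic `p`. -/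
structure SeparableAdditivePair {K : Type*} [Field K] (p : ℕ) (L M : K[X]) : Prop where
  L_mem : L ∈ additivePolynomials K p
  M_mem : M ∈ additivePolynomials K p
  L_coeff : L.coeff 1 ≠ 0
  M_coeff : M.coeff 1 ≠ 0

namespace SeparableAdditivePair

section Field

variable {K : Type*} [Field K] {p e : ℕ} {L M : K[X]}

theorem L_ne_zero (h : SeparableAdditivePair p L M) : L ≠ 0 := by
  rintro rfl
  exact h.L_coeff (coeff_zero 1)

theorem M_ne_zero (h : SeparableAdditivePair p L M) : M ≠ 0 := by
  rintro rfl
  exact h.M_coeff (coeff_zero 1)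

theorem map (h : SeparableAdditivePair p L M) {F : Type*} [Field F] (φ : K →+* F) :
    SeparableAdditivePair p (L.map φ) (M.map φ) :=
  ⟨map_mem_additivePolynomials φ h.L_mem, map_mem_additivePolynomials φ h.M_mem,
    by simpa using h.L_coeff, by simpa using h.M_coeff⟩

theorem natDegree_M_pos (h : SeparableAdditivePair p L M) : 0 < M.natDegree :=
  lt_of_lt_of_le zero_lt_one (le_natDegree_of_ne_zero h.M_coeff)

variable [Fact p.Prime] [CharP K p]

theorem separable_M (h : SeparableAdditivePair p L M) : M.Separable := by
  rw [Polynomial.Separable, derivative_of_mem_additivePolynomials h.M_mem]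
  exact ⟨0, C (M.coeff 1)⁻¹, by rw [zero_mul, zero_add, ← C_mul, inv_mul_cancel₀ h.M_coeff, C_1]⟩

end Field

section RootSpace

variable {C Ω : Type*} [Field C] [Field Ω] [Algebra C Ω] {p : ℕ} [Fact p.Prime] [CharP Ω p]
  {L M : C[X]}

/-- The additive group of the roots `v` of `u L(v) = M(v) ^ p ^ e`. -/
def rootSpace (h : SeparableAdditivePair p L M) (e : ℕ) (u : Ω) : AddSubgroup Ω where
  carrier := {v | u * aeval v L = aeval v M ^ p ^ e}
  zero_mem' := by
    change _ = _
    rw [aeval_zero_of_mem_additivePolynomials h.L_mem,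
      aeval_zero_of_mem_additivePolynomials h.M_mem, mul_zero,
      zero_pow (pow_pos (Fact.out : p.Prime).pos e).ne']
  add_mem' {v w} hv hw := by
    change _ = _ at hv hw ⊢
    rw [aeval_add_of_mem_additivePolynomials h.L_mem, aeval_add_of_mem_additivePolynomials h.M_mem,
      add_pow_char_pow, mul_add, hv, hw]
  neg_mem' {v} hv := by
    change _ = _ at hv ⊢
    have neg : ∀ {A : C[X]}, A ∈ additivePolynomials C p → aeval (-v) A = -aeval v A := by
      intro A hA
      have := aeval_add_of_mem_additivePolynomials hA (-v) v
      rw [neg_add_cancel, aeval_zero_of_mem_additivePolynomials hA] at this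
      exact eq_neg_of_add_eq_zero_left this.symm
    rw [neg h.L_mem, neg h.M_mem, mul_neg, hv, eq_comm]
    have := add_pow_char_pow (-aeval v M) (aeval v M) (p := p) (n := e)
    rw [neg_add_cancel, zero_pow (pow_pos (Fact.out : p.Prime).pos e).ne'] at this
    exact eq_neg_of_add_eq_zero_left this.symm

theorem mem_rootSpace {h : SeparableAdditivePair p L M} {e : ℕ} {u v : Ω} :
    v ∈ h.rootSpace e u ↔ u * aeval v L = aeval v M ^ p ^ e := Iff.rfl

end RootSpace

section Geometry

variable {C Ω : Type*} [Field C] [Field Ω] [Algebra C Ω] {p : ℕ} [Fact p.Prime] [CharP Ω p]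
  {L M : C[X]} {h : SeparableAdditivePair p L M} {e : ℕ}

/-- A relation u L(c) = M(c)^Q with transcendental `u` forces both values to vanish. -/
theorem isRoot_of_algebraMap_mem {u : Ω} (hu : Transcendental C u) {c : C}
    (hc : algebraMap C Ω c ∈ h.rootSpace e u) : L.IsRoot c ∧ M.IsRoot c := by
  rw [mem_rootSpace, aeval_algebraMap_apply, aeval_algebraMap_apply] at hc
  have hL : aeval c L = 0 := by
    by_contra h0
    have h1 : algebraMap C Ω (aeval c L) ≠ 0 := by simpa using h0
    apply hu
    rw [← eq_div_iff h1] at hc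
    rw [hc, ← map_pow, ← map_div₀]
    exact isAlgebraic_algebraMap _
  have hM : aeval c M = 0 := by
    rw [hL, map_zero, mul_zero, eq_comm] at hc
    simpa using eq_zero_of_pow_eq_zero hc
  exact ⟨hL, hM⟩

theorem aeval_ne_zero_of_transcendental {v : Ω} (hv : Transcendental C v) {f : C[X]}
    (hf : f ≠ 0) : aeval v f ≠ 0 := fun h0 => hv ⟨f, hf, h0⟩

theorem ratFuncLift_algebraMap {v : Ω} (hv : Transcendental C v) (f : C[X]) :
    ratFuncLift v hv (algebraMap C[X] (RatFunc C) f) = aeval v f := by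
  have : (ratFuncLift v hv).comp (IsScalarTower.toAlgHom C C[X] (RatFunc C)) = aeval v := by
    apply Polynomial.algHom_ext
    simp
  exact DFunLike.congr_fun this f

theorem ratFuncLift_eq_of_mem (h : SeparableAdditivePair p L M) {u v : Ω}
    (hv : Transcendental C v) (hmem : v ∈ h.rootSpace e u) :
    ratFuncLift v hv (algebraMap C[X] (RatFunc C) M ^ p ^ e / algebraMap C[X] (RatFunc C) L) =
      u := by
  rw [map_div₀, map_pow, ratFuncLift_algebraMap, ratFuncLift_algebraMap,
    div_eq_iff (aeval_ne_zero_of_transcendental hv h.L_ne_zero)]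
  exact (mem_rootSpace.mp hmem).symm

theorem exists_ratFuncLift_eq (h : SeparableAdditivePair p L M) {t u v : Ω}
    (hv : Transcendental C v) (hmem : v ∈ h.rootSpace e u) (ht : Transcendental C t)
    {ψ : RatFunc C} (hψ : ratFuncLift t ht ψ = v) : ∃ χ, ratFuncLift t ht χ = u := by
  have haeval : ∀ f : C[X], aeval v f = ratFuncLift t ht (aeval ψ f) := by
    intro f
    rw [← hψ]
    exact (aeval_algHom_apply (ratFuncLift t ht) ψ f)
  refine ⟨aeval ψ M ^ p ^ e / aeval ψ L, ?_⟩
  rw [map_div₀, map_pow, ← haeval, ← haeval,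
    div_eq_iff (aeval_ne_zero_of_transcendental hv h.L_ne_zero)]
  exact (mem_rootSpace.mp hmem).symm

section Valuation

variable {O : ValuationSubring Ω} {u : Ω}

theorem exists_residue [IsAlgClosed C] (hC : ∀ c : C, algebraMap C Ω c ∈ O) (hu : O.valuation u < 1) {v : Ω}
    (hv : v ∈ h.rootSpace e u) (hvO : v ∈ O) :
    ∃ c : C, M.IsRoot c ∧ O.valuation (v - algebraMap C Ω c) < 1 := by
  apply ValuationSubring.exists_isRoot_of_valuation_aeval_lt hC h.M_ne_zero
  have h1 : O.valuation (aeval v M ^ p ^ e) < 1 := by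
    rw [← mem_rootSpace.mp hv, mul_comm]
    exact ValuationSubring.valuation_mul_lt (ValuationSubring.aeval_mem hC hvO _) hu
  rw [map_pow] at h1
  exact (pow_lt_one_iff (pow_pos (Fact.out : p.Prime).pos e).ne').mp h1

/-- For small `v` the leading terms are L(v) ~ l v and M(v) ~ m v, so v^(Q-1) ~ u l / m^Q does not
depend on `v`. The proof divides the equation by `v`. -/
theorem valuation_div_small (hC : ∀ c : C, algebraMap C Ω c ∈ O) {v w : Ω}
    (hv : v ∈ h.rootSpace e u) (hw : w ∈ h.rootSpace e u) (hu0 : u ≠ 0)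
    (hv0 : v ≠ 0) (hw0 : w ≠ 0)
    (hvO : O.valuation v < 1) (hwO : O.valuation w < 1) :
    O.valuation ((v / w) ^ (p ^ e - 1) - 1) < 1 := by
  have hpos : 0 < p ^ e := pow_pos (Fact.out : p.Prime).pos e
  have hred : ∀ v : Ω, v ∈ h.rootSpace e u → v ≠ 0 →
      u * aeval v L.divX = v ^ (p ^ e - 1) * aeval v (M.divX ^ p ^ e) := by
    intro v hv hv0
    have h1 := mem_rootSpace.mp hv
    rw [eq_divX_mul_X_of_mem_additivePolynomials h.L_mem,
      eq_divX_mul_X_of_mem_additivePolynomials h.M_mem, map_mul, map_mul, aeval_X, mul_pow] at h1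
    apply mul_right_cancel₀ hv0
    rw [map_pow, mul_assoc, h1, mul_right_comm, ← pow_succ, Nat.sub_add_cancel hpos, mul_comm]
  have hcong : ∀ v : Ω, O.valuation v < 1 → ∀ f : C[X],
      O.valuation (aeval v f - algebraMap C Ω (f.eval 0)) < 1 := fun v hv f =>
    ValuationSubring.valuation_aeval_sub_lt hC (by simpa using hv) f
  have hL0 : L.divX.eval 0 ≠ 0 := by
    rw [← coeff_zero_eq_eval_zero, coeff_divX]
    exact h.L_coeff
  have hM0 : (M.divX ^ p ^ e).eval 0 ≠ 0 := by
    rw [eval_pow, ← coeff_zero_eq_eval_zero, coeff_divX]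
    exact pow_ne_zero _ h.M_coeff
  refine ValuationSubring.valuation_sub_one_lt_of_mul_eq hC hM0 hL0 (hcong v hvO (M.divX ^ p ^ e))
    (hcong w hwO _) (hcong w hwO L.divX) (hcong v hvO _) ?_
  have e1 := hred v hv hv0
  have e2 := hred w hw hw0
  have hw1 : w ^ (p ^ e - 1) ≠ 0 := pow_ne_zero _ hw0
  rw [div_pow, div_mul_eq_mul_div, div_eq_iff hw1]
  apply mul_left_cancel₀ hu0
  linear_combination (v ^ (p ^ e - 1) * aeval v (M.divX ^ p ^ e)) * e2 -
    (w ^ (p ^ e - 1) * aeval w (M.divX ^ p ^ e)) * e1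

/-- At a pole of `v` the equation reads u l v^(deg L) ~ m^Q v^(Q deg M), so the power `deg L - Q deg
M` of `v` has a leading term independent of `v`. Reversed polynomials in `v⁻¹` make this precise. -/
theorem valuation_div_large (hC : ∀ c : C, algebraMap C Ω c ∈ O) {v w : Ω}
    (hu : O.valuation u < 1)
    (hv : v ∈ h.rootSpace e u) (hw : w ∈ h.rootSpace e u)
    (hvO : v ∉ O) (hwO : w ∉ O) :
    p ^ e * M.natDegree < L.natDegree ∧
      O.valuation ((v / w) ^ (L.natDegree - p ^ e * M.natDegree) - 1) < 1 := by
  set a := L.natDegree with ha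
  set b := p ^ e * M.natDegree with hb
  have hne : ∀ {v : Ω}, v ∉ O → v ≠ 0 := by
    rintro v hv rfl
    exact hv O.zero_mem
  have hinv : ∀ {v : Ω}, v ∉ O → O.valuation v⁻¹ < 1 := by
    intro v hv
    have h1 : 1 < O.valuation v := by
      rw [← not_le, ValuationSubring.valuation_le_one_iff]
      exact hv
    rw [map_inv₀]
    exact inv_lt_one_of_one_lt₀ h1
  have hrev : ∀ {v : Ω}, v ≠ 0 → ∀ f : C[X],
      aeval v f = v ^ f.natDegree * aeval v⁻¹ f.reverse := by
    intro v hv f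
    let _ := invertibleOfNonzero hv
    have := eval₂_reverse_mul_pow (algebraMap C Ω) v f
    rw [invOf_eq_inv] at this
    rw [aeval_def, aeval_def, ← this, mul_comm]
  have hred : ∀ {v : Ω}, v ∈ h.rootSpace e u → v ≠ 0 →
      u * (v ^ a * aeval v⁻¹ L.reverse) = v ^ b * aeval v⁻¹ (M.reverse ^ p ^ e) := by
    intro v hv hv0
    have h1 := mem_rootSpace.mp hv
    rw [hrev hv0 L, hrev hv0 M, mul_pow, ← pow_mul, mul_comm M.natDegree] at h1
    rw [h1, map_pow]
  have hcong : ∀ {v : Ω}, v ∉ O → ∀ f : C[X],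
      O.valuation (aeval v⁻¹ f - algebraMap C Ω (f.eval 0)) < 1 := fun hv f =>
    ValuationSubring.valuation_aeval_sub_lt hC (by simpa using hinv hv) f
  have hL0 : L.reverse.eval 0 ≠ 0 := by
    rw [← coeff_zero_eq_eval_zero, coeff_zero_reverse]
    exact leadingCoeff_ne_zero.mpr h.L_ne_zero
  have hM0 : (M.reverse ^ p ^ e).eval 0 ≠ 0 := by
    rw [eval_pow, ← coeff_zero_eq_eval_zero, coeff_zero_reverse]
    exact pow_ne_zero _ (leadingCoeff_ne_zero.mpr h.M_ne_zero)
  -- Otherwise `u` would have the valuation of a nonnegative power of the infinite `v`,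
  -- contradicting that `u` is small.
  have hab : b < a := by
    by_contra! hle
    have h1 := congrArg O.valuation (hred hv (hne hvO))
    rw [map_mul, map_mul, map_mul,
      ValuationSubring.valuation_eq_one_of_sub_algebraMap hC hL0 (hcong hvO _),
      ValuationSubring.valuation_eq_one_of_sub_algebraMap hC hM0 (hcong hvO _), mul_one, mul_one,
      map_pow, map_pow, ← Nat.sub_add_cancel hle, pow_add] at h1
    have hv1 : O.valuation v ^ a ≠ 0 := pow_ne_zero _ (by simpa using hne hvO)
    have h2 := mul_right_cancel₀ hv1 h1
    rw [h2] at hu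
    have h3 : 1 ≤ O.valuation v ^ (b - a) := by
      apply one_le_pow_of_one_le'
      exact (not_le.mp (fun hc => hvO ((O.valuation_le_one_iff v).mp hc))).le
    exact absurd hu (not_lt.mpr h3)
  refine ⟨hab, ?_⟩
  have hred' : ∀ {v : Ω}, v ∈ h.rootSpace e u → v ≠ 0 →
      u * v ^ (a - b) * aeval v⁻¹ L.reverse = aeval v⁻¹ (M.reverse ^ p ^ e) := by
    intro v hv hv0
    have h1 := hred hv hv0
    apply mul_left_cancel₀ (pow_ne_zero b hv0)
    rw [← h1]
    conv_rhs => rw [← Nat.sub_add_cancel hab.le, pow_add]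
    ring
  refine ValuationSubring.valuation_sub_one_lt_of_mul_eq hC hL0 hM0 (hcong hvO L.reverse)
    (hcong hwO _) (hcong hwO (M.reverse ^ p ^ e)) (hcong hvO _) ?_
  have e1 := hred' hv (hne hvO)
  have e2 := hred' hw (hne hwO)
  have hw1 : w ^ (a - b) ≠ 0 := pow_ne_zero _ (hne hwO)
  rw [div_pow, div_mul_eq_mul_div, div_eq_iff hw1, ← e1, ← e2]
  ring

end Valuation

end Geometry

end SeparableAdditivePair

end

/-! ### Galois automorphisms preserving a place, and existence of places. -/

section

open scoped Pointwise
open Polynomial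

theorem ValuationSubring.valuation_lt_one_iff_inv {Ω : Type*} [Field Ω] (O : ValuationSubring Ω)
    (x : Ω) : O.valuation x < 1 ↔ x = 0 ∨ x⁻¹ ∉ O := by
  rw [← ValuationSubring.mem_nonunits_iff]
  have := O.inv_mem_nonunits_iff (x := x⁻¹)
  rw [inv_inv, inv_eq_zero] at this
  exact this

theorem ValuationSubring.valuation_map_lt_one_iff {Ω Ω' : Type*} [Field Ω] [Field Ω']
    {O : ValuationSubring Ω} {O' : ValuationSubring Ω'} {g : Ω →+* Ω'}
    (hg : ∀ x, g x ∈ O' ↔ x ∈ O) (x : Ω) : O'.valuation (g x) < 1 ↔ O.valuation x < 1 := by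
  rw [valuation_lt_one_iff_inv, valuation_lt_one_iff_inv, map_eq_zero, ← map_inv₀, hg]

/-- The image of the variable under the structure map of an extension of the rational function
field. -/
noncomputable abbrev ratFuncVar (C Ω : Type*) [Field C] [Field Ω] [Algebra (RatFunc C) Ω] : Ω :=
  algebraMap (RatFunc C) Ω RatFunc.X

namespace SeparableAdditivePair

variable {C Ω : Type*} [Field C] [IsAlgClosed C] [Field Ω] [Algebra C Ω] [Algebra (RatFunc C) Ω]
  [IsScalarTower C (RatFunc C) Ω] {p : ℕ} [Fact p.Prime] [CharP Ω p] {L M : C[X]}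
  {h : SeparableAdditivePair p L M} {e : ℕ}

theorem exists_galois_eq [Normal (RatFunc C) Ω] {x y : Ω} (hx : x ∈ h.rootSpace e (ratFuncVar C Ω))
    (hy : y ∈ h.rootSpace e (ratFuncVar C Ω)) (hxC : x ∉ Set.range (algebraMap C Ω))
    (hyC : y ∉ Set.range (algebraMap C Ω)) : ∃ g : Ω ≃ₐ[RatFunc C] Ω, g x = y :=
  exists_galois_of_ratFuncLift_eq (IsAlgClosed.transcendental_of_notMem_range hxC)
    (IsAlgClosed.transcendental_of_notMem_range hyC) (h.ratFuncLift_eq_of_mem _ hx)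
    (h.ratFuncLift_eq_of_mem _ hy)

/-- Take `g₁` with `g₁ x = y`. The place and its image under `g₁` both lie above the zero of a
parameter `t` generating C(y), so an automorphism fixing `t`, hence `y`, moves the image back. -/
theorem exists_stabilizer_eq [FiniteDimensional (RatFunc C) Ω] [IsGalois (RatFunc C) Ω]
    {O : ValuationSubring Ω} (hC : ∀ c : C, algebraMap C Ω c ∈ O)
    {x y : Ω} (hx : x ∈ h.rootSpace e (ratFuncVar C Ω))
    (hy : y ∈ h.rootSpace e (ratFuncVar C Ω)) (hxC : x ∉ Set.range (algebraMap C Ω))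
    (hyC : y ∉ Set.range (algebraMap C Ω)) {t : Ω} (ht : Transcendental C t) {ψ : RatFunc C}
    (hψ : ratFuncLift t ht ψ = y) (htO : O.valuation t < 1)
    (hconj : ∀ g : Ω ≃ₐ[RatFunc C] Ω, g x = y → O.valuation (g.symm t) < 1) :
    ∃ g : Ω ≃ₐ[RatFunc C] Ω, g x = y ∧ ∀ z, g z ∈ O ↔ z ∈ O := by
  obtain ⟨g₁, hg₁⟩ := exists_galois_eq hx hy hxC hyC
  obtain ⟨χ, hχ⟩ := h.exists_ratFuncLift_eq (IsAlgClosed.transcendental_of_notMem_range hyC) hy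
    ht hψ
  have hconst : ∀ (g : Ω ≃ₐ[RatFunc C] Ω) (c : C), g (algebraMap C Ω c) = algebraMap C Ω c := by
    intro g c
    rw [IsScalarTower.algebraMap_apply C (RatFunc C) Ω, g.commutes]
  let O₁ : ValuationSubring Ω := O.comap (g₁.symm : Ω →+* Ω)
  have hO₁ : ∀ z, g₁.symm z ∈ O ↔ z ∈ O₁ := fun z => Iff.rfl
  have htO₁ : O₁.valuation t < 1 :=
    (ValuationSubring.valuation_map_lt_one_iff (g := (g₁.symm : Ω →+* Ω)) hO₁ t).mp (hconj g₁ hg₁)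
  have hC₁ : ∀ c : C, algebraMap C Ω c ∈ O₁ := by
    intro c
    rw [← hO₁, hconst]
    exact hC c
  obtain ⟨g₂, hg₂t, hg₂⟩ := exists_galois_conj_of_parameter ht hχ O₁ O hC₁ hC htO₁ htO
  have hg₂y : g₂ y = y := by
    have e : ((g₂.restrictScalars C : Ω ≃ₐ[C] Ω) : Ω →ₐ[C] Ω).comp (ratFuncLift t ht) =
        ratFuncLift t ht := by
      apply RatFunc.algHom_ext_X
      simp [hg₂t]
    rw [← hψ]
    exact DFunLike.congr_fun e ψ
  refine ⟨g₁.trans g₂, ?_, fun z => ?_⟩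
  · rw [AlgEquiv.trans_apply, hg₁, hg₂y]
  · rw [AlgEquiv.trans_apply, hg₂, ← hO₁, AlgEquiv.symm_apply_apply]

section Stabilizer

variable [FiniteDimensional (RatFunc C) Ω] [IsGalois (RatFunc C) Ω]
    {O : ValuationSubring Ω} (hC : ∀ c : C, algebraMap C Ω c ∈ O)
    (hu : O.valuation (ratFuncVar C Ω) < 1) {x y : Ω} (hx : x ∈ h.rootSpace e (ratFuncVar C Ω))
    (hy : y ∈ h.rootSpace e (ratFuncVar C Ω)) (hxC : x ∉ Set.range (algebraMap C Ω))
    (hyC : y ∉ Set.range (algebraMap C Ω))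
include hC hx hy hxC hyC

include hu in
theorem exists_stabilizer_small (hxO : x ∈ O) (hxy : O.valuation (y - x) < 1) :
    ∃ g : Ω ≃ₐ[RatFunc C] Ω, g x = y ∧ ∀ z, g z ∈ O ↔ z ∈ O := by
  obtain ⟨c, -, hc⟩ := exists_residue hC hu hx hxO
  have hyc : O.valuation (y - algebraMap C Ω c) < 1 := by
    simpa using ValuationSubring.valuation_add_lt hxy hc
  have ht : Transcendental C (y - algebraMap C Ω c) := by
    intro halg
    apply IsAlgClosed.transcendental_of_notMem_range hyC
    simpa using halg.add (isAlgebraic_algebraMap c)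
  refine exists_stabilizer_eq hC hx hy hxC hyC ht (ψ := RatFunc.X + algebraMap C _ c) ?_ hyc ?_
  · rw [map_add, ratFuncLift_X, AlgHom.commutes, sub_add_cancel]
  · intro g hg
    rw [map_sub, ← hg, AlgEquiv.symm_apply_apply,
      IsScalarTower.algebraMap_apply C (RatFunc C) Ω, AlgEquiv.commutes,
      ← IsScalarTower.algebraMap_apply]
    exact hc

theorem exists_stabilizer_large (hxO : x ∉ O) (hyO : y ∉ O) :
    ∃ g : Ω ≃ₐ[RatFunc C] Ω, g x = y ∧ ∀ z, g z ∈ O ↔ z ∈ O := by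
  have ht : Transcendental C y⁻¹ := by
    intro halg
    apply IsAlgClosed.transcendental_of_notMem_range hyC
    simpa using halg.inv
  refine exists_stabilizer_eq hC hx hy hxC hyC ht (ψ := RatFunc.X⁻¹) ?_ ?_ ?_
  · rw [map_inv₀, ratFuncLift_X, inv_inv]
  · rw [ValuationSubring.valuation_lt_one_iff_inv, inv_inv]
    exact Or.inr hyO
  · intro g hg
    rw [map_inv₀, ← hg, AlgEquiv.symm_apply_apply, ValuationSubring.valuation_lt_one_iff_inv,
      inv_inv]
    exact Or.inr hxO

end Stabilizer

theorem exists_galois_place [FiniteDimensional (RatFunc C) Ω] [IsGalois (RatFunc C) Ω]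
    (O O' : ValuationSubring Ω) (hO : ∀ c : C, algebraMap C Ω c ∈ O)
    (hO' : ∀ c : C, algebraMap C Ω c ∈ O') (huO : O.valuation (ratFuncVar C Ω) < 1)
    (huO' : O'.valuation (ratFuncVar C Ω) < 1) :
    ∃ g : Ω ≃ₐ[RatFunc C] Ω, ∀ z, g z ∈ O' ↔ z ∈ O := by
  obtain ⟨g, -, hg⟩ := exists_galois_conj_of_parameter (ψ := RatFunc.X) transcendental_algebraMap_X
    (by simp) O O' hO hO' huO huO'
  exact ⟨g, hg⟩

/-- A transcendental element has a place where it takes a given constant value. -/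
theorem exists_place {v : Ω} (hv : Transcendental C v) (c : C) : ∃ O : ValuationSubring Ω,
    (∀ a : C, algebraMap C Ω a ∈ O) ∧ O.valuation (v - algebraMap C Ω c) < 1 := by
  let φ : C[X] →+* Ω := (aeval (R := C) v : C[X] →+* Ω)
  have hφ : Function.Injective φ := transcendental_iff_injective.mp hv
  let I : Ideal φ.range := Ideal.span {⟨v - algebraMap C Ω c, X - Polynomial.C c, by simp [φ]⟩}
  have hI : I ≠ ⊤ := by
    rw [Ne, Ideal.span_singleton_eq_top]
    intro hunit
    obtain ⟨⟨_, f, rfl⟩, hf⟩ := hunit.exists_right_inv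
    have h1 : φ ((X - Polynomial.C c) * f) = φ 1 := by
      have := congrArg Subtype.val hf
      simpa [φ] using this
    exact not_isUnit_X_sub_C c (IsUnit.of_mul_eq_one _ (hφ h1))
  obtain ⟨O, hO, hI'⟩ := Ideal.image_subset_nonunits_valuationSubring I hI
  refine ⟨O, fun a => hO ⟨Polynomial.C a, by simp [φ]⟩, ?_⟩
  rw [← ValuationSubring.mem_nonunits_iff]
  exact hI' ⟨_, Ideal.mem_span_singleton_self _, rfl⟩

/-- At a place where v = 0, `u` is v^(Q-1) times a finite quantity, hence small as Q > 1. -/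
theorem exists_place_mem {v : Ω} (he : 1 < p ^ e) (hv : v ∈ h.rootSpace e (ratFuncVar C Ω))
    (hvC : v ∉ Set.range (algebraMap C Ω)) : ∃ O : ValuationSubring Ω,
    (∀ a : C, algebraMap C Ω a ∈ O) ∧ O.valuation (ratFuncVar C Ω) < 1 ∧ O.valuation v < 1 := by
  have htr := IsAlgClosed.transcendental_of_notMem_range hvC
  obtain ⟨O, hC, hO⟩ := exists_place htr 0
  rw [map_zero, sub_zero] at hO
  refine ⟨O, hC, ?_, hO⟩
  have h1 := mem_rootSpace.mp hv
  rw [eq_divX_mul_X_of_mem_additivePolynomials h.L_mem,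
    eq_divX_mul_X_of_mem_additivePolynomials h.M_mem, map_mul, map_mul, aeval_X, mul_pow] at h1
  have h2 := congrArg O.valuation h1
  have hL0 : L.divX.eval 0 ≠ 0 := by
    rw [← coeff_zero_eq_eval_zero, coeff_divX]
    exact h.L_coeff
  have hv0 : O.valuation v ≠ 0 := by
    rw [Ne, map_eq_zero]
    rintro rfl
    exact hvC ⟨0, map_zero _⟩
  have hm : O.valuation (aeval v M.divX ^ p ^ e) ≤ 1 :=
    (O.valuation_le_one_iff _).mpr (pow_mem (ValuationSubring.aeval_mem hC
      ((O.valuation_le_one_iff _).mp hO.le) _) _)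
  rw [map_mul, map_mul, map_mul, ValuationSubring.valuation_eq_one_of_sub_algebraMap hC hL0
      (ValuationSubring.valuation_aeval_sub_lt hC (by simpa using hO) _), one_mul,
    map_pow O.valuation v, ← pow_sub_one_mul (by omega) (O.valuation v), ← mul_assoc] at h2
  rw [mul_right_cancel₀ hv0 h2]
  have h3 : O.valuation v ^ (p ^ e - 1) < 1 := (pow_lt_one_iff (by omega)).mpr hO
  exact (mul_le_of_le_one_left' hm).trans_lt h3

theorem exists_place_residue {v : Ω} (hv : v ∈ h.rootSpace e (ratFuncVar C Ω))
    (hvC : v ∉ Set.range (algebraMap C Ω)) {c : C} (hcM : M.IsRoot c) (hcL : ¬ L.IsRoot c) :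
    ∃ O : ValuationSubring Ω, (∀ a : C, algebraMap C Ω a ∈ O) ∧
      O.valuation (ratFuncVar C Ω) < 1 ∧ O.valuation (v - algebraMap C Ω c) < 1 := by
  have htr := IsAlgClosed.transcendental_of_notMem_range hvC
  obtain ⟨O, hC, hO⟩ := exists_place htr c
  refine ⟨O, hC, ?_, hO⟩
  have h1 := congrArg O.valuation (mem_rootSpace.mp hv)
  rw [map_mul, ValuationSubring.valuation_eq_one_of_sub_algebraMap hC hcL
    (ValuationSubring.valuation_aeval_sub_lt hC hO _), mul_one, map_pow] at h1
  rw [h1, pow_lt_one_iff (pow_pos (Fact.out : p.Prime).pos e).ne']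
  have h2 := ValuationSubring.valuation_aeval_sub_lt hC hO M
  rwa [hcM.eq_zero, map_zero, sub_zero] at h2

/-- `M` has simple roots, so it would divide `L` if all of them were roots of `L`. -/
theorem exists_isRoot_not_isRoot [CharP C p] (h : SeparableAdditivePair p L M) (hML : ¬ M ∣ L) :
    ∃ c : C, M.IsRoot c ∧ ¬ L.IsRoot c := by
  by_contra! hcon
  apply hML
  apply (IsAlgClosed.splits M).dvd_of_roots_le_roots h.M_ne_zero
  rw [Multiset.le_iff_subset (nodup_roots h.separable_M)]
  intro c hc
  exact (mem_roots h.L_ne_zero).mpr (hcon c ((mem_roots h.M_ne_zero).mp hc))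

end SeparableAdditivePair

end

/-! ### Separability, degree and counting of roots. -/

section

open scoped Pointwise
open Polynomial

namespace SeparableAdditivePair

variable {C : Type*} [Field C] {p : ℕ} [Fact p.Prime] {L M : C[X]}

/-- The polynomial `u L - M ^ p ^ e` over the rational function field in `u`. -/
noncomputable def rootPoly (_ : SeparableAdditivePair p L M) (e : ℕ) : (RatFunc C)[X] :=
  Polynomial.C RatFunc.X * L.map (algebraMap C (RatFunc C)) -
    M.map (algebraMap C (RatFunc C)) ^ p ^ e

theorem separable_rootPoly [CharP C p] (h : SeparableAdditivePair p L M) {e : ℕ} (he : e ≠ 0) :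
    (h.rootPoly e).Separable := by
  have : CharP (RatFunc C) p :=
    charP_of_injective_algebraMap (algebraMap C (RatFunc C)).injective p
  have hp : ((p : ℕ) : (RatFunc C)[X]) = 0 := CharP.cast_eq_zero _ _
  have hd : derivative (h.rootPoly e) =
      Polynomial.C (RatFunc.X * algebraMap C (RatFunc C) (L.coeff 1)) := by
    rw [rootPoly, derivative_sub, derivative_C_mul, derivative_pow, derivative_map,
      derivative_of_mem_additivePolynomials h.L_mem, Nat.cast_pow, map_pow, map_natCast, hp,
      zero_pow he]
    simp
  rw [Polynomial.Separable, hd]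
  have h0 : RatFunc.X * algebraMap C (RatFunc C) (L.coeff 1) ≠ 0 :=
    mul_ne_zero RatFunc.X_ne_zero (by simpa using h.L_coeff)
  exact ⟨0, Polynomial.C (RatFunc.X * algebraMap C (RatFunc C) (L.coeff 1))⁻¹, by
    rw [zero_mul, zero_add, ← C_mul, inv_mul_cancel₀ h0, C_1]⟩

/-- The leading term of M^Q cannot cancel against a term of u L, since `u` is transcendental. -/
theorem le_natDegree_rootPoly (h : SeparableAdditivePair p L M) (e : ℕ) :
    p ^ e * M.natDegree ≤ (h.rootPoly e).natDegree := by
  apply le_natDegree_of_ne_zero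
  have hcoeff : (M.map (algebraMap C (RatFunc C)) ^ p ^ e).coeff (p ^ e * M.natDegree) =
      algebraMap C (RatFunc C) (M.leadingCoeff ^ p ^ e) := by
    rw [← Polynomial.map_pow, coeff_map, coeff_pow_mul_natDegree]
  rw [rootPoly, coeff_sub, coeff_C_mul, hcoeff, coeff_map]
  intro h0
  refine RatFunc.transcendental_X (K := C)
    ⟨Polynomial.C (L.coeff (p ^ e * M.natDegree)) * X - Polynomial.C (M.leadingCoeff ^ p ^ e),
      ?_, ?_⟩
  · intro h1
    have h2 := congrArg (fun f => coeff f 0) h1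
    simp only [coeff_sub, mul_coeff_zero, coeff_X_zero, mul_zero, coeff_C_zero, coeff_zero,
      zero_sub, neg_eq_zero] at h2
    exact pow_ne_zero _ (leadingCoeff_ne_zero.mpr h.M_ne_zero) h2
  · simp only [map_sub, map_mul, aeval_C, aeval_X]
    rw [mul_comm]
    exact h0

theorem rootPoly_ne_zero (h : SeparableAdditivePair p L M) (e : ℕ) : h.rootPoly e ≠ 0 := by
  apply ne_zero_of_natDegree_gt (n := 0)
  exact lt_of_lt_of_le (Nat.mul_pos (pow_pos (Fact.out : p.Prime).pos e) h.natDegree_M_pos)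
    (h.le_natDegree_rootPoly e)

variable {Ω : Type*} [Field Ω] [Algebra C Ω] [Algebra (RatFunc C) Ω]
  [IsScalarTower C (RatFunc C) Ω] [CharP Ω p]

theorem rootSet_rootPoly (h : SeparableAdditivePair p L M) (e : ℕ) :
    (h.rootPoly e).rootSet Ω = h.rootSpace e (ratFuncVar C Ω) := by
  ext v
  rw [mem_rootSet_of_ne (h.rootPoly_ne_zero e), SetLike.mem_coe, mem_rootSpace, rootPoly, map_sub,
    map_mul, map_pow, aeval_C, aeval_map_algebraMap, aeval_map_algebraMap, sub_eq_zero]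

instance finite_rootSpace (h : SeparableAdditivePair p L M) (e : ℕ) :
    Finite (h.rootSpace e (ratFuncVar C Ω)) := by
  have : Set.Finite (h.rootSpace e (ratFuncVar C Ω) : Set Ω) := by
    rw [← rootSet_rootPoly]
    exact rootSet_finite _ _
  exact this

theorem le_card_rootSpace [CharP C p] (h : SeparableAdditivePair p L M) {e : ℕ} (he : e ≠ 0)
    [(h.rootPoly e).IsSplittingField (RatFunc C) Ω] :
    p ^ e * M.natDegree ≤ Nat.card (h.rootSpace e (ratFuncVar C Ω)) := by
  have h1 := card_rootSet_eq_natDegree (K := Ω) (h.separable_rootPoly he)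
    (IsSplittingField.splits Ω (h.rootPoly e))
  have h2 : Nat.card (h.rootSpace e (ratFuncVar C Ω)) = (h.rootPoly e).natDegree := by
    rw [← h1, ← Nat.card_eq_fintype_card, rootSet_rootPoly]
    rfl
  rw [h2]
  exact h.le_natDegree_rootPoly e

/-- There are at least Q deg M roots, while the constant ones are roots of `M`. -/
theorem exists_mem_rootSpace_notMem_range [CharP C p] (h : SeparableAdditivePair p L M) {e : ℕ}
    (he : e ≠ 0) [(h.rootPoly e).IsSplittingField (RatFunc C) Ω] :
    ∃ v ∈ h.rootSpace e (ratFuncVar C Ω), v ∉ Set.range (algebraMap C Ω) := by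
  classical
  by_contra! hcon
  have hsub : (h.rootSpace e (ratFuncVar C Ω) : Set Ω) ⊆
      (M.roots.toFinset.image (algebraMap C Ω) : Finset Ω) := by
    intro v hv
    obtain ⟨c, rfl⟩ := hcon v hv
    rw [Finset.mem_coe]
    exact Finset.mem_image_of_mem _ (Multiset.mem_toFinset.mpr ((mem_roots h.M_ne_zero).mpr
      (isRoot_of_algebraMap_mem transcendental_algebraMap_X hv).2))
  have h1 : Nat.card (h.rootSpace e (ratFuncVar C Ω)) ≤ M.natDegree := by
    calc _ = Set.ncard (h.rootSpace e (ratFuncVar C Ω) : Set Ω) := rfl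
      _ ≤ _ := Set.ncard_le_ncard hsub (Finset.finite_toSet _)
      _ = _ := Set.ncard_coe_finset _
      _ ≤ _ := Finset.card_image_le
      _ ≤ _ := Multiset.toFinset_card_le _
      _ ≤ _ := card_roots' M
  have h2 := h.le_card_rootSpace (Ω := Ω) he
  have h3 : 1 < p ^ e := Nat.one_lt_pow he (Fact.out : p.Prime).one_lt
  have := h.natDegree_M_pos
  nlinarith

/-- Residues of the roots are roots of `M`, so at most deg M residue classes contain at least Q deg
M roots; every class embeds into the small roots by translation. -/
theorem le_card_small [CharP C p] [IsAlgClosed C] (h : SeparableAdditivePair p L M) {e : ℕ}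
    (he : e ≠ 0) [(h.rootPoly e).IsSplittingField (RatFunc C) Ω] {O : ValuationSubring Ω}
    (hC : ∀ c : C, algebraMap C Ω c ∈ O) (hu : O.valuation (ratFuncVar C Ω) < 1)
    (hO : ∀ v ∈ h.rootSpace e (ratFuncVar C Ω), v ∈ O) (U : Set Ω)
    (hU : ∀ v ∈ h.rootSpace e (ratFuncVar C Ω), O.valuation v < 1 → v ∈ U) (hfin : U.Finite) :
    p ^ e ≤ U.ncard := by
  classical
  have hV : Set.Finite (h.rootSpace e (ratFuncVar C Ω) : Set Ω) :=
    (finite_rootSpace (Ω := Ω) h e)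
  choose! r hr hrO using fun v (hv : v ∈ h.rootSpace e (ratFuncVar C Ω)) =>
    exists_residue hC hu hv (hO v hv)
  have hmaps : ∀ v ∈ hV.toFinset, r v ∈ M.roots.toFinset := by
    intro v hv
    rw [Multiset.mem_toFinset, mem_roots h.M_ne_zero]
    exact hr v (by simpa using hv)
  have hfib : ∀ c ∈ M.roots.toFinset, (hV.toFinset.filter fun v => r v = c).card ≤ U.ncard := by
    intro c _
    rcases Finset.eq_empty_or_nonempty (hV.toFinset.filter fun v => r v = c) with hemp | ⟨v, hv⟩
    · simp [hemp]
    · rw [Finset.mem_filter, Set.Finite.mem_toFinset] at hv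
      rw [← Set.ncard_coe_finset]
      refine Set.ncard_le_ncard_of_injOn (fun w => w - v) ?_ (sub_left_injective.injOn) hfin
      intro w hw
      rw [Finset.mem_coe, Finset.mem_filter, Set.Finite.mem_toFinset] at hw
      refine hU _ (sub_mem hw.1 hv.1) ?_
      have h1 := ValuationSubring.valuation_sub_lt (hrO w hw.1) (hrO v hv.1)
      rwa [hw.2, hv.2, sub_sub_sub_cancel_right] at h1
  have h1 := Finset.card_le_mul_card_image_of_maps_to hmaps _ hfib
  have h2 : hV.toFinset.card = Nat.card (h.rootSpace e (ratFuncVar C Ω)) := by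
    rw [← Set.ncard_eq_toFinset_card _ hV]
    rfl
  have h3 := h.le_card_rootSpace (Ω := Ω) he
  have h4 : M.roots.toFinset.card ≤ M.natDegree :=
    (Multiset.toFinset_card_le _).trans (card_roots' M)
  have h5 : p ^ e * M.natDegree ≤ U.ncard * M.natDegree := by
    calc _ ≤ _ := h3
      _ = _ := h2.symm
      _ ≤ _ := h1
      _ ≤ _ := Nat.mul_le_mul_left _ h4
  exact Nat.le_of_mul_le_mul_right h5 h.natDegree_M_pos

end SeparableAdditivePair

end

/-! ### Arithmetic and geometric groups acting on places and roots. -/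

section

open scoped Pointwise
open Polynomial MulAction

/-- The valuation rings of `Ω` over `C` at which the variable is not a unit. -/
abbrev ZeroPlaces (C Ω : Type*) [Field C] [Field Ω] [Algebra C Ω] [Algebra (RatFunc C) Ω] : Type _ :=
  {O : ValuationSubring Ω // (∀ c : C, algebraMap C Ω c ∈ O) ∧ O.valuation (ratFuncVar C Ω) < 1}

section Group

variable (K C Ω : Type*) [Field K] [Field C] [Field Ω] [Algebra K C] [Algebra C Ω] [Algebra K Ω]
  [Algebra (RatFunc C) Ω]

/-- The automorphisms over `K` which fix the variable. -/
noncomputable abbrev varStabilizer : Subgroup (Ω ≃ₐ[K] Ω) :=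
  stabilizer (Ω ≃ₐ[K] Ω) (ratFuncVar C Ω)

/-- The automorphisms which fix the constants and the variable. -/
noncomputable def geometricSubgroup : Subgroup (varStabilizer K C Ω) where
  carrier := {σ | ∀ c : C, (σ : Ω ≃ₐ[K] Ω) (algebraMap C Ω c) = algebraMap C Ω c}
  one_mem' := fun c => rfl
  mul_mem' {σ τ} hσ hτ := fun c => by
    rw [Subgroup.coe_mul, AlgEquiv.mul_apply, hτ c, hσ c]
  inv_mem' {σ} hσ := fun c => by
    rw [Subgroup.coe_inv, ← hσ c, ← AlgEquiv.mul_apply, inv_mul_cancel, AlgEquiv.one_apply, hσ c]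

variable {K C Ω}

theorem mem_geometricSubgroup {σ : varStabilizer K C Ω} : σ ∈ geometricSubgroup K C Ω ↔
    ∀ c : C, (σ : Ω ≃ₐ[K] Ω) (algebraMap C Ω c) = algebraMap C Ω c := Iff.rfl

theorem varStabilizer_apply_var (σ : varStabilizer K C Ω) :
    (σ : Ω ≃ₐ[K] Ω) (ratFuncVar C Ω) = ratFuncVar C Ω := σ.2

variable [IsScalarTower K C Ω]

/-- The image of a constant is algebraic over `K`, hence over the algebraically closed field `C`. -/
theorem exists_apply_algebraMap_eq [IsAlgClosed C] [Algebra.IsAlgebraic K C] (σ : Ω ≃ₐ[K] Ω)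
    (c : C) : ∃ d : C, σ (algebraMap C Ω c) = algebraMap C Ω d := by
  by_contra! hcon
  have h1 : Transcendental C (σ (algebraMap C Ω c)) := by
    apply IsAlgClosed.transcendental_of_notMem_range
    rintro ⟨d, hd⟩
    exact hcon d hd.symm
  apply h1
  have h2 : IsAlgebraic K (σ (algebraMap C Ω c)) :=
    ((Algebra.IsAlgebraic.isAlgebraic c).algebraMap).algHom (σ : Ω →ₐ[K] Ω)
  exact h2.tower_top C

theorem apply_mem_range_iff [IsAlgClosed C] [Algebra.IsAlgebraic K C] (σ : Ω ≃ₐ[K] Ω) (x : Ω) :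
    σ x ∈ Set.range (algebraMap C Ω) ↔ x ∈ Set.range (algebraMap C Ω) := by
  constructor
  · rintro ⟨c, hc⟩
    obtain ⟨d, hd⟩ := exists_apply_algebraMap_eq σ⁻¹ c
    refine ⟨d, ?_⟩
    rw [← hd, hc, ← AlgEquiv.mul_apply, inv_mul_cancel, AlgEquiv.one_apply]
  · rintro ⟨c, rfl⟩
    obtain ⟨d, hd⟩ := exists_apply_algebraMap_eq σ c
    exact ⟨d, hd.symm⟩

instance [IsAlgClosed C] [Algebra.IsAlgebraic K C] : (geometricSubgroup K C Ω).Normal := by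
  constructor
  intro g hg σ c
  obtain ⟨d, hd⟩ := exists_apply_algebraMap_eq (σ⁻¹ : Ω ≃ₐ[K] Ω) c
  simp only [Subgroup.coe_mul, Subgroup.coe_inv, AlgEquiv.mul_apply]
  rw [hd, mem_geometricSubgroup.mp hg, ← hd, ← AlgEquiv.mul_apply, mul_inv_cancel,
    AlgEquiv.one_apply]

theorem ValuationSubring.valuation_smul_lt_one_iff {O : ValuationSubring Ω} (σ : Ω ≃ₐ[K] Ω)
    (x : Ω) : (σ • O).valuation (σ x) < 1 ↔ O.valuation x < 1 :=
  ValuationSubring.valuation_map_lt_one_iff (g := (σ : Ω →+* Ω))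
    (fun _ => ValuationSubring.smul_mem_pointwise_smul_iff) x

noncomputable instance [IsAlgClosed C] [Algebra.IsAlgebraic K C] :
    MulAction (varStabilizer K C Ω) (ZeroPlaces C Ω) where
  smul σ O := ⟨(σ : Ω ≃ₐ[K] Ω) • O.1, by
    constructor
    · intro c
      obtain ⟨d, hd⟩ := exists_apply_algebraMap_eq (σ⁻¹ : Ω ≃ₐ[K] Ω) c
      rw [ValuationSubring.mem_pointwise_smul_iff_inv_smul_mem, AlgEquiv.smul_def, hd]
      exact O.2.1 d
    · have h := (ValuationSubring.valuation_smul_lt_one_iff (O := O.1) (σ : Ω ≃ₐ[K] Ω) _).mpr O.2.2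
      rwa [varStabilizer_apply_var] at h⟩
  one_smul O := Subtype.ext (one_smul _ O.1)
  mul_smul σ τ O := Subtype.ext (mul_smul (σ : Ω ≃ₐ[K] Ω) (τ : Ω ≃ₐ[K] Ω) O.1)

theorem ZeroPlaces.coe_smul [IsAlgClosed C] [Algebra.IsAlgebraic K C] (σ : varStabilizer K C Ω)
    (O : ZeroPlaces C Ω) : ((σ • O : ZeroPlaces C Ω) : ValuationSubring Ω) =
      (σ : Ω ≃ₐ[K] Ω) • (O : ValuationSubring Ω) := rfl

theorem ZeroPlaces.smul_eq_iff [IsAlgClosed C] [Algebra.IsAlgebraic K C] {σ : varStabilizer K C Ω}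
    {O O' : ZeroPlaces C Ω} : σ • O = O' ↔ ∀ x, (σ : Ω ≃ₐ[K] Ω) x ∈ O'.1 ↔ x ∈ O.1 := by
  constructor
  · rintro rfl x
    rw [ZeroPlaces.coe_smul]
    exact ValuationSubring.smul_mem_pointwise_smul_iff
  · intro h
    apply Subtype.ext
    ext x
    rw [ZeroPlaces.coe_smul, ValuationSubring.mem_pointwise_smul_iff_inv_smul_mem, ← h,
      AlgEquiv.smul_def, ← AlgEquiv.mul_apply, mul_inv_cancel, AlgEquiv.one_apply]

variable [IsScalarTower C (RatFunc C) Ω]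

theorem exists_galois_of_mem_geometricSubgroup {σ : varStabilizer K C Ω}
    (hσ : σ ∈ geometricSubgroup K C Ω) :
    ∃ g : Ω ≃ₐ[RatFunc C] Ω, ∀ x, g x = (σ : Ω ≃ₐ[K] Ω) x := by
  let f : Ω →ₐ[C] Ω := { ((σ : Ω ≃ₐ[K] Ω) : Ω →+* Ω) with commutes' := hσ }
  have e : f.comp (IsScalarTower.toAlgHom C (RatFunc C) Ω) =
      IsScalarTower.toAlgHom C (RatFunc C) Ω :=
    RatFunc.algHom_ext_X (varStabilizer_apply_var σ)
  exact ⟨AlgEquiv.ofRingEquiv (f := ((σ : Ω ≃ₐ[K] Ω) : Ω ≃+* Ω)) fun x => DFunLike.congr_fun e x,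
    fun x => rfl⟩

theorem exists_mem_geometricSubgroup (g : Ω ≃ₐ[RatFunc C] Ω) :
    ∃ σ ∈ geometricSubgroup K C Ω, ∀ x, (σ : Ω ≃ₐ[K] Ω) x = g x := by
  have hC : ∀ c : C, g (algebraMap C Ω c) = algebraMap C Ω c := by
    intro c
    rw [IsScalarTower.algebraMap_apply C (RatFunc C) Ω, g.commutes]
  let σ : Ω ≃ₐ[K] Ω := AlgEquiv.ofRingEquiv (f := (g : Ω ≃+* Ω)) fun x => by
    rw [IsScalarTower.algebraMap_apply K C Ω]
    exact hC _
  exact ⟨⟨σ, g.commutes _⟩, hC, fun x => rfl⟩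

instance [FiniteDimensional (RatFunc C) Ω] : Finite (geometricSubgroup K C Ω) := by
  choose f hf using fun σ : geometricSubgroup K C Ω => exists_galois_of_mem_geometricSubgroup σ.2
  refine Finite.of_injective f fun σ τ h => ?_
  apply Subtype.ext
  apply Subtype.ext
  ext x
  rw [← hf, ← hf, h]

end Group

namespace SeparableAdditivePair

variable {K : Type*} (C Ω : Type*) [Field K] [Field C] [Field Ω] [Algebra K C] [Algebra C Ω]
  [Algebra K Ω] [Algebra (RatFunc C) Ω] [IsScalarTower K C Ω] {p : ℕ} [Fact p.Prime] [CharP Ω p]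
  {L M : K[X]}

/-- The root space of the base change to `C`. -/
noncomputable abbrev genericRootSpace (h : SeparableAdditivePair p L M) (e : ℕ) : AddSubgroup Ω :=
  (h.map (algebraMap K C)).rootSpace e (ratFuncVar C Ω)

variable {C Ω}

theorem mem_genericRootSpace {h : SeparableAdditivePair p L M} {e : ℕ} {v : Ω} :
    v ∈ h.genericRootSpace C Ω e ↔ ratFuncVar C Ω * aeval v L = aeval v M ^ p ^ e := by
  rw [mem_rootSpace, aeval_map_algebraMap, aeval_map_algebraMap]

theorem apply_mem_genericRootSpace {h : SeparableAdditivePair p L M} {e : ℕ}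
    (σ : varStabilizer K C Ω) {v : Ω} (hv : v ∈ h.genericRootSpace C Ω e) :
    (σ : Ω ≃ₐ[K] Ω) v ∈ h.genericRootSpace C Ω e := by
  rw [mem_genericRootSpace] at hv ⊢
  have h1 := congrArg (σ : Ω ≃ₐ[K] Ω) hv
  rwa [map_mul, map_pow, varStabilizer_apply_var, ← aeval_algHom_apply,
    ← aeval_algHom_apply] at h1

instance (h : SeparableAdditivePair p L M) (e : ℕ) :
    DistribMulAction (varStabilizer K C Ω) (h.genericRootSpace C Ω e) where
  smul σ v := ⟨(σ : Ω ≃ₐ[K] Ω) v, apply_mem_genericRootSpace σ v.2⟩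
  one_smul _ := rfl
  mul_smul _ _ _ := rfl
  smul_zero σ := Subtype.ext (map_zero (σ : Ω ≃ₐ[K] Ω))
  smul_add σ v w := Subtype.ext (map_add (σ : Ω ≃ₐ[K] Ω) v.1 w.1)

theorem coe_smul {h : SeparableAdditivePair p L M} {e : ℕ} (σ : varStabilizer K C Ω)
    (v : h.genericRootSpace C Ω e) :
    ((σ • v : h.genericRootSpace C Ω e) : Ω) = (σ : Ω ≃ₐ[K] Ω) v := rfl

variable (C Ω) in
/-- The constant roots. -/
noncomputable def constantRoots (h : SeparableAdditivePair p L M) (e : ℕ) :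
    AddSubgroup (h.genericRootSpace C Ω e) :=
  (algebraMap C Ω).range.toAddSubgroup.comap (h.genericRootSpace C Ω e).subtype

/-- The roots in the maximal ideal of a place. -/
noncomputable def smallRoots (h : SeparableAdditivePair p L M) (e : ℕ) (O : ZeroPlaces C Ω) :
    AddSubgroup (h.genericRootSpace C Ω e) :=
  O.1.nonunits.toAddSubgroup.comap (h.genericRootSpace C Ω e).subtype

theorem mem_smallRoots {h : SeparableAdditivePair p L M} {e : ℕ} {O : ZeroPlaces C Ω}
    {v : h.genericRootSpace C Ω e} :
    v ∈ h.smallRoots e O ↔ O.1.valuation (v : Ω) < 1 := Iff.rfl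

/-- The roots in the valuation ring of a place. -/
noncomputable def finiteRoots (h : SeparableAdditivePair p L M) (e : ℕ) (O : ZeroPlaces C Ω) :
    AddSubgroup (h.genericRootSpace C Ω e) :=
  O.1.toSubring.toAddSubgroup.comap (h.genericRootSpace C Ω e).subtype

theorem mem_finiteRoots {h : SeparableAdditivePair p L M} {e : ℕ} {O : ZeroPlaces C Ω}
    {v : h.genericRootSpace C Ω e} :
    v ∈ h.finiteRoots e O ↔ (v : Ω) ∈ O.1 := Iff.rfl

end SeparableAdditivePair

end

/-! ### The roots and the places over u = 0 form an inertial system. -/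

section

open scoped Pointwise
open Polynomial MulAction

namespace SeparableAdditivePair

variable {K C Ω : Type*} [Field K] [Field C] [Field Ω] [Algebra K C] [Algebra C Ω]
  [Algebra K Ω] [Algebra (RatFunc C) Ω] [IsScalarTower K C Ω] [IsScalarTower C (RatFunc C) Ω]
  {p : ℕ} [Fact p.Prime] [CharP Ω p] [CharP C p] [IsAlgClosed C] [Algebra.IsAlgebraic K C]
  [FiniteDimensional (RatFunc C) Ω] [IsGalois (RatFunc C) Ω] {L M : K[X]}

theorem exists_mem_geometricSubgroup_smul_eq {h : SeparableAdditivePair p L M} {e : ℕ}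
    {O : ZeroPlaces C Ω} {x y : h.genericRootSpace C Ω e}
    (hg : ∃ g : Ω ≃ₐ[RatFunc C] Ω, g x = y ∧ ∀ z, g z ∈ O.1 ↔ z ∈ O.1) :
    ∃ g ∈ geometricSubgroup K C Ω, g • O = O ∧ g • x = y := by
  obtain ⟨g, hgx, hgO⟩ := hg
  obtain ⟨σ, hσ, hσg⟩ := exists_mem_geometricSubgroup (K := K) g
  refine ⟨σ, hσ, ZeroPlaces.smul_eq_iff.mpr fun z => ?_, Subtype.ext ?_⟩
  · rw [hσg, hgO]
  · rw [coe_smul, hσg, hgx]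

theorem not_unipotent {O : ZeroPlaces C Ω} {S : Ω → Prop} {d : ℕ} (hd : 0 < d)
    (h0 : ∀ v, S v → v ≠ 0)
    (hS : ∀ v w, S v → S w → O.1.valuation ((v / w) ^ d - 1) < 1) {g : varStabilizer K C Ω}
    (hg : g ∈ geometricSubgroup K C Ω) (hgO : g • O = O) {m : ℕ} (hm : g ^ p ^ m = 1) {v : Ω}
    (hv : S v) (hgv : S ((g : Ω ≃ₐ[K] Ω) v)) : ¬ S ((g : Ω ≃ₐ[K] Ω) v - v) := by
  obtain ⟨f, hf⟩ := exists_galois_of_mem_geometricSubgroup hg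
  have hpow : ∀ n x, (f.restrictScalars C ^ n) x = ((g ^ n : varStabilizer K C Ω) : Ω ≃ₐ[K] Ω) x := by
    intro n
    induction n with
    | zero => intro x; rfl
    | succ n ih =>
      intro x
      rw [pow_succ', pow_succ', AlgEquiv.mul_apply, Subgroup.coe_mul, AlgEquiv.mul_apply, ih]
      exact hf _
  have hf1 : f.restrictScalars C ^ p ^ m = 1 := by
    ext x
    rw [hpow, hm]
    rfl
  have hval : ∀ x, O.1.valuation x < 1 → O.1.valuation (f.restrictScalars C x) < 1 := by
    intro x hx
    have := (ValuationSubring.valuation_map_lt_one_iff (O := O.1) (O' := O.1)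
      (g := ((g : Ω ≃ₐ[K] Ω) : Ω →+* Ω)) (ZeroPlaces.smul_eq_iff.mp hgO) x).mpr hx
    rw [AlgEquiv.restrictScalars_apply, hf]
    exact this
  have key := ValuationSubring.not_of_pow_prime_pow_eq_one O.2.1 hd h0 hS (f.restrictScalars C)
    hval hf1 hv (by rw [AlgEquiv.restrictScalars_apply, hf]; exact hgv)
  rw [AlgEquiv.restrictScalars_apply, hf] at key
  exact key

theorem inertialSystem (h : SeparableAdditivePair p L M) {e : ℕ} (he : 7 ≤ p ^ e)
    (hML : ¬ M ∣ L)
    [((h.map (algebraMap K C)).rootPoly e).IsSplittingField (RatFunc C) Ω] :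
    InertialSystem p (geometricSubgroup K C Ω) (h.constantRoots C Ω e) (h.smallRoots e)
      (h.finiteRoots e) := by
  have he0 : e ≠ 0 := by
    rintro rfl
    norm_num at he
  have hsmall : ∀ (O : ZeroPlaces C Ω) (x y : h.genericRootSpace C Ω e),
      x ∈ h.finiteRoots e O → y - x ∈ h.smallRoots e O → x ∉ h.constantRoots C Ω e →
      y ∉ h.constantRoots C Ω e → ∃ g ∈ geometricSubgroup K C Ω, g • O = O ∧ g • x = y :=
    fun O x y hxO hxy hx hy => exists_mem_geometricSubgroup_smul_eq
      (exists_stabilizer_small O.2.1 O.2.2 x.2 y.2 hx hy hxO hxy)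
  -- A finite root has a constant residue, which `g` fixes.
  have hsub : ∀ O : ZeroPlaces C Ω, ∀ g ∈ geometricSubgroup K C Ω, g • O = O →
      ∀ x ∈ h.finiteRoots e O, g • x - x ∈ h.smallRoots e O := by
    intro O g hg hgO x hx
    obtain ⟨c, -, hc⟩ := exists_residue O.2.1 O.2.2 x.2 hx
    have h1 := (ValuationSubring.valuation_map_lt_one_iff (O := O.1) (O' := O.1)
      (g := ((g : Ω ≃ₐ[K] Ω) : Ω →+* Ω)) (ZeroPlaces.smul_eq_iff.mp hgO) _).mpr hc
    have h2 : ((g : Ω ≃ₐ[K] Ω) : Ω →+* Ω) (x - algebraMap C Ω c) =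
        (g : Ω ≃ₐ[K] Ω) x - algebraMap C Ω c := by
      rw [RingHom.coe_coe, map_sub, hg]
    rw [h2] at h1
    have h3 := ValuationSubring.valuation_sub_lt h1 hc
    rwa [sub_sub_sub_cancel_right] at h3
  have hfin : ∀ (O : ZeroPlaces C Ω) (g : varStabilizer K C Ω), g • O = O →
      ∀ x : Ω, (g : Ω ≃ₐ[K] Ω) x ∈ O.1 ↔ x ∈ O.1 := fun O g hgO =>
    ZeroPlaces.smul_eq_iff.mp hgO
  have hu0 : ratFuncVar C Ω ≠ 0 := by
    rw [Ne, map_eq_zero]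
    exact RatFunc.X_ne_zero
  refine
    { char_smul := fun x => Subtype.ext ?_
      smul_W := fun σ w hw => ?_
      smul_U := fun σ O x hx => ?_
      smul_A := fun σ O x hx => ?_
      fixed := fun g hg w hw => ?_
      trans := fun x y hx hy => ?_
      trans_index := fun O O' => ?_
      W_le := fun O w hw => ?_
      U_le := fun O x hx => ?_
      eq_zero := fun O x hxU hxW => ?_
      exists_small := fun O x y hx hy hxO hxy => hsmall O x y hxO hxy hx hy
      exists_large := fun O x y hx hy => ?_
      smul_sub_mem := hsub
      unipotent_fixed := fun O g hg hgO m hm x hx => ?_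
      unipotent_sub_mem := fun O g hg hgO m hm x => ?_
      cover := fun x hx => ?_
      exists_mem_notMem := ?_
      card_le := fun O hO => ?_ }
  · simp
  · exact (apply_mem_range_iff _ _).mpr hw
  · exact (ValuationSubring.valuation_smul_lt_one_iff (O := O.1) (σ : Ω ≃ₐ[K] Ω) _).mpr hx
  · exact (ZeroPlaces.smul_eq_iff (σ := σ) (O := O)).mp rfl _ |>.mpr hx
  · obtain ⟨c, hc⟩ := hw
    apply Subtype.ext
    rw [coe_smul]
    change algebraMap C Ω c = (w : Ω) at hc
    rw [← hc]
    exact hg c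
  · obtain ⟨g, hg⟩ := exists_galois_eq x.2 y.2 hx hy
    obtain ⟨σ, hσ, hσg⟩ := exists_mem_geometricSubgroup (K := K) g
    exact ⟨σ, hσ, Subtype.ext (by rw [coe_smul, hσg, hg])⟩
  · obtain ⟨g, hg⟩ := exists_galois_place O.1 O'.1 O.2.1 O'.2.1 O.2.2 O'.2.2
    obtain ⟨σ, hσ, hσg⟩ := exists_mem_geometricSubgroup (K := K) g
    exact ⟨σ, hσ, ZeroPlaces.smul_eq_iff.mpr fun z => by rw [hσg, hg]⟩
  · obtain ⟨c, hc⟩ := hw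
    change algebraMap C Ω c = (w : Ω) at hc
    rw [mem_finiteRoots, ← hc]
    exact O.2.1 c
  · exact (O.1.valuation_le_one_iff _).mp (mem_smallRoots.mp hx).le
  · obtain ⟨c, hc⟩ := hxW
    change algebraMap C Ω c = (x : Ω) at hc
    rw [mem_smallRoots, ← hc] at hxU
    apply Subtype.ext
    rw [← hc]
    by_cases hc0 : c = 0
    · rw [hc0, map_zero]
      rfl
    · rw [ValuationSubring.valuation_algebraMap_eq_one O.2.1 hc0] at hxU
      exact absurd hxU (lt_irrefl _)
  · have hxW : x ∉ h.constantRoots C Ω e := by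
      rintro ⟨c, hc⟩
      change algebraMap C Ω c = (x : Ω) at hc
      exact hx (by rw [mem_finiteRoots, ← hc]; exact O.2.1 c)
    have hyW : y ∉ h.constantRoots C Ω e := by
      rintro ⟨c, hc⟩
      change algebraMap C Ω c = (y : Ω) at hc
      exact hy (by rw [mem_finiteRoots, ← hc]; exact O.2.1 c)
    exact exists_mem_geometricSubgroup_smul_eq
      (exists_stabilizer_large O.2.1 x.2 y.2 hxW hyW hx hy)
  -- The nonzero small roots have leading terms determined up to a root of unity; were `g • x ≠ x`,
  -- the difference would be another such root.
  · by_cases hx0 : x = 0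
    · rw [hx0, smul_zero]
    by_contra hne
    have hgx : O.1.valuation ((g : Ω ≃ₐ[K] Ω) x) < 1 :=
      (ValuationSubring.valuation_map_lt_one_iff (O := O.1) (O' := O.1)
        (g := ((g : Ω ≃ₐ[K] Ω) : Ω →+* Ω)) (hfin O g hgO) _).mpr hx
    have hx0' : (x : Ω) ≠ 0 := fun h0 => hx0 (Subtype.ext h0)
    refine not_unipotent (S := fun v => v ∈ h.genericRootSpace C Ω e ∧ v ≠ 0 ∧ O.1.valuation v < 1)
      (d := p ^ e - 1) (by omega) (fun v hv => hv.2.1)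
      (fun v w hv hw => valuation_div_small O.2.1 hv.1 hw.1 hu0 hv.2.1 hw.2.1 hv.2.2 hw.2.2)
      hg hgO hm ⟨x.2, hx0', hx⟩ ⟨apply_mem_genericRootSpace g x.2, by simpa using hx0', hgx⟩
      ⟨sub_mem (apply_mem_genericRootSpace g x.2) x.2, ?_, ValuationSubring.valuation_sub_lt hgx hx⟩
    intro h0
    exact hne (Subtype.ext (sub_eq_zero.mp h0))
  -- The same argument with the infinite roots.
  · by_cases hx : (x : Ω) ∈ O.1
    · exact (O.1.valuation_le_one_iff _).mp (mem_smallRoots.mp (hsub O g hg hgO x hx)).le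
    by_contra hne
    have hlt := (valuation_div_large O.2.1 O.2.2 x.2 x.2 hx hx).1
    refine not_unipotent (S := fun v => v ∈ h.genericRootSpace C Ω e ∧ v ∉ O.1)
      (Nat.sub_pos_of_lt hlt) ?_
      (fun v w hv hw => (valuation_div_large O.2.1 O.2.2 hv.1 hw.1 hv.2 hw.2).2)
      hg hgO hm ⟨x.2, hx⟩ ⟨apply_mem_genericRootSpace g x.2, fun hgx => hx ((hfin O g hgO _).mp hgx)⟩
      ⟨sub_mem (apply_mem_genericRootSpace g x.2) x.2, hne⟩
    rintro v hv rfl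
    exact hv.2 O.1.zero_mem
  · obtain ⟨O, hC, hu, hO⟩ := exists_place_mem (by omega) x.2 hx
    exact ⟨⟨O, hC, hu⟩, hO⟩
  -- A root `c` of `M` that is not a root of `L` is the residue of some root `v` at a suitable
  -- place. A constant root congruent to `v` would equal `c` and so be a root of `L`.
  · have hML' : ¬ M.map (algebraMap K C) ∣ L.map (algebraMap K C) := by
      rwa [Polynomial.map_dvd_map']
    obtain ⟨c, hcM, hcL⟩ := exists_isRoot_not_isRoot (h.map (algebraMap K C)) hML'
    obtain ⟨v, hv, hvC⟩ := exists_mem_rootSpace_notMem_range (Ω := Ω) (h.map (algebraMap K C)) he0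
    obtain ⟨O, hC, hu, hO⟩ := exists_place_residue hv hvC hcM hcL
    refine ⟨⟨O, hC, hu⟩, ⟨v, hv⟩, ValuationSubring.mem_of_sub_algebraMap hC hO, ?_⟩
    intro hsup
    obtain ⟨a, ha, w, hw, haw⟩ := AddSubgroup.mem_sup.mp hsup
    obtain ⟨d, hd⟩ := hw
    change algebraMap C Ω d = (w : Ω) at hd
    have hvd : O.valuation (v - algebraMap C Ω d) < 1 := by
      have : (a : Ω) = v - algebraMap C Ω d := by
        rw [hd]
        exact eq_sub_of_add_eq (congrArg Subtype.val haw)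
      rw [← this]
      exact ha
    have hcd : c = d := ValuationSubring.eq_of_valuation_sub_lt hC hO hvd
    apply hcL
    rw [hcd]
    refine (isRoot_of_algebraMap_mem (transcendental_algebraMap_X (Ω := Ω)) (e := e)
      (h := h.map (algebraMap K C)) ?_).1
    rw [hd]
    exact w.2
  · have h1 := le_card_small (h.map (algebraMap K C)) he0 O.2.1 O.2.2 (fun v hv => ?_)
      (Subtype.val '' (h.smallRoots e O : Set (h.genericRootSpace C Ω e))) ?_ (Set.toFinite _)
    · rw [Set.ncard_image_of_injective _ Subtype.val_injective] at h1
      exact he.trans h1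
    · have : (⟨v, hv⟩ : h.genericRootSpace C Ω e) ∈ h.finiteRoots e O := by
        rw [hO]
        trivial
      exact this
    · intro v hv hval
      exact ⟨⟨v, hv⟩, hval, rfl⟩

end SeparableAdditivePair

end

/-! ### Lifting automorphisms of the constants, and the generic point. -/

section

open scoped Pointwise
open Polynomial MulAction

/-- An automorphism of the base field which fixes a polynomial extends to a splitting field. -/
theorem Polynomial.IsSplittingField.exists_ringHom_extension {F Ω : Type*} [Field F] [Field Ω]
    [Algebra F Ω] (f : F[X]) [f.IsSplittingField F Ω] (φ : F →+* F) (hφ : f.map φ = f) :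
    ∃ σ : Ω →+* Ω, ∀ x, σ (algebraMap F Ω x) = algebraMap F Ω (φ x) := by
  have key : ∀ (E : Type _) [Field E] [Algebra F E], (f.map (algebraMap F E)).Splits →
      ∃ σ : Ω →+* E, ∀ x, σ (algebraMap F Ω x) = algebraMap F E x := by
    intro E _ _ hE
    exact ⟨(IsSplittingField.lift Ω f hE : Ω →ₐ[F] E), fun x => AlgHom.commutes _ x⟩
  -- The target `Ω` carries the structure twisted by `φ`; `f` still splits there because `φ` fixes
  -- it.
  refine @key Ω _ ((algebraMap F Ω).comp φ).toAlgebra ?_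
  have : f.map ((algebraMap F Ω).comp φ) = f.map (algebraMap F Ω) := by
    rw [← Polynomial.map_map, hφ]
  change (f.map ((algebraMap F Ω).comp φ)).Splits
  rw [this]
  exact IsSplittingField.splits Ω f

theorem Polynomial.IsSplittingField.exists_ringEquiv_extension {F Ω : Type*} [Field F] [Field Ω]
    [Algebra F Ω] (f : F[X]) [f.IsSplittingField F Ω] (φ : F ≃+* F)
    (hφ : f.map (φ : F →+* F) = f) :
    ∃ σ : Ω ≃+* Ω, ∀ x, σ (algebraMap F Ω x) = algebraMap F Ω (φ x) := by
  have : FiniteDimensional F Ω := IsSplittingField.finiteDimensional Ω f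
  have hφ' : f.map (φ.symm : F →+* F) = f := by
    conv_lhs => rw [← hφ, Polynomial.map_map]
    simp
  obtain ⟨σ, hσ⟩ := exists_ringHom_extension (Ω := Ω) f (φ : F →+* F) hφ
  obtain ⟨τ, hτ⟩ := exists_ringHom_extension (Ω := Ω) f (φ.symm : F →+* F) hφ'
  -- σ ∘ τ is an endomorphism of the algebraic extension `Ω` over `F`, hence bijective.
  let g : Ω →ₐ[F] Ω := { σ.comp τ with commutes' := fun x => by simp [hτ, hσ] }
  have hg : Function.Surjective (σ.comp τ) :=
    (Algebra.IsAlgebraic.algHom_bijective g).2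
  have hsurj : Function.Surjective σ := fun x => by
    obtain ⟨y, hy⟩ := hg x
    exact ⟨τ y, hy⟩
  exact ⟨RingEquiv.ofBijective σ ⟨σ.injective, hsurj⟩, hσ⟩

namespace SeparableAdditivePair

section Extension

variable {K C Ω : Type*} [Field K] [Field C] [Field Ω] [Algebra K C] [Algebra C Ω]
  [Algebra K Ω] [Algebra (RatFunc C) Ω] [IsScalarTower K C Ω] [IsScalarTower C (RatFunc C) Ω]
  {p : ℕ} [Fact p.Prime] {L M : K[X]}

/-- Acting by `τ` on coefficients fixes `u` and the root polynomial, which has coefficients in K(u).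
-/
theorem exists_varStabilizer_extension (h : SeparableAdditivePair p L M) {e : ℕ}
    [((h.map (algebraMap K C)).rootPoly e).IsSplittingField (RatFunc C) Ω] (τ : C ≃ₐ[K] C) :
    ∃ σ : varStabilizer K C Ω, ∀ c, (σ : Ω ≃ₐ[K] Ω) (algebraMap C Ω c) = algebraMap C Ω (τ c) := by
  let φ : RatFunc C ≃+* RatFunc C :=
    IsFractionRing.ringEquivOfRingEquiv (A := C[X]) (B := C[X]) (mapEquiv (τ : C ≃+* C))
  have hφ : ∀ q : C[X], φ (algebraMap C[X] (RatFunc C) q) =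
      algebraMap C[X] (RatFunc C) (q.map (τ : C →+* C)) := fun q =>
    IsFractionRing.ringEquivOfRingEquiv_algebraMap _ q
  have hX : φ RatFunc.X = RatFunc.X := by
    rw [← RatFunc.algebraMap_X, hφ, map_X]
  have hc : ∀ c : C, φ (algebraMap C (RatFunc C) c) = algebraMap C (RatFunc C) (τ c) := by
    intro c
    rw [IsScalarTower.algebraMap_apply C C[X] (RatFunc C), hφ,
      IsScalarTower.algebraMap_apply C C[X] (RatFunc C)]
    simp
  have hmap : ∀ f : K[X], ((f.map (algebraMap K C)).map (algebraMap C (RatFunc C))).map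
      (φ : RatFunc C →+* RatFunc C) = (f.map (algebraMap K C)).map (algebraMap C (RatFunc C)) := by
    intro f
    simp only [Polynomial.map_map]
    congr 1
    refine RingHom.ext fun a => ?_
    change φ (algebraMap C (RatFunc C) (algebraMap K C a)) =
      algebraMap C (RatFunc C) (algebraMap K C a)
    rw [hc, τ.commutes]
  obtain ⟨σ, hσ⟩ := IsSplittingField.exists_ringEquiv_extension (Ω := Ω)
    ((h.map (algebraMap K C)).rootPoly e) φ (by
      rw [rootPoly, Polynomial.map_sub, Polynomial.map_mul, Polynomial.map_pow, map_C, hmap, hmap]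
      simp [hX])
  have hσC : ∀ c, σ (algebraMap C Ω c) = algebraMap C Ω (τ c) := by
    intro c
    rw [IsScalarTower.algebraMap_apply C (RatFunc C) Ω, hσ, hc,
      ← IsScalarTower.algebraMap_apply C (RatFunc C) Ω]
  refine ⟨⟨AlgEquiv.ofRingEquiv (f := σ) fun a => ?_, ?_⟩, hσC⟩
  · rw [IsScalarTower.algebraMap_apply K C Ω, hσC, τ.commutes]
  · change σ _ = _
    rw [hσ, hX]

end Extension

theorem exists_rational_locus_of_isSplittingField {K C Ω : Type*} [Field K] [Field C] [Algebra K C]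
    {p : ℕ} [Fact p.Prime] [CharP K p] [IsAlgClosed C] [Algebra.IsAlgebraic K C] {L M : K[X]}
    (h : SeparableAdditivePair p L M) {e : ℕ} (he : 7 ≤ p ^ e) (hML : ¬ M ∣ L)
    [Field Ω] [Algebra C Ω] [Algebra (RatFunc C) Ω] [IsScalarTower C (RatFunc C) Ω]
    [((h.map (algebraMap K C)).rootPoly e).IsSplittingField (RatFunc C) Ω] :
    ∃ x y : Ω, Transcendental C y ∧
      aeval x (L.map (algebraMap K C)) * aeval y (M.map (algebraMap K C)) ^ p ^ e =
        aeval y (L.map (algebraMap K C)) * aeval x (M.map (algebraMap K C)) ^ p ^ e ∧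
      (∃ g : Ω ≃ₐ[C] Ω, g y = y ∧ g x ≠ x) ∧
      ∀ τ : C ≃ₐ[K] C, ∃ σ : Ω ≃+* Ω, (∀ c, σ (algebraMap C Ω c) = algebraMap C Ω (τ c)) ∧
        σ x = x ∧ σ y = y := by
  have he0 : e ≠ 0 := by
    rintro rfl
    norm_num at he
  have : CharP C p := charP_of_injective_algebraMap (algebraMap K C).injective p
  have : CharP Ω p := charP_of_injective_algebraMap (algebraMap C Ω).injective p
  have : IsGalois (RatFunc C) Ω := IsGalois.of_separable_splitting_field
    (p := (h.map (algebraMap K C)).rootPoly e) ((h.map (algebraMap K C)).separable_rootPoly he0)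
  have : FiniteDimensional (RatFunc C) Ω :=
    IsSplittingField.finiteDimensional Ω ((h.map (algebraMap K C)).rootPoly e)
  let _ : Algebra K Ω := ((algebraMap C Ω).comp (algebraMap K C)).toAlgebra
  have : IsScalarTower K C Ω := IsScalarTower.of_algebraMap_eq fun _ => rfl
  have S : InertialSystem p (geometricSubgroup K C Ω) (h.constantRoots C Ω e) (h.smallRoots e)
    (h.finiteRoots e) := h.inertialSystem he hML
  obtain ⟨y, hy, hyC⟩ := exists_mem_rootSpace_notMem_range (Ω := Ω) (h.map (algebraMap K C)) he0
  have : Finite (h.genericRootSpace C Ω e) := finite_rootSpace _ _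
  obtain ⟨X, ⟨a, ha, b, hb, hab⟩, htr, hst⟩ := S.hasCanonicalOrbit (y := ⟨y, hy⟩) hyC
  have hytr := IsAlgClosed.transcendental_of_notMem_range hyC
  refine ⟨a, y, hytr, ?_, ?_, ?_⟩
  · have h1 := mem_rootSpace.mp a.2
    have h2 := mem_rootSpace.mp hy
    rw [← h1, ← h2]
    ring
  · obtain ⟨g, hg, hgy, hgab⟩ := htr a ha b hb
    obtain ⟨g', hg'⟩ := exists_galois_of_mem_geometricSubgroup hg
    refine ⟨g'.restrictScalars C, ?_, ?_⟩
    · rw [AlgEquiv.restrictScalars_apply, hg']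
      exact congrArg Subtype.val hgy
    · rw [AlgEquiv.restrictScalars_apply, hg']
      intro h1
      exact hab (hgab ▸ Subtype.ext h1.symm)
  · intro τ
    -- A lift of `τ` is corrected twice by the geometric group: `g₁` restores `y`, so the canonical
    -- orbit is preserved, and `g₂` then restores `a` while fixing `y`.
    obtain ⟨σ₁, hσ₁⟩ := h.exists_varStabilizer_extension (Ω := Ω) (e := e) τ
    obtain ⟨g₁, hg₁, hgy⟩ := S.trans (σ₁ • ⟨y, hy⟩) ⟨y, hy⟩ ((S.smul_W_iff _ _).not.mpr hyC) hyC
    have hσy : (g₁ * σ₁) • (⟨y, hy⟩ : h.genericRootSpace C Ω e) = ⟨y, hy⟩ := by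
      rw [mul_smul, hgy]
    obtain ⟨g₂, hg₂, hg₂y, hg₂a⟩ := htr _ (hst (g₁ * σ₁) hσy a ha) a ha
    let σ : varStabilizer K C Ω := g₂ * (g₁ * σ₁)
    refine ⟨((σ : Ω ≃ₐ[K] Ω) : Ω ≃+* Ω), fun c => ?_, ?_, ?_⟩
    · change (g₂ : Ω ≃ₐ[K] Ω) ((g₁ : Ω ≃ₐ[K] Ω) ((σ₁ : Ω ≃ₐ[K] Ω) (algebraMap C Ω c))) = _
      rw [hσ₁, mem_geometricSubgroup.mp hg₁, mem_geometricSubgroup.mp hg₂]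
    · have : σ • a = a := by rw [mul_smul, hg₂a]
      exact congrArg Subtype.val this
    · have : σ • (⟨y, hy⟩ : h.genericRootSpace C Ω e) = ⟨y, hy⟩ := by rw [mul_smul, hσy, hg₂y]
      exact congrArg Subtype.val this

/-- A point of the curve `L(x) M(y) ^ p ^ e = L(y) M(x) ^ p ^ e`, generic over `C`, which is not
rational over `C(y)` and whose locus over `C` is defined over `K`. -/
theorem exists_rational_locus.{u, v} {K : Type u} {C : Type v} [Field K] [Field C] [Algebra K C] {p : ℕ} [Fact p.Prime]
    [CharP K p] [IsAlgClosed C] [Algebra.IsAlgebraic K C] {L M : K[X]}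
    (h : SeparableAdditivePair p L M) {e : ℕ} (he : 7 ≤ p ^ e) (hML : ¬ M ∣ L) :
    ∃ (Ω : Type v) (_ : Field Ω) (_ : Algebra C Ω) (x y : Ω), Transcendental C y ∧
      aeval x (L.map (algebraMap K C)) * aeval y (M.map (algebraMap K C)) ^ p ^ e =
        aeval y (L.map (algebraMap K C)) * aeval x (M.map (algebraMap K C)) ^ p ^ e ∧
      (∃ g : Ω ≃ₐ[C] Ω, g y = y ∧ g x ≠ x) ∧
      ∀ τ : C ≃ₐ[K] C, ∃ σ : Ω ≃+* Ω, (∀ c, σ (algebraMap C Ω c) = algebraMap C Ω (τ c)) ∧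
        σ x = x ∧ σ y = y := by
  obtain ⟨x, y, hxy⟩ := exists_rational_locus_of_isSplittingField (C := C)
    (Ω := ((h.map (algebraMap K C)).rootPoly e).SplittingField) h he hML
  exact ⟨((h.map (algebraMap K C)).rootPoly e).SplittingField, inferInstance, inferInstance, x, y,
    hxy⟩

end SeparableAdditivePair

end

/-! ### Moore determinants and linear independence over the field of q elements. -/

section

open Polynomial

section MooreDeterminant

theorem map_mooreDet {R S : Type*} [CommRing R] [CommRing S] (φ : R →+* S) (q : ℕ) {r : ℕ}
    (x : Fin r → R) (e : Fin r → ℕ) : φ (mooreDet q x e) = mooreDet q (φ ∘ x) e := by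
  rw [mooreDet, mooreDet, RingHom.map_det]
  congr 1
  ext a b
  simp

theorem mooreDet_cons {R : Type*} [CommRing R] (q : ℕ) {r : ℕ} (x : R) (v : Fin r → R)
    (e : Fin (r + 1) → ℕ) : mooreDet q (Fin.cons x v : Fin (r + 1) → R) e =
      ∑ j : Fin (r + 1), (-1) ^ (j : ℕ) * x ^ q ^ e j * mooreDet q v (e ∘ j.succAbove) := by
  rw [mooreDet, Matrix.det_succ_row_zero]
  rfl

theorem mooreDet_cons_X {R : Type*} [CommRing R] (q : ℕ) {r : ℕ} (v : Fin r → R)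
    (e : Fin (r + 1) → ℕ) : mooreDet q (Fin.cons X (C ∘ v) : Fin (r + 1) → R[X]) e =
      ∑ j : Fin (r + 1), C ((-1) ^ (j : ℕ) * mooreDet q v (e ∘ j.succAbove)) * X ^ q ^ e j := by
  rw [mooreDet_cons]
  refine Finset.sum_congr rfl fun j _ => ?_
  rw [← map_mooreDet, C_mul, C_pow, C_neg, C_1]
  ring

theorem eval_mooreDet_cons_X {R : Type*} [CommRing R] (q : ℕ) {r : ℕ} (v : Fin r → R)
    (e : Fin (r + 1) → ℕ) (t : R) : eval t (mooreDet q (Fin.cons X (C ∘ v) : Fin (r + 1) → R[X]) e) =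
      mooreDet q (Fin.cons t v : Fin (r + 1) → R) e := by
  rw [← coe_evalRingHom, map_mooreDet]
  congr 1
  ext j
  refine Fin.cases ?_ (fun j => ?_) j <;> simp

theorem pow_pow_eq_self {R : Type*} [Monoid R] {q : ℕ} {a : R} (ha : a ^ q = a) (e : ℕ) :
    a ^ q ^ e = a := by
  induction e with
  | zero => simp
  | succ e ih => rw [pow_succ, pow_mul, ih, ha]

/-- Raising the relation to the powers `q ^ e b` keeps its coefficients, so it is a relation among
the rows of the matrix. -/
theorem mooreDet_eq_zero_of_sum_eq_zero {R : Type*} [CommRing R] [IsDomain R] {p f q : ℕ}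
    [Fact p.Prime] [CharP R p] (hq : q = p ^ f) {r : ℕ} {x c : Fin r → R} (hc0 : c ≠ 0)
    (hc : ∀ j, c j ^ q = c j) (h : ∑ j, c j * x j = 0) (e : Fin r → ℕ) : mooreDet q x e = 0 := by
  rw [mooreDet, ← Matrix.exists_vecMul_eq_zero_iff]
  refine ⟨c, hc0, ?_⟩
  ext b
  have hqe : q ^ e b = p ^ (f * e b) := by rw [hq, pow_mul]
  have h1 : (∑ j, c j * x j) ^ q ^ e b = 0 := by
    rw [h, hqe, zero_pow (pow_pos (Fact.out : p.Prime).pos _).ne']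
  rw [hqe, sum_pow_char_pow, ← hqe] at h1
  change ∑ j, c j * x j ^ q ^ e b = 0
  rw [← h1]
  refine Finset.sum_congr rfl fun j _ => ?_
  rw [mul_pow, pow_pow_eq_self (hc j)]

/-- Linear independence over the fixed points of `a ↦ a ^ q`. -/
def FrobeniusIndependent {R : Type*} (K : Type*) [Field K] [CommRing R] [Algebra K R] (q : ℕ)
    {r : ℕ} (v : Fin r → R) : Prop :=
  ∀ c : Fin r → K, (∀ j, c j ^ q = c j) → ∑ j, algebraMap K R (c j) * v j = 0 → c = 0

theorem frobeniusIndependent_of_mooreDet_ne_zero {R K : Type*} [Field K] [CommRing R] [IsDomain R]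
    [Algebra K R] {p f q : ℕ} [Fact p.Prime] [CharP R p] (hq : q = p ^ f) {r : ℕ} {v : Fin r → R}
    {e : Fin r → ℕ} (h : mooreDet q v e ≠ 0) : FrobeniusIndependent K q v := by
  intro c hc hsum
  by_contra hc0
  apply h
  refine mooreDet_eq_zero_of_sum_eq_zero hq (c := fun j => algebraMap K R (c j)) ?_ ?_ hsum e
  · intro h0
    apply hc0
    ext j
    have := congrFun h0 j
    simpa using this
  · intro j
    rw [← map_pow, hc]

section SpanPoly

variable {R K : Type*} [Field K] [Finite K] [CommRing R] [IsDomain R] [Algebra K R]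

noncomputable instance (q : ℕ) : Fintype {a : K // a ^ q = a} := Fintype.ofFinite _

variable (K) in
/-- The monic polynomial whose roots are the combinations of `v` with coefficients fixed by
`a ↦ a ^ q`. -/
noncomputable def spanPoly (q : ℕ) {r : ℕ} (v : Fin r → R) : R[X] :=
  ∏ c : Fin r → {a : K // a ^ q = a}, (X + C (∑ j, algebraMap K R (c j) * v j))

theorem spanPoly_monic (q : ℕ) {r : ℕ} (v : Fin r → R) : (spanPoly K q v).Monic :=
  monic_prod_of_monic _ _ fun _ _ => monic_X_add_C _

theorem natDegree_spanPoly {q : ℕ} (hcard : Nat.card {a : K // a ^ q = a} = q) {r : ℕ}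
    (v : Fin r → R) : (spanPoly K q v).natDegree = q ^ r := by
  rw [spanPoly, natDegree_prod_of_monic _ _ fun _ _ => monic_X_add_C _]
  simp only [natDegree_X_add_C, Finset.sum_const, smul_eq_mul, mul_one, Finset.card_univ]
  rw [Fintype.card_fun, Fintype.card_fin, ← Nat.card_eq_fintype_card, hcard]

variable {p f q : ℕ} [Fact p.Prime] [CharP R p]

theorem FrobeniusIndependent.injective (hq : q = p ^ f) {r : ℕ} {v : Fin r → R}
    (hv : FrobeniusIndependent K q v) : Function.Injective
      fun c : Fin r → {a : K // a ^ q = a} => ∑ j, algebraMap K R (c j) * v j := by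
  have : CharP K p := (algebraMap K R).charP (algebraMap K R).injective p
  intro c d hcd
  have hsub : ∀ a b : {a : K // a ^ q = a}, ((a : K) - b) ^ q = a - b := by
    rintro ⟨a, ha⟩ ⟨b, hb⟩
    subst hq
    rw [sub_pow_char_pow, ha, hb]
  have h1 := hv (fun j => (c j : K) - d j) (fun j => hsub _ _) (by
    simp only [map_sub, sub_mul, Finset.sum_sub_distrib]
    exact sub_eq_zero.mpr hcd)
  ext j
  exact sub_eq_zero.mp (congrFun h1 j)

theorem spanPoly_dvd (hq : q = p ^ f) {r : ℕ} {v : Fin r → R} (hv : FrobeniusIndependent K q v)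
    {A : R[X]} (hA : ∀ c : Fin r → {a : K // a ^ q = a},
      eval (-∑ j, algebraMap K R (c j) * v j) A = 0) : spanPoly K q v ∣ A := by
  by_cases hA0 : A = 0
  · rw [hA0]
    exact dvd_zero _
  let s : Multiset R := (Finset.univ : Finset (Fin r → {a : K // a ^ q = a})).val.map
    fun c => -∑ j, algebraMap K R (c j) * v j
  have hs : spanPoly K q v = (s.map fun a => X - C a).prod := by
    rw [spanPoly, Finset.prod, Multiset.map_map]
    simp
  rw [hs, Multiset.prod_X_sub_C_dvd_iff_le_roots hA0, Multiset.le_iff_subset]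
  · intro a ha
    obtain ⟨c, -, rfl⟩ := Multiset.mem_map.mp ha
    exact (mem_roots hA0).mpr (hA c)
  · exact Multiset.Nodup.map (neg_injective.comp (hv.injective hq)) Finset.univ.nodup

theorem mooreDet_cons_neg_sum (hq : q = p ^ f) {r : ℕ} (v : Fin r → R)
    (c : Fin r → {a : K // a ^ q = a}) (e : Fin (r + 1) → ℕ) :
    mooreDet q (Fin.cons (-∑ j, algebraMap K R (c j) * v j) v : Fin (r + 1) → R) e = 0 := by
  have hq0 : q ≠ 0 := by
    rw [hq]
    exact (pow_pos (Fact.out : p.Prime).pos f).ne'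
  refine mooreDet_eq_zero_of_sum_eq_zero hq
    (c := Fin.cons 1 fun j => algebraMap K R (c j)) ?_ ?_ ?_ e
  · intro h
    have := congrFun h 0
    simp at this
  · intro j
    refine Fin.cases ?_ (fun j => ?_) j
    · simp
    · rw [Fin.cons_succ, ← map_pow, (c j).2]
  · rw [Fin.sum_univ_succ]
    simp

theorem spanPoly_dvd_mooreDet (hq : q = p ^ f) {r : ℕ} {v : Fin r → R}
    (hv : FrobeniusIndependent K q v) (e : Fin (r + 1) → ℕ) :
    spanPoly K q v ∣ mooreDet q (Fin.cons X (C ∘ v) : Fin (r + 1) → R[X]) e := by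
  refine spanPoly_dvd hq hv fun c => ?_
  rw [eval_mooreDet_cons_X, mooreDet_cons_neg_sum hq]

/-- The determinant has degree at most `q ^ r` and is divisible by the monic `spanPoly` of exactly
that degree, so the quotient is the coefficient of X^(q^r). -/
theorem mooreDet_cons_X_eq (hq : q = p ^ f) (hf : f ≠ 0)
    (hcard : Nat.card {a : K // a ^ q = a} = q) {r : ℕ}
    {v : Fin r → R} (hv : FrobeniusIndependent K q v) :
    mooreDet q (Fin.cons X (C ∘ v) : Fin (r + 1) → R[X]) (fun b => b) =
      C ((-1) ^ r * mooreDet q v (fun b => b)) * spanPoly K q v := by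
  have hq1 : 1 < q := by
    rw [hq]
    exact Nat.one_lt_pow hf (Fact.out : p.Prime).one_lt
  obtain ⟨B, hB⟩ := spanPoly_dvd_mooreDet hq hv (fun b => b)
  set D := mooreDet q (Fin.cons X (C ∘ v) : Fin (r + 1) → R[X]) (fun b => b) with hD
  have hdeg : D.natDegree ≤ q ^ r := by
    rw [hD, mooreDet_cons_X]
    refine natDegree_sum_le_of_forall_le _ _ fun j _ => ?_
    refine (natDegree_C_mul_X_pow_le _ _).trans ?_
    exact Nat.pow_le_pow_right hq1.le (Nat.lt_succ_iff.mp j.2)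
  have hcoeff : D.coeff (q ^ r) = (-1) ^ r * mooreDet q v (fun b => b) := by
    rw [hD, mooreDet_cons_X, finsetSum_coeff, Finset.sum_eq_single (Fin.last r)]
    · rw [coeff_C_mul, coeff_X_pow, if_pos (by simp), mul_one, Fin.val_last]
      congr 2
      ext b
      simp
    · intro j _ hj
      rw [coeff_C_mul, coeff_X_pow, if_neg, mul_zero]
      intro h
      apply hj
      apply Fin.ext
      rw [Fin.val_last]
      exact (Nat.pow_right_injective hq1 h).symm
    · simp
  have hmonic := spanPoly_monic (K := K) q v
  have hB0 : B.natDegree = 0 := by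
    by_cases h0 : B = 0
    · rw [h0, natDegree_zero]
    · have h1 := hmonic.natDegree_mul' h0
      rw [← hB, natDegree_spanPoly hcard] at h1
      omega
  obtain ⟨b, rfl⟩ := natDegree_eq_zero.mp hB0
  rw [hB, mul_comm]
  congr 2
  rw [← hcoeff, hB, coeff_mul_C, ← natDegree_spanPoly hcard v, hmonic.coeff_natDegree, one_mul]

theorem FrobeniusIndependent.tail {r : ℕ} {x : R} {v : Fin r → R} (hq : q ≠ 0)
    (h : FrobeniusIndependent K q (Fin.cons x v : Fin (r + 1) → R)) :
    FrobeniusIndependent K q v := by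
  intro c hc hsum
  have h1 := h (Fin.cons 0 c) (fun j => Fin.cases (by simp [hq]) (fun j => by simp [hc]) j) (by
    rw [Fin.sum_univ_succ]
    simpa using hsum)
  ext j
  have := congrFun h1 j.succ
  simpa using this

/-- Induction by Moore's product formula, whose factors are nonzero by independence. -/
theorem FrobeniusIndependent.mooreDet_ne_zero (hq : q = p ^ f) (hf : f ≠ 0)
    (hcard : Nat.card {a : K // a ^ q = a} = q) {r : ℕ}
    {v : Fin r → R} (hv : FrobeniusIndependent K q v) : mooreDet q v (fun b => b) ≠ 0 := by
  have hq0 : q ≠ 0 := by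
    rw [hq]
    exact (pow_pos (Fact.out : p.Prime).pos f).ne'
  induction r with
  | zero => simp [mooreDet]
  | succ r ih =>
    induction v using Fin.consCases with
    | cons x v =>
      have hv' := hv.tail hq0
      rw [← eval_mooreDet_cons_X, mooreDet_cons_X_eq hq hf hcard hv', eval_mul, eval_C]
      refine mul_ne_zero (mul_ne_zero (pow_ne_zero _ (neg_ne_zero.mpr one_ne_zero)) (ih hv')) ?_
      rw [spanPoly, eval_prod]
      refine Finset.prod_ne_zero_iff.mpr fun c _ => ?_
      rw [eval_add, eval_X, eval_C]
      intro h0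
      have h1 := hv (Fin.cons 1 fun j => (c j : K)) (fun j => Fin.cases (by simp)
        (fun j => by rw [Fin.cons_succ]; exact (c j).2) j) (by
          rw [Fin.sum_univ_succ]
          simpa using h0)
      have := congrFun h1 0
      simp at this

end SpanPoly

theorem card_pow_eq_self {K : Type*} [Field K] [Finite K] {q n : ℕ} (hq : 1 < q)
    (hK : Nat.card K = q ^ n) : Nat.card {a : K // a ^ q = a} = q := by
  classical
  have := Fintype.ofFinite K
  have hn : n ≠ 0 := by
    rintro rfl
    rw [pow_zero] at hK
    exact (Finite.one_lt_card (α := K)).ne' hK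
  rw [Nat.card_eq_fintype_card] at hK
  have h0 : (X ^ q - X : K[X]) ≠ 0 := FiniteField.X_pow_card_sub_X_ne_zero K hq
  have hdvd : (X ^ q - X : K[X]) ∣ X ^ Fintype.card K - X := by
    rw [hK]
    simpa using dvd_pow_pow_sub_self_of_dvd (r := (X : K[X])) (p := q) (one_dvd n)
  have hne : (X ^ Fintype.card K - X : K[X]) ≠ 0 :=
    FiniteField.X_pow_card_sub_X_ne_zero K (hK ▸ Nat.one_lt_pow hn hq)
  have hroots : (X ^ Fintype.card K - X : K[X]).roots = Finset.univ.val :=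
    FiniteField.roots_X_pow_card_sub_X K
  have hsplit : (X ^ Fintype.card K - X : K[X]).Splits := by
    rw [splits_iff_card_roots, hroots, FiniteField.X_pow_card_sub_X_natDegree_eq K
      (hK ▸ Nat.one_lt_pow hn hq)]
    rfl
  have h1 := splits_iff_card_roots.mp (hsplit.of_dvd hne hdvd)
  rw [FiniteField.X_pow_card_sub_X_natDegree_eq K hq] at h1
  have hnodup : (X ^ q - X : K[X]).roots.Nodup := by
    refine Multiset.nodup_of_le (roots.le_of_dvd hne hdvd) ?_
    rw [hroots]
    exact Finset.univ.nodup
  have h2 : Nat.card {a : K // a ∈ (X ^ q - X : K[X]).roots.toFinset} = q := by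
    rw [Nat.card_eq_fintype_card, Fintype.card_coe, Multiset.toFinset_card_of_nodup hnodup, h1]
  conv_rhs => rw [← h2]
  refine Nat.card_congr (Equiv.subtypeEquivRight fun a => ?_)
  rw [Multiset.mem_toFinset, mem_roots h0, IsRoot, eval_sub, eval_pow, eval_X, sub_eq_zero]

end MooreDeterminant

end

/-! ### Divisibility of F by G, and Sylvester's identity. -/

section

open Polynomial

section MooreDivisibility

variable {K : Type*} [Field K] [Finite K] {p f q : ℕ} [Fact p.Prime] [CharP K p]

theorem FrobeniusIndependent.cons_X {r : ℕ} {w : Fin r → K}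
    (hw : FrobeniusIndependent K q w) :
    FrobeniusIndependent K q (Fin.cons X (C ∘ w) : Fin (r + 1) → K[X]) := by
  intro c hc hsum
  rw [Fin.sum_univ_succ] at hsum
  simp only [Fin.cons_zero, Fin.cons_succ, Function.comp_apply, algebraMap_eq, ← C_mul,
    ← map_sum] at hsum
  have h0 : c 0 = 0 := by
    have := congrArg (fun g => coeff g 1) hsum
    simpa [coeff_C] using this
  have h1 := hw (fun j => c j.succ) (fun j => hc _) (by
    rw [h0, map_zero, zero_mul, zero_add] at hsum
    refine C_injective ?_
    simpa using hsum)
  ext j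
  refine Fin.cases h0 (fun j => ?_) j
  exact congrFun h1 j

/-- The inner variable is Y, the outer one X. By Moore's formula G is, up to a unit, `spanPoly` of
`w` in Y times `spanPoly` of (Y, w) in X. The first divides every minor in the expansion of F along
the row of X; what remains still vanishes at the roots of the second, because the first factor is
nonzero and can be cancelled. -/
theorem mooreDet_dvd_mooreDet (hq : q = p ^ f) (hf : f ≠ 0)
    (hcard : Nat.card {a : K // a ^ q = a} = q) {r : ℕ} {w : Fin r → K}
    (hw : FrobeniusIndependent K q w) (e : Fin (r + 2) → ℕ) :
    mooreDet q (Fin.cons X (C ∘ (Fin.cons X (C ∘ w) : Fin (r + 1) → K[X])) :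
      Fin (r + 2) → K[X][X]) (fun b => b) ∣
    mooreDet q (Fin.cons X (C ∘ (Fin.cons X (C ∘ w) : Fin (r + 1) → K[X]))) e := by
  have hv := hw.cons_X
  have hκ : ((-1) ^ r * mooreDet q w fun b => b) ≠ 0 :=
    mul_ne_zero (pow_ne_zero _ (neg_ne_zero.mpr one_ne_zero)) (hw.mooreDet_ne_zero hq hf hcard)
  rw [mooreDet_cons_X_eq hq hf hcard hv, mooreDet_cons_X_eq hq hf hcard hw]
  choose B hB using fun e' => spanPoly_dvd_mooreDet (K := K) hq hw e'
  have hF : mooreDet q (Fin.cons X (C ∘ (Fin.cons X (C ∘ w) : Fin (r + 1) → K[X])) :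
      Fin (r + 2) → K[X][X]) e = C (spanPoly K q w) *
      ∑ j : Fin (r + 2), C ((-1) ^ (j : ℕ) * B (e ∘ j.succAbove)) * X ^ q ^ e j := by
    rw [mooreDet_cons_X, Finset.mul_sum]
    refine Finset.sum_congr rfl fun j _ => ?_
    rw [hB]
    simp only [C_mul]
    ring
  have hdvd : spanPoly K q (Fin.cons X (C ∘ w) : Fin (r + 1) → K[X]) ∣
      ∑ j : Fin (r + 2), C ((-1) ^ (j : ℕ) * B (e ∘ j.succAbove)) * X ^ q ^ e j := by
    refine spanPoly_dvd hq hv fun c => ?_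
    have h1 := congrArg
      (eval (-∑ j, algebraMap K K[X] (c j) * (Fin.cons X (C ∘ w) : Fin (r + 1) → K[X]) j)) hF
    rw [eval_mooreDet_cons_X, mooreDet_cons_neg_sum hq, eval_mul, eval_C, eq_comm, mul_eq_zero] at h1
    exact h1.resolve_left (spanPoly_monic q w).ne_zero
  have hunit : IsUnit (C ((-1) ^ (r + 1) * C ((-1) ^ r * mooreDet q w fun b => b)) : K[X][X]) := by
    refine isUnit_C.mpr (IsUnit.mul ?_ (isUnit_C.mpr hκ.isUnit))
    exact (isUnit_one.neg).pow _
  rw [← mul_assoc ((-1) ^ (r + 1)), C_mul, mul_assoc, hunit.mul_left_dvd, hF]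
  exact mul_dvd_mul_left _ hdvd

theorem curveRows_eq {m : ℕ} (z : Fin m → K) : curveRows z =
    Fin.cons (MvPolynomial.X 0) (Fin.cons (MvPolynomial.X 1)
      (MvPolynomial.C ∘ (Fin.snoc z 1 : Fin (m + 1) → K))) := by
  rw [curveRows, Fin.comp_snoc]
  simp [Function.comp_def]

theorem polyG_dvd_polyF (hq : q = p ^ f) (hf : f ≠ 0)
    (hcard : Nat.card {a : K // a ^ q = a} = q) (i : ℕ → ℕ) {m : ℕ} {z : Fin m → K}
    (hz : FrobeniusIndependent K q (Fin.snoc z 1 : Fin (m + 1) → K)) :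
    polyG q z ∣ polyF q i z := by
  let ψ : K[X][X] →+* MvPolynomial (Fin 2) K :=
    eval₂RingHom ((aeval (MvPolynomial.X 1 : MvPolynomial (Fin 2) K) :
      K[X] →ₐ[K] MvPolynomial (Fin 2) K) : K[X] →+* MvPolynomial (Fin 2) K) (MvPolynomial.X 0)
  have hrows : ψ ∘ (Fin.cons X (C ∘ (Fin.cons X (C ∘ (Fin.snoc z 1 : Fin (m + 1) → K)) :
      Fin (m + 2) → K[X])) : Fin (m + 3) → K[X][X]) = curveRows z := by
    rw [curveRows_eq]
    ext1 j
    refine Fin.cases ?_ (fun j => Fin.cases ?_ (fun j => ?_) j) j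
    · simp [ψ]
    · simp [ψ]
    · simp [ψ, MvPolynomial.algebraMap_eq]
  rw [polyG, polyF, ← hrows, ← map_mooreDet, ← map_mooreDet]
  exact map_dvd ψ (mooreDet_dvd_mooreDet hq hf hcard hz _)

end MooreDivisibility

section Sylvester

/-- The Sylvester determinant identity for a bordering by two rows and columns. -/
theorem Matrix.det_mul_det_of_isUnit {R : Type*} [CommRing R] {r : ℕ}
    (M : Matrix (Fin (r + 2)) (Fin (r + 2)) R)
    (hD : IsUnit (M.submatrix (fun a : Fin r => a.succ.succ) (fun b : Fin r => b.succ.succ)).det) :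
    (M.submatrix (fun a : Fin r => a.succ.succ) (fun b : Fin r => b.succ.succ)).det * M.det =
      (M.submatrix (Fin.cons 0 fun a : Fin r => a.succ.succ : Fin (r + 1) → Fin (r + 2))
        (Fin.cons 0 fun a : Fin r => a.succ.succ : Fin (r + 1) → Fin (r + 2))).det *
      (M.submatrix (Fin.cons 1 fun a : Fin r => a.succ.succ : Fin (r + 1) → Fin (r + 2))
        (Fin.cons 1 fun a : Fin r => a.succ.succ : Fin (r + 1) → Fin (r + 2))).det -
      (M.submatrix (Fin.cons 0 fun a : Fin r => a.succ.succ : Fin (r + 1) → Fin (r + 2))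
        (Fin.cons 1 fun a : Fin r => a.succ.succ : Fin (r + 1) → Fin (r + 2))).det *
      (M.submatrix (Fin.cons 1 fun a : Fin r => a.succ.succ : Fin (r + 1) → Fin (r + 2))
        (Fin.cons 0 fun a : Fin r => a.succ.succ : Fin (r + 1) → Fin (r + 2))).det := by
  set D := M.submatrix (fun a : Fin r => a.succ.succ) (fun b : Fin r => b.succ.succ) with hDdef
  let _ : Invertible D := D.invertibleOfIsUnitDet hD
  -- The Schur complement of `D`: each bordered minor is det D times an entry of `S`, and det M is
  -- det D times the 2 × 2 determinant of `S`.
  let S : Fin (r + 2) → Fin (r + 2) → R := fun i j =>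
    M i j - ((Matrix.of fun (_ : Unit) (b : Fin r) => M i b.succ.succ) * ⅟D *
      (Matrix.of fun (a : Fin r) (_ : Unit) => M a.succ.succ j)) () ()
  have hone : ∀ i j : Fin (r + 2),
      (M.submatrix (Fin.cons i fun a : Fin r => a.succ.succ : Fin (r + 1) → Fin (r + 2))
        (Fin.cons j fun a : Fin r => a.succ.succ : Fin (r + 1) → Fin (r + 2))).det =
      D.det * S i j := by
    intro i j
    let ε : Unit ⊕ Fin r ≃ Fin (r + 1) :=
      { toFun := Sum.elim (fun _ => 0) Fin.succ
        invFun := Fin.cases (Sum.inl ()) Sum.inr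
        left_inv := by rintro (_ | a) <;> simp
        right_inv := fun a => by refine Fin.cases ?_ (fun a => ?_) a <;> simp }
    rw [← Matrix.det_submatrix_equiv_self ε]
    have h1 : (M.submatrix (Fin.cons i fun a : Fin r => a.succ.succ : Fin (r + 1) → Fin (r + 2))
        (Fin.cons j fun a : Fin r => a.succ.succ : Fin (r + 1) → Fin (r + 2))).submatrix ε ε =
        Matrix.fromBlocks (Matrix.of fun _ _ => M i j)
          (Matrix.of fun (_ : Unit) (b : Fin r) => M i b.succ.succ)
          (Matrix.of fun (a : Fin r) (_ : Unit) => M a.succ.succ j) D := by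
      ext a b
      rcases a with a | a <;> rcases b with b | b <;> rfl
    rw [h1, Matrix.det_fromBlocks₂₂]
    congr 1
    exact Matrix.det_unique _
  have htwo : M.det = D.det * (S 0 0 * S 1 1 - S 0 1 * S 1 0) := by
    let ε : Fin 2 ⊕ Fin r ≃ Fin (r + 2) :=
      { toFun := Sum.elim ![0, 1] fun a => a.succ.succ
        invFun := Fin.cases (Sum.inl 0) (Fin.cases (Sum.inl 1) Sum.inr)
        left_inv := by
          rintro (a | a)
          · fin_cases a
            · rfl
            · rfl
          · simp
        right_inv := Fin.cases rfl (Fin.cases rfl fun _ => rfl) }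
    rw [← Matrix.det_submatrix_equiv_self ε]
    have h1 : M.submatrix ε ε = Matrix.fromBlocks
        (M.submatrix (![0, 1] : Fin 2 → Fin (r + 2)) (![0, 1] : Fin 2 → Fin (r + 2)))
        (Matrix.of fun (a : Fin 2) (b : Fin r) => M ((![0, 1] : Fin 2 → Fin (r + 2)) a) b.succ.succ)
        (Matrix.of fun (a : Fin r) (b : Fin 2) => M a.succ.succ ((![0, 1] : Fin 2 → Fin (r + 2)) b))
        D := by
      ext a b
      rcases a with a | a <;> rcases b with b | b <;> rfl
    rw [h1, Matrix.det_fromBlocks₂₂, Matrix.det_fin_two]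
    rfl
  rw [hone, hone, hone, hone, htwo]
  ring

end Sylvester

end

/-! ### The additive polynomials L and M, and separation of variables in F. -/

section

open Polynomial

section MoorePolynomials

theorem mooreDet_pow {R : Type*} [CommRing R] {p f q : ℕ} [Fact p.Prime] [CharP R p]
    (hq : q = p ^ f) {r : ℕ} (x : Fin r → R) (e : Fin r → ℕ) (t : ℕ) :
    mooreDet q x e ^ q ^ t = mooreDet q x (fun b => e b + t) := by
  have hqt : q ^ t = p ^ (f * t) := by rw [hq, pow_mul]
  rw [hqt, ← iterateFrobenius_def, map_mooreDet, mooreDet, mooreDet]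
  congr 1
  ext a b
  simp only [Matrix.of_apply, Function.comp_apply, iterateFrobenius_def, ← hqt, ← pow_mul]
  rw [pow_add, mul_comm]

variable {K : Type*} [Field K] {p f q : ℕ}

theorem mooreDet_cons_X_mem (hq : q = p ^ f) {r : ℕ} (w : Fin r → K) (e : Fin (r + 1) → ℕ) :
    mooreDet q (Fin.cons X (C ∘ w) : Fin (r + 1) → K[X]) e ∈ additivePolynomials K p := by
  rw [mooreDet_cons_X]
  refine sum_mem fun j _ => ?_
  rw [← smul_eq_C_mul]
  refine Submodule.smul_mem _ _ (Submodule.subset_span ⟨f * e j, ?_⟩)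
  simp only [hq, pow_mul]

theorem coeff_one_mooreDet_cons_X (hq : 1 < q) {r : ℕ} (w : Fin r → K) {e : Fin (r + 1) → ℕ}
    (he0 : e 0 = 0) (he : ∀ b : Fin r, 0 < e b.succ) :
    (mooreDet q (Fin.cons X (C ∘ w) : Fin (r + 1) → K[X]) e).coeff 1 =
      mooreDet q w (fun b => e b.succ) := by
  rw [mooreDet_cons_X, finsetSum_coeff, Fin.sum_univ_succ, Finset.sum_eq_zero, add_zero]
  · rw [he0, pow_zero, pow_one, coeff_C_mul, coeff_X_one, mul_one, Fin.val_zero, pow_zero, one_mul]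
    rfl
  · intro b _
    rw [coeff_C_mul, coeff_X_pow, if_neg (Nat.one_lt_pow (he b).ne' hq).ne, mul_zero]

theorem polyL_eq (q : ℕ) (i : ℕ → ℕ) {m : ℕ} (z : Fin m → K) : polyL q i z =
    mooreDet q (Fin.cons X (C ∘ (Fin.snoc z 1 : Fin (m + 1) → K)))
      (Fin.cons 0 fun b : Fin (m + 1) => i (b + 2)) := by
  rw [polyL, Fin.comp_snoc]
  simp [Function.comp_def]

theorem polyM_eq (q : ℕ) (i : ℕ → ℕ) {m : ℕ} (z : Fin m → K) : polyM q i z =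
    mooreDet q (Fin.cons X (C ∘ (Fin.snoc z 1 : Fin (m + 1) → K)))
      (Fin.cons 0 fun b : Fin (m + 1) => i (b + 2) - i 1) := by
  rw [polyM, Fin.comp_snoc]
  simp [Function.comp_def]

theorem aeval_mooreDet_cons_X {A : Type*} [CommRing A] [Algebra K A] (q : ℕ) {r : ℕ} (w : Fin r → K)
    (e : Fin (r + 1) → ℕ) (t : A) :
    aeval t (mooreDet q (Fin.cons X (C ∘ w) : Fin (r + 1) → K[X]) e) =
      mooreDet q (Fin.cons t (algebraMap K A ∘ w) : Fin (r + 1) → A) e := by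
  rw [← RingHom.coe_coe, map_mooreDet]
  congr 1
  ext j
  refine Fin.cases ?_ (fun j => ?_) j <;> simp

variable [Fact p.Prime] {i : ℕ → ℕ} {m : ℕ} {z : Fin m → K}

theorem polyN_pow [CharP K p] (hq : q = p ^ f) (hi : ∀ b : Fin (m + 1), i 1 < i (b + 2)) :
    polyN q i z ^ q ^ i 1 =
      mooreDet q (Fin.snoc z 1 : Fin (m + 1) → K) (fun b : Fin (m + 1) => i (b + 2)) := by
  rw [polyN, mooreDet_pow hq]
  congr 1
  ext b
  exact Nat.sub_add_cancel (hi b).le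

theorem separableAdditivePair_poly [CharP K p] (hq : q = p ^ f) (hf : f ≠ 0)
    (hi : ∀ b : Fin (m + 1), i 1 < i (b + 2)) (hN : polyN q i z ≠ 0) :
    SeparableAdditivePair p (polyL q i z) (polyM q i z) := by
  have hq1 : 1 < q := by
    rw [hq]
    exact Nat.one_lt_pow hf (Fact.out : p.Prime).one_lt
  refine ⟨?_, ?_, ?_, ?_⟩
  · rw [polyL_eq]
    exact mooreDet_cons_X_mem hq _ _
  · rw [polyM_eq]
    exact mooreDet_cons_X_mem hq _ _
  · rw [polyL_eq, coeff_one_mooreDet_cons_X hq1 _ rfl fun b => (Nat.zero_le _).trans_lt (hi b)]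
    simp only [Fin.cons_succ]
    rw [← polyN_pow hq hi]
    exact pow_ne_zero _ hN
  · rw [polyM_eq, coeff_one_mooreDet_cons_X hq1 _ rfl fun b => Nat.sub_pos_of_lt (hi b)]
    exact hN

/-- The curve `F = 0` separates the variables. -/
theorem polyN_pow_mul_mooreDet [CharP K p] {A : Type*} [CommRing A] [Algebra K A] [CharP A p]
    (hq : q = p ^ f) (hi0 : i 0 = 0)
    (hi : ∀ b : Fin (m + 1), i 1 < i (b + 2)) (hN : polyN q i z ≠ 0) (x y : A) :
    algebraMap K A (polyN q i z ^ q ^ i 1) *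
      mooreDet q (Fin.cons x (Fin.cons y (algebraMap K A ∘ (Fin.snoc z 1 : Fin (m + 1) → K)) :
        Fin (m + 2) → A) : Fin (m + 3) → A) (fun b => i b) =
      aeval x (polyL q i z) * aeval y (polyM q i z) ^ q ^ i 1 -
        aeval x (polyM q i z) ^ q ^ i 1 * aeval y (polyL q i z) := by
  set w : Fin (m + 1) → K := Fin.snoc z 1 with hw
  have hM : ∀ t : A, aeval t (polyM q i z) ^ q ^ i 1 =
      mooreDet q (Fin.cons t (algebraMap K A ∘ w) : Fin (m + 2) → A)
        (Fin.cons (i 1) fun b : Fin (m + 1) => i (b + 2)) := by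
    intro t
    rw [polyM_eq, aeval_mooreDet_cons_X, mooreDet_pow hq]
    congr 1
    ext b
    refine Fin.cases ?_ (fun b => ?_) b
    · simp
    · simpa using Nat.sub_add_cancel (hi b).le
  have hL : ∀ t : A, aeval t (polyL q i z) =
      mooreDet q (Fin.cons t (algebraMap K A ∘ w) : Fin (m + 2) → A)
        (Fin.cons (i 0) fun b : Fin (m + 1) => i (b + 2)) := by
    intro t
    rw [polyL_eq, aeval_mooreDet_cons_X, hi0]
  have hD : algebraMap K A (polyN q i z ^ q ^ i 1) =
      mooreDet q (algebraMap K A ∘ w) (fun b : Fin (m + 1) => i (b + 2)) := by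
    rw [polyN_pow hq hi, map_mooreDet]
  have hunit : IsUnit (algebraMap K A (polyN q i z ^ q ^ i 1)) :=
    (pow_ne_zero _ hN).isUnit.map (algebraMap K A)
  rw [hM, hM, hL, hL, hD]
  rw [hD] at hunit
  let B : Matrix (Fin (m + 3)) (Fin (m + 3)) A := Matrix.of fun a b =>
    (Fin.cons x (Fin.cons y (algebraMap K A ∘ w) : Fin (m + 2) → A) : Fin (m + 3) → A) a ^ q ^ i b
  -- The central minor is N^Q. Bordering it with column `i 0 = 0` gives L, with column `i 1` gives
  -- M^Q.
  have key := B.det_mul_det_of_isUnit hunit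
  have hsub : ∀ (s t : Fin (m + 3)) (v : A), (Fin.cons x (Fin.cons y (algebraMap K A ∘ w) :
      Fin (m + 2) → A) : Fin (m + 3) → A) s = v →
      (B.submatrix (Fin.cons s fun a : Fin (m + 1) => a.succ.succ : Fin (m + 2) → Fin (m + 3))
        (Fin.cons t fun a : Fin (m + 1) => a.succ.succ : Fin (m + 2) → Fin (m + 3))).det =
      mooreDet q (Fin.cons v (algebraMap K A ∘ w) : Fin (m + 2) → A)
        (Fin.cons (i t) fun b : Fin (m + 1) => i (b + 2)) := by
    rintro s t v rfl
    rw [mooreDet]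
    congr 1
    ext a b
    refine Fin.cases ?_ (fun a => ?_) a <;> refine Fin.cases ?_ (fun b => ?_) b <;> simp [B]
  rw [hsub 0 0 x rfl, hsub 1 1 y rfl, hsub 0 1 x rfl, hsub 1 0 y rfl] at key
  exact key

end MoorePolynomials

end

/-! ### Loci of generic points and their field of definition. -/

section

open MvPolynomial

section GenericPoint

open Polynomial in
-- By Gauss's lemma it suffices to work over the fraction field, where a polynomial coprime to `P`
-- cannot share the zero `x`.
theorem Polynomial.dvd_of_irreducible_of_eval₂_eq_zero {R Ω : Type*} [CommRing R] [IsDomain R]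
    [UniqueFactorizationMonoid R] [Field Ω] {φ : R →+* Ω} (hφ : Function.Injective φ) {x : Ω}
    {P A : R[X]} (hP : Irreducible P) (hPx : P.eval₂ φ x = 0) (hA : A.eval₂ φ x = 0) : P ∣ A := by
  have hdeg : P.natDegree ≠ 0 := by
    intro h0
    obtain ⟨a, rfl⟩ := natDegree_eq_zero.mp h0
    rw [eval₂_C, map_eq_zero_iff φ hφ] at hPx
    exact hP.ne_zero (by rw [hPx, C_0])
  have hprim := hP.isPrimitive hdeg
  let F := FractionRing R
  let ψ : F →+* Ω := IsFractionRing.lift hφ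
  have hψ : ∀ B : R[X], (B.map (algebraMap R F)).eval₂ ψ x = B.eval₂ φ x := by
    intro B
    rw [eval₂_map]
    congr 1
    ext a
    exact IsFractionRing.lift_algebraMap hφ a
  have hirr := (hprim.irreducible_iff_irreducible_map_fraction_map (K := F)).mp hP
  rw [hprim.dvd_iff_fraction_map_dvd_fraction_map F]
  by_contra hndvd
  obtain ⟨a, b, hab⟩ := (EuclideanDomain.dvd_or_coprime _ _ hirr).resolve_left hndvd
  have h1 := congrArg (eval₂ ψ x) hab
  rw [eval₂_add, eval₂_mul, eval₂_mul, hψ, hψ, hPx, hA, mul_zero, mul_zero, add_zero,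
    eval₂_one] at h1
  exact zero_ne_one h1


theorem MvPolynomial.dvd_of_irreducible_of_aeval_eq_zero {k Ω : Type*} [Field k] [Field Ω]
    [Algebra k Ω] {x y : Ω} (hy : Transcendental k y) {P A : MvPolynomial (Fin 2) k}
    (hP : Irreducible P) (hPx : aeval ![x, y] P = 0) (hA : aeval ![x, y] A = 0) : P ∣ A := by
  let φ : MvPolynomial (Fin 1) k →+* Ω := (aeval ![y] : MvPolynomial (Fin 1) k →ₐ[k] Ω)
  have hφ : Function.Injective φ :=
    algebraicIndependent_iff_injective_aeval.mp (algebraicIndependent_iff_transcendental.mpr hy)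
  have heval : ∀ B : MvPolynomial (Fin 2) k,
      (finSuccEquiv k 1 B).eval₂ φ x = aeval ![x, y] B := by
    intro B
    have : ((Polynomial.eval₂RingHom φ x).comp
        (finSuccEquiv k 1 : MvPolynomial (Fin 2) k →+* Polynomial (MvPolynomial (Fin 1) k))) =
        (aeval ![x, y] : MvPolynomial (Fin 2) k →ₐ[k] Ω) := by
      apply MvPolynomial.ringHom_ext
      · intro a
        simp [φ, finSuccEquiv_apply]
      · intro j
        refine Fin.cases ?_ (fun j => ?_) j
        · simp [finSuccEquiv_apply]
        · simp [φ, finSuccEquiv_apply]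
    exact DFunLike.congr_fun this B
  rw [← map_dvd_iff (finSuccEquiv k 1)]
  refine Polynomial.dvd_of_irreducible_of_eval₂_eq_zero hφ (x := x) ?_ ?_ ?_
  · exact (MulEquiv.irreducible_iff (finSuccEquiv k 1)).mpr hP
  · rw [heval, hPx]
  · rw [heval, hA]

theorem MvPolynomial.irreducible_of_map {σ k F : Type*} [Field k] [Field F] (φ : k →+* F)
    {P : MvPolynomial σ k} (hP : Irreducible (map φ P)) : Irreducible P := by
  have hunit : ∀ A : MvPolynomial σ k, IsUnit (map φ A) → IsUnit A := by
    intro A hA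
    rw [isUnit_iff_eq_C_of_isReduced] at hA ⊢
    obtain ⟨a, ha, hA⟩ := hA
    have h1 : A = C (coeff 0 A) := by
      apply map_injective φ φ.injective
      have h2 := congrArg (coeff 0) hA
      rw [coeff_map, coeff_zero_C] at h2
      rw [map_C, h2, hA]
    refine ⟨coeff 0 A, ?_, h1⟩
    rw [isUnit_iff_ne_zero]
    rintro h0
    rw [h0, C_0] at h1
    rw [h1, map_zero, eq_comm, C_eq_zero] at hA
    exact ha.ne_zero hA
  refine ⟨fun h => hP.not_isUnit (h.map (map φ)), fun A B hAB => ?_⟩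
  rcases hP.isUnit_or_isUnit (by rw [hAB, map_mul]) with h | h
  · exact Or.inl (hunit A h)
  · exact Or.inr (hunit B h)

theorem isAbsolutelyIrreducible_of_map.{u, v} {K : Type u} [Field K] {σ : Type v} {F : Type*}
    [Field F] [Algebra K F] [IsAlgClosed F] {P : MvPolynomial σ K}
    (hP : Irreducible (map (algebraMap K F) P)) : IsAbsolutelyIrreducible P := by
  intro E _ _ _
  let ψ : E →ₐ[K] F := IsAlgClosed.lift
  refine irreducible_of_map (ψ : E →+* F) ?_
  rw [map_map, AlgHom.comp_algebraMap]
  exact hP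

theorem exists_irreducible_dvd_aeval_eq_zero {R Ω : Type*} [CommRing R] [IsDomain R]
    [UniqueFactorizationMonoid R] [Field Ω] (φ : R →+* Ω) {A : R} (hA0 : A ≠ 0) (hA : φ A = 0) :
    ∃ P, Irreducible P ∧ φ P = 0 := by
  obtain ⟨s, hs, u, hu⟩ := UniqueFactorizationMonoid.exists_prime_factors A hA0
  have h1 : φ s.prod = 0 := by
    have h2 := congrArg φ hu
    rw [map_mul, hA, mul_eq_zero] at h2
    exact h2.resolve_right (u.isUnit.map φ).ne_zero
  rw [map_multiset_prod, Multiset.prod_eq_zero_iff, Multiset.mem_map] at h1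
  obtain ⟨P, hP, hP0⟩ := h1
  exact ⟨P, (hs P hP).irreducible, hP0⟩

/-- A polynomial associated to all its conjugates is, up to a constant, defined over the base
field. -/
theorem MvPolynomial.exists_map_eq_C_mul {σ K C : Type*} [Field K] [Field C] [Algebra K C]
    [IsGalois K C] {P : MvPolynomial σ C} (hP : P ≠ 0)
    (h : ∀ τ : C ≃ₐ[K] C, P ∣ map (τ : C →+* C) P) :
    ∃ (c : C) (A : MvPolynomial σ K), c ≠ 0 ∧ map (algebraMap K C) A = MvPolynomial.C c * P := by
  obtain ⟨d, hd⟩ := ne_zero_iff.mp hP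
  -- After one coefficient is normalised to 1, every coefficient is Galois invariant, because `P`
  -- divides its conjugates and degrees leave only constant cofactors.
  have hmem : MvPolynomial.C (coeff d P)⁻¹ * P ∈
      Set.range (map (algebraMap K C) : MvPolynomial σ K → MvPolynomial σ C) := by
    suffices ∀ b, coeff b (MvPolynomial.C (coeff d P)⁻¹ * P) ∈ Set.range (algebraMap K C) by
      choose a ha using this
      refine ⟨?_, ?_⟩
      · exact ∑ b ∈ P.support, monomial b (a b)
      · rw [map_sum]
        simp only [map_monomial, ha, coeff_C_mul]
        conv_rhs => rw [P.as_sum, Finset.mul_sum]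
        simp [C_mul_monomial]
    intro b
    rw [InfiniteGalois.mem_range_algebraMap_iff_fixed]
    intro τ
    obtain ⟨A, hA⟩ := h τ
    have hdeg : A.totalDegree = 0 := by
      have hA0 : A ≠ 0 := by
        rintro rfl
        rw [mul_zero] at hA
        exact hP (map_injective _ (RingHom.injective _) (by rw [hA, map_zero]))
      have h1 := totalDegree_mul_of_isDomain hP hA0
      have h2 : (map (τ : C →+* C) P).totalDegree ≤ P.totalDegree :=
      totalDegree_le_of_support_subset (support_map_subset _ _)
      rw [← hA] at h1
      omega
    rw [totalDegree_eq_zero_iff_eq_C] at hdeg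
    have hcoeff : ∀ b, τ (coeff b P) = coeff b P * coeff 0 A := by
      intro b
      have h1 := congrArg (coeff b) hA
      rw [coeff_map, hdeg, mul_comm, coeff_C_mul, mul_comm] at h1
      exact h1
    have hd' : τ (coeff d P) ≠ 0 := by simpa using hd
    have hA0 : coeff 0 A ≠ 0 := by
      intro h0
      rw [hcoeff, h0, mul_zero] at hd'
      exact hd' rfl
    rw [coeff_C_mul, map_mul, map_inv₀, hcoeff, hcoeff]
    field_simp
  obtain ⟨A, hA⟩ := hmem
  exact ⟨(coeff d P)⁻¹, A, inv_ne_zero hd, hA⟩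

/-- The locus of a generic point which is fixed by lifts of all Galois automorphisms is defined
over the base field. -/
theorem exists_isAbsolutelyIrreducible_of_generic {K C Ω : Type*} [Field K] [Field C] [Algebra K C]
    [IsAlgClosed C] [IsGalois K C] [Field Ω] [Algebra C Ω] [Algebra K Ω] [IsScalarTower K C Ω]
    {x y : Ω} (hy : Transcendental C y) {F : MvPolynomial (Fin 2) K} (hF0 : F ≠ 0)
    (hF : aeval ![x, y] F = 0)
    (hfix : ∀ τ : C ≃ₐ[K] C, ∃ σ : Ω ≃+* Ω,
      (∀ c, σ (algebraMap C Ω c) = algebraMap C Ω (τ c)) ∧ σ x = x ∧ σ y = y) :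
    ∃ P : MvPolynomial (Fin 2) K, IsAbsolutelyIrreducible P ∧ aeval ![x, y] P = 0 ∧
      ∀ A : MvPolynomial (Fin 2) K, aeval ![x, y] A = 0 → P ∣ A := by
  obtain ⟨P₁, hirr, hP₁⟩ := exists_irreducible_dvd_aeval_eq_zero
    ((aeval ![x, y] : MvPolynomial (Fin 2) C →ₐ[C] Ω) : MvPolynomial (Fin 2) C →+* Ω)
    (A := map (algebraMap K C) F) ((map_ne_zero_iff _ (map_injective _ (RingHom.injective _))).mpr hF0)
    (by rw [RingHom.coe_coe, aeval_map_algebraMap, hF])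
  have hdvd : ∀ τ : C ≃ₐ[K] C, P₁ ∣ map (τ : C →+* C) P₁ := by
    intro τ
    -- The lift of `τ` fixes the point, so the conjugate of `P₁` vanishes there as well.
    refine dvd_of_irreducible_of_aeval_eq_zero hy hirr hP₁ ?_
    obtain ⟨σ, hσ, hσx, hσy⟩ := hfix τ
    have h1 : ((aeval ![x, y] : MvPolynomial (Fin 2) C →ₐ[C] Ω) :
        MvPolynomial (Fin 2) C →+* Ω).comp (map (τ : C →+* C)) =
        (σ : Ω →+* Ω).comp ((aeval ![x, y] : MvPolynomial (Fin 2) C →ₐ[C] Ω) :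
        MvPolynomial (Fin 2) C →+* Ω) := by
      apply MvPolynomial.ringHom_ext
      · intro a
        simp [hσ]
      · intro j
        fin_cases j
        · simp [hσx]
        · simp [hσy]
    have h2 := DFunLike.congr_fun h1 P₁
    rw [RingHom.comp_apply, RingHom.comp_apply, hP₁, map_zero] at h2
    exact h2
  obtain ⟨c, P, hc, hP⟩ := exists_map_eq_C_mul hirr.ne_zero hdvd
  have hPirr : Irreducible (map (algebraMap K C) P) := by
    rw [hP]
    exact (irreducible_isUnit_mul ((isUnit_iff_ne_zero.mpr hc).map MvPolynomial.C)).mpr hirr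
  have hPx : aeval ![x, y] P = 0 := by
    rw [← aeval_map_algebraMap C, hP, map_mul]
    have : aeval ![x, y] P₁ = 0 := hP₁
    rw [this, mul_zero]
  have hyK : Transcendental K y := fun h => hy (h.tower_top C)
  exact ⟨P, isAbsolutelyIrreducible_of_map hPirr, hPx, fun A hA =>
    dvd_of_irreducible_of_aeval_eq_zero hyK (irreducible_of_map _ hPirr) hPx hA⟩

end GenericPoint

end

/-! ### The rational component of the curve. -/

section

open MvPolynomial

section CurveComponent

variable {K : Type*} [Field K] {q : ℕ} {m : ℕ} {z : Fin m → K}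

theorem aeval_mooreDet_curveRows [Finite K] {A : Type*} [CommRing A] [Algebra K A] (x y : A)
    (e : Fin (m + 3) → ℕ) : aeval ![x, y] (mooreDet q (curveRows z) e) =
      mooreDet q (Fin.cons x (Fin.cons y (algebraMap K A ∘ (Fin.snoc z 1 : Fin (m + 1) → K)) :
        Fin (m + 2) → A) : Fin (m + 3) → A) e := by
  rw [curveRows_eq, ← RingHom.coe_coe, map_mooreDet]
  congr 1
  ext1 j
  refine Fin.cases ?_ (fun j => Fin.cases ?_ (fun j => ?_) j) j <;> simp

variable {p f : ℕ} [Fact p.Prime] [CharP K p] {i : ℕ → ℕ}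

/-- The derivative of `F` in the first variable only depends on the second one. -/
theorem polyN_pow_mul_pderiv_polyF [Finite K] (hq : q = p ^ f) (hf : f ≠ 0) (hi0 : i 0 = 0)
    (hi1 : i 1 ≠ 0) (hi : ∀ b : Fin (m + 1), i 1 < i (b + 2)) (hN : polyN q i z ≠ 0) :
    C (polyN q i z ^ q ^ i 1) * pderiv 0 (polyF q i z) =
      C ((polyL q i z).coeff 1) * Polynomial.aeval (X 1) (polyM q i z) ^ q ^ i 1 := by
  have hpair := separableAdditivePair_poly hq hf hi hN
  have key := polyN_pow_mul_mooreDet (A := MvPolynomial (Fin 2) K) hq hi0 hi hN (X 0) (X 1)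
  have hF : polyF q i z = mooreDet q (Fin.cons (X 0) (Fin.cons (X 1)
      (algebraMap K (MvPolynomial (Fin 2) K) ∘ (Fin.snoc z 1 : Fin (m + 1) → K)) :
        Fin (m + 2) → MvPolynomial (Fin 2) K) : Fin (m + 3) → MvPolynomial (Fin 2) K)
        (fun b => i b) := by
    rw [polyF, curveRows_eq]
    rfl
  rw [← hF, algebraMap_eq] at key
  have hQ : ((q ^ i 1 : ℕ) : MvPolynomial (Fin 2) K) = 0 := by
    rw [hq, ← pow_mul, Nat.cast_pow, CharP.cast_eq_zero, zero_pow (mul_ne_zero hf hi1)]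
  -- Q-th powers have zero derivative, so differentiating the separated equation leaves only L'(X)
  -- M(Y)^Q, with L' constant.
  have hpow : ∀ A : MvPolynomial (Fin 2) K, pderiv 0 (A ^ q ^ i 1) = 0 := by
    intro A
    rw [Derivation.leibniz_pow, nsmul_eq_mul, hQ, zero_mul]
  have h0 : pderiv 0 (Polynomial.aeval (X 0 : MvPolynomial (Fin 2) K) (polyL q i z)) =
      C ((polyL q i z).coeff 1) := by
    rw [Derivation.map_aeval, derivative_of_mem_additivePolynomials hpair.L_mem, pderiv_X_self,
      Polynomial.aeval_C, smul_eq_mul, mul_one, algebraMap_eq]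
  have h1 : pderiv 0 (Polynomial.aeval (X 1 : MvPolynomial (Fin 2) K) (polyL q i z)) = 0 := by
    rw [Derivation.map_aeval, pderiv_X_of_ne (by decide), smul_zero]
  have h2 := congrArg (pderiv 0) key
  rw [pderiv_C_mul, map_sub, Derivation.leibniz, Derivation.leibniz, hpow, hpow, h0, h1] at h2
  rw [h2]
  simp [mul_comm]

theorem exists_isNonrepeatedAbsIrredComponent [Finite K] (hq : q = p ^ f) (hf : f ≠ 0)
    (hcard : Nat.card {a : K // a ^ q = a} = q) (hi0 : i 0 = 0)
    (hi : ∀ b : Fin (m + 1), i 1 < i (b + 2)) (hN : polyN q i z ≠ 0)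
    (hML : ¬ polyM q i z ∣ polyL q i z) (hQ : 7 ≤ q ^ i 1) :
    polyG q z ≠ 0 ∧ ∃ H : MvPolynomial (Fin 2) K, polyF q i z = polyG q z * H ∧
      ∃ P : MvPolynomial (Fin 2) K, IsNonrepeatedAbsIrredComponent P H := by
  have hi1 : i 1 ≠ 0 := by
    intro h0
    rw [h0, pow_zero] at hQ
    omega
  have hpair := separableAdditivePair_poly hq hf hi hN
  have hw : FrobeniusIndependent K q (Fin.snoc z 1 : Fin (m + 1) → K) :=
    frobeniusIndependent_of_mooreDet_ne_zero hq hN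
  have hqe : q ^ i 1 = p ^ (f * i 1) := by rw [hq, pow_mul]
  obtain ⟨Ω, _, _, x, y, hy, hxy, ⟨g, hgy, hgx⟩, hfix⟩ :=
    hpair.exists_rational_locus (C := AlgebraicClosure K) (hqe ▸ hQ) hML
  let _ : Algebra K Ω :=
    ((algebraMap (AlgebraicClosure K) Ω).comp (algebraMap K (AlgebraicClosure K))).toAlgebra
  have : IsScalarTower K (AlgebraicClosure K) Ω := IsScalarTower.of_algebraMap_eq fun _ => rfl
  have : CharP Ω p := charP_of_injective_algebraMap (algebraMap K Ω).injective p
  have : IsGalois K (AlgebraicClosure K) := { }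
  have hyK : Transcendental K y := fun h => hy (h.tower_top _)
  simp only [Polynomial.aeval_map_algebraMap, ← hqe] at hxy
  have hgK : ∀ a : K, g (algebraMap K Ω a) = algebraMap K Ω a := fun a => g.commutes _
  -- In a linear relation, `g` fixes every term except that of `x`, so x does not occur; y is
  -- transcendental, so it does not occur either; and N ≠ 0 makes the z's and 1 independent.
  have hind : FrobeniusIndependent K q (Fin.cons x (Fin.cons y
      (algebraMap K Ω ∘ (Fin.snoc z 1 : Fin (m + 1) → K)) : Fin (m + 2) → Ω) :
      Fin (m + 3) → Ω) := by
    intro c hc hsum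
    rw [Fin.sum_univ_succ, Fin.sum_univ_succ] at hsum
    simp only [Fin.cons_zero, Fin.cons_succ, Function.comp_apply, ← map_mul, ← map_sum] at hsum
    have hc0 : c 0 = 0 := by
      by_contra hc0
      have h1 := congrArg g hsum
      rw [map_add, map_add, map_mul, map_mul, hgK, hgK, hgK, hgy, map_zero, ← hsum,
        add_left_inj] at h1
      exact hgx (mul_left_cancel₀ (by simpa using hc0) h1)
    have hc1 : c (Fin.succ 0) = 0 := by
      by_contra hc1
      apply hyK
      rw [hc0, map_zero, zero_mul, zero_add] at hsum
      have h1 : y = algebraMap K Ω (-(∑ j, c j.succ.succ * (Fin.snoc z 1 : Fin (m + 1) → K) j) /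
          c (Fin.succ 0)) := by
        rw [map_div₀, map_neg, eq_div_iff (by simpa using hc1), mul_comm]
        exact eq_neg_of_add_eq_zero_left hsum
      rw [h1]
      exact isAlgebraic_algebraMap _
    have h2 := hw (fun j => c j.succ.succ) (fun j => hc _) (by
      rw [hc0, hc1, map_zero, zero_mul, zero_mul, zero_add, zero_add] at hsum
      simpa only [Algebra.algebraMap_self_apply, map_eq_zero] using hsum)
    ext j
    refine Fin.cases hc0 (fun j => Fin.cases hc1 (fun j => ?_) j) j
    exact congrFun h2 j
  have hGxy : aeval ![x, y] (polyG q z) ≠ 0 := by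
    rw [polyG, aeval_mooreDet_curveRows]
    exact hind.mooreDet_ne_zero hq hf hcard
  have hNΩ : algebraMap K Ω (polyN q i z ^ q ^ i 1) ≠ 0 := by
    rw [Ne, map_eq_zero]
    exact pow_ne_zero _ hN
  have hFxy : aeval ![x, y] (polyF q i z) = 0 := by
    have h1 := polyN_pow_mul_mooreDet (A := Ω) hq hi0 hi hN x y
    rw [hxy, mul_comm (Polynomial.aeval y _), sub_self] at h1
    rw [polyF, aeval_mooreDet_curveRows]
    exact (mul_eq_zero.mp h1).resolve_left hNΩ
  have hdF : aeval ![x, y] (pderiv 0 (polyF q i z)) ≠ 0 := by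
    intro h0
    have h1 := congrArg (aeval ![x, y]) (polyN_pow_mul_pderiv_polyF hq hf hi0 hi1 hi hN)
    rw [map_mul, map_mul, h0, mul_zero, map_pow, ← Polynomial.aeval_algHom_apply] at h1
    simp only [aeval_X, aeval_C, Matrix.cons_val_one, Matrix.cons_val_fin_one] at h1
    have h2 : algebraMap K Ω ((polyL q i z).coeff 1) ≠ 0 := by simpa using hpair.L_coeff
    have h3 : Polynomial.aeval y (polyM q i z) ≠ 0 := fun h => hyK ⟨_, hpair.M_ne_zero, h⟩
    exact mul_ne_zero h2 (pow_ne_zero _ h3) h1.symm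
  have hF0 : polyF q i z ≠ 0 := by
    intro h0
    rw [h0, map_zero, map_zero] at hdF
    exact hdF rfl
  obtain ⟨H, hH⟩ := polyG_dvd_polyF hq hf hcard i hw
  have hHxy : aeval ![x, y] H = 0 := by
    rw [hH, map_mul] at hFxy
    exact (mul_eq_zero.mp hFxy).resolve_left hGxy
  obtain ⟨P, hP, hPxy, hPdvd⟩ := exists_isAbsolutelyIrreducible_of_generic hy hF0 hFxy hfix
  refine ⟨fun h0 => hGxy (by rw [h0, map_zero]), H, hH, P, hP, hPdvd H hHxy, ?_⟩
  -- If P² divided H, then ∂F/∂X would vanish at the generic point.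
  rintro ⟨R, hR⟩
  apply hdF
  rw [hH, hR, Derivation.leibniz, Derivation.leibniz, Derivation.leibniz_pow]
  simp [hPxy]

end CurveComponent

end

theorem theorem4p4 (q n k : ℕ) (hq : IsPrimePow q) (hk : 3 < k)
    {K : Type*} [Field K] [Finite K] (hK : Nat.card K = q ^ n)
    (i : ℕ → ℕ) (hi0 : i 0 = 0) (hi : StrictMonoOn i (Set.Iio k))
    (z : Fin (k - 3) → K)
    (hN : polyN q i z ≠ 0)
    (hML : ¬ polyM q i z ∣ polyL q i z)
    (hcond : 7 ≤ q ∨ ((q = 3 ∨ q = 4 ∨ q = 5) ∧ 1 < i 1) ∨ (q = 2 ∧ 2 < i 1)) :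
    polyG q z ≠ 0 ∧ ∃ H : MvPolynomial (Fin 2) K, polyF q i z = polyG q z * H ∧
      ∃ P : MvPolynomial (Fin 2) K, IsNonrepeatedAbsIrredComponent P H := by
  have hcard := card_pow_eq_self hq.one_lt hK
  have h01 : i 0 < i 1 := hi (by simp; omega) (by simp; omega) zero_lt_one
  -- The numerical hypotheses enter only through Q ≥ 7.
  have hQ : 7 ≤ q ^ i 1 := by
    rcases hcond with h | ⟨h, h1⟩ | ⟨rfl, h1⟩
    · exact h.trans (Nat.le_self_pow (by omega) q)
    · have h3 : 3 ≤ q := by omega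
      calc 7 ≤ 3 ^ 2 := by norm_num
        _ ≤ q ^ 2 := Nat.pow_le_pow_left h3 2
        _ ≤ q ^ i 1 := Nat.pow_le_pow_right (by omega) h1
    · calc 7 ≤ 2 ^ 3 := by norm_num
        _ ≤ 2 ^ i 1 := Nat.pow_le_pow_right (by norm_num) h1
  obtain ⟨p, f, hp, hf, hpq⟩ := hq
  have : Fact p.Prime := ⟨hp.nat_prime⟩
  have : CharP K p := by
    have := Fintype.ofFinite K
    refine charP_of_card_eq_prime_pow (f := f * n) ?_
    rw [← Nat.card_eq_fintype_card, hK, ← hpq, pow_mul]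
  refine exists_isNonrepeatedAbsIrredComponent hpq.symm hf.ne' hcard hi0 (fun b => ?_) hN hML hQ
  exact hi (by simp; omega) (by simp; omega) (by omega)
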